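/- Let $L>0$ and $\Omega=(-L,0)$, with outward normal derivative $\partial_\nu$ ($\partial_\nu=\partial_x$ at $x=0$ and $\partial_\nu=-\partial_x$ at $x=-L$), and let $X$ be the closure of $\mathcal D(\overline\Omega)$ for the norm $(\|u\|_{L^2(\Omega)}^2+\varepsilon\|u\|_{L^2(\partial\Omega)}^2)^{1/2}$, that is $X=L^2(-L,0)\times\mathbb R^2$, the last two components being the boundary values at $0$ and $-L$. For $\varepsilon,T>0$ and $\varphi_T\in X$ let $\varphi\in C([0,T],X)$ be the (mild, i.e. semigroup) solution of the adjoint system $$(S')\quad \varphi_t+\varphi_x+\varepsilon\varphi_{xx}=0 \text{ in }(0,T)\times(-L,0),\quad \varepsilon(\varphi_t-\partial_\nu\varphi)-\varphi=0\text{ at }x=0,\quad \varphi_t-\partial_\nu\varphi=0\text{ at }x=-L,\quad \varphi(T,\cdot)=\varphi_T .$$ Fix a constant $K>e^{2L}$ and set $$\alpha(t,x)=\frac{K-e^{2L+x}}{\varepsilon^2t(T-t)},\qquad \phi(t,x)=\frac{e^{2L+x}}{\varepsilon^2t(T-t)} .$$ (i) There exist $C>0$ and $s_0>0$, depending only on $L$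 and $K$, such that for every $\varepsilon\in(0,1)$, every $T>0$, every $s\ge s_0(\varepsilon T+\varepsilon^2T^2)$ and every $\varphi_T\in X$, one has $\varphi(t,\cdot)\in H^1(-L,0)$ for almost every $t\in(0,T)$ and $$s^3\int_0^T\!\!\int_{-L}^0\phi^3e^{-2s\alpha}|\varphi|^2\,dx\,dt+s\int_0^T\!\!\int_{-L}^0\phi e^{-2s\alpha}|\varphi_x|^2\,dx\,dt+s^3\sum_{x\in\{0,-L\}}\int_0^T\phi^3e^{-2s\alpha}|\varphi|^2(t,x)\,dt$$ $$\le C s^9\int_0^Te^{-4s\alpha(t,0)+2s\alpha(t,-L)}\phi(t,0)^9|\varphi(t,0)|^2\,dt ,$$ the integrals being understood in $[0,\infty]$. (ii) (Rescaled form.) There exists $C>0$, depending only on $L$ and $K$, such that for every $\varepsilon\in(0,1)$, every $\tilde T>0$, every $s\ge C(\tilde T+\tilde T^2+\varepsilon^{-1}\tilde T^2+\varepsilon^{1/3}\tilde T^{2/3})$ and every $\tilde\varphi_T\in X$, the solution $\tilde\varphi\in C([0,\tilde T],X)$ of $$\tilde\varphi_t+\varepsilon^{-1}\tilde\varphi_x+\tilde\varphi_{xx}=0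 \text{ in }(0,\tilde T)\times(-L,0),\quad \varepsilon^2(\tilde\varphi_t-\varepsilon^{-1}\partial_\nu\tilde\varphi)-\tilde\varphi=0\text{ at }x=0,\quad \tilde\varphi_t-\varepsilon^{-1}\partial_\nu\tilde\varphi=0\text{ at }x=-L,\quad \tilde\varphi(\tilde T,\cdot)=\tilde\varphi_T$$ satisfies the conclusion of (i), with this $C$, with $\tilde\varphi$ and $\tilde T$ in place of $\varphi$ and $T$, and with the weights $\tilde\alpha(t,x)=\alpha(t/\varepsilon,x)$, $\tilde\phi(t,x)=\phi(t/\varepsilon,x)$ (where $T=\tilde T/\varepsilon$), i.e. $\tilde\alpha=\frac{K-e^{2L+x}}{t(\tilde T-t)}$, $\tilde\phi=\frac{e^{2L+x}}{t(\tilde T-t)}$. -/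

import Mathlib

open MeasureTheory Set

noncomputable section

namespace AdvDiff

/-- The state space `X` on `Ω = (-L, 0)`. The closure of `𝓓(Ω̄)` for
`(‖u‖²_{L²(Ω)} + ε ‖u‖²_{L²(∂Ω)})^{1/2}` is `L²(Ω) × L²(∂Ω)`, and `∂Ω = {0, -L}`. An element is
`(f, a, b)`: the interior part `f`, the boundary value `a` at `x = 0`, the boundary value `b` at
`x = -L`. For fixed `ε > 0` the norm above and the product norm define the same topology. -/
abbrev StateSpace (L : ℝ) : Type :=
  Lp ℝ 2 (volume.restrict (Ioo (-L) 0)) × ℝ × ℝ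

/-- `v ∈ H¹(-L, 0)` with derivative `g`: `v` is the absolutely continuous representative,
and `g ∈ L²(-L, 0)`. -/
def IsH1 (L : ℝ) (v g : ℝ → ℝ) : Prop :=
  MemLp g 2 (volume.restrict (Ioo (-L) 0)) ∧
    ∀ x ∈ Icc (-L) 0, v x = v (-L) + ∫ y in (-L)..x, g y

/-- The element `u` of `X` is the function `v`: same interior part, and the boundary components
are the traces of `v` at `0` and at `-L`. -/
def Represents (L : ℝ) (v : ℝ → ℝ) (u : StateSpace L) : Prop :=
  (∀ᵐ x ∂(volume.restrict (Ioo (-L) 0)), u.1 x = v x) ∧ u.2.1 = v 0 ∧ u.2.2 = v (-L)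

/-- `u ∈ X` belongs to `H¹(-L, 0)` and its derivative is `g`. -/
def HasSpaceDeriv (L : ℝ) (u : StateSpace L) (g : ℝ → ℝ) : Prop :=
  ∃ v : ℝ → ℝ, IsH1 L v g ∧ Represents L v u

/-- `u` lies in the domain `H²(-L, 0)` of the operator `B` of the evolution problem `φ_t + B φ = 0`
in `X` for the system
* `φ_t + a φ_x + d φ_xx = 0` in `(-L, 0)`,
* `φ_t - a ∂_ν φ - c φ = 0` at `x = 0` (where `∂_ν = ∂_x`),
* `φ_t - a ∂_ν φ = 0` at `x = -L` (where `∂_ν = -∂_x`),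

and `B u = f`. Below, `v`, `w`, `z` are `u`, `u_x`, `u_xx`. -/
def IsGenerator (a d c L : ℝ) (u f : StateSpace L) : Prop :=
  ∃ v w z : ℝ → ℝ, IsH1 L v w ∧ IsH1 L w z ∧ Represents L v u ∧
    (∀ᵐ x ∂(volume.restrict (Ioo (-L) 0)), f.1 x = a * w x + d * z x) ∧
    f.2.1 = -(a * w 0) - c * v 0 ∧
    f.2.2 = a * w (-L)

/-- `φ ∈ C([0, T], X)` is the (mild, i.e. semigroup) solution of `φ_t + B φ = 0`, `φ(T) = φT`, with
`B` as in `IsGenerator`: `∫_t^T φ` lies in the domain of `B` and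
`φ(t) = φT + B ∫_t^T φ` for all `t ∈ [0, T]`. -/
structure IsMildSolution (a d c L T : ℝ) (φT : StateSpace L) (φ : ℝ → StateSpace L) : Prop where
  continuousOn : ContinuousOn φ (Icc 0 T)
  terminal : φ T = φT
  equation : ∀ t ∈ Icc 0 T, IsGenerator a d c L (∫ r in t..T, φ r) (φ t - φT)

/-- Solutions of the adjoint system
`φ_t + φ_x + ε φ_xx = 0`, `ε (φ_t - ∂_ν φ) - φ = 0` at `0`, `φ_t - ∂_ν φ = 0` at `-L`. -/
def IsAdjointSolution (ε L T : ℝ) (φT : StateSpace L) (φ : ℝ → StateSpace L) : Prop :=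
  IsMildSolution 1 ε (1 / ε) L T φT φ

/-- Solutions of the adjoint system after the change of time `t ↦ t / ε`:
`φ_t + ε⁻¹ φ_x + φ_xx = 0`, `ε² (φ_t - ε⁻¹ ∂_ν φ) - φ = 0` at `0`,
`φ_t - ε⁻¹ ∂_ν φ = 0` at `-L`. -/
def IsRescaledAdjointSolution (ε L T : ℝ) (φT : StateSpace L) (φ : ℝ → StateSpace L) : Prop :=
  IsMildSolution (1 / ε) 1 (1 / ε ^ 2) L T φT φ

/-- `η(x) = 2L + x`. -/
def eta (L x : ℝ) : ℝ := 2 * L + x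

/-- The weight `α(t, x) = (K - e^{η(x)}) / (ε² t (T - t))`. -/
def alpha (ε L K T t x : ℝ) : ℝ := (K - Real.exp (eta L x)) / (ε ^ 2 * t * (T - t))

/-- The weight `ϕ(t, x) = e^{η(x)} / (ε² t (T - t))`. -/
def phi (ε L T t x : ℝ) : ℝ := Real.exp (eta L x) / (ε ^ 2 * t * (T - t))

/-- The Carleman inequality on `(0, T) × (-L, 0)` with weights `α`, `ϕ`, parameter `s` and
constant `C`. All integrals are `[0, ∞]`-valued (on the right-hand side the weight need not be
bounded). The first conjunct says that `φ(t) ∈ H¹(-L, 0)`, with `φx t` as derivative, for almost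
every `t`, so that the integral of `|φ_x|²` makes sense. -/
def CarlemanInequality (L T s C : ℝ) (α ϕ : ℝ → ℝ → ℝ) (φ : ℝ → StateSpace L) : Prop :=
  ∃ φx : ℝ → ℝ → ℝ,
    (∀ᵐ t ∂(volume.restrict (Ioo 0 T)), HasSpaceDeriv L (φ t) (φx t)) ∧
    ENNReal.ofReal (s ^ 3) * (∫⁻ t in Ioo 0 T, ∫⁻ x in Ioo (-L) 0,
        ENNReal.ofReal (ϕ t x ^ 3 * Real.exp (-2 * s * α t x)) * ‖(φ t).1 x‖ₑ ^ 2)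
      + ENNReal.ofReal s * (∫⁻ t in Ioo 0 T, ∫⁻ x in Ioo (-L) 0,
        ENNReal.ofReal (ϕ t x * Real.exp (-2 * s * α t x)) * ‖φx t x‖ₑ ^ 2)
      + ENNReal.ofReal (s ^ 3) *
        ((∫⁻ t in Ioo 0 T,
          ENNReal.ofReal (ϕ t 0 ^ 3 * Real.exp (-2 * s * α t 0)) * ‖(φ t).2.1‖ₑ ^ 2)
        + ∫⁻ t in Ioo 0 T,
          ENNReal.ofReal (ϕ t (-L) ^ 3 * Real.exp (-2 * s * α t (-L))) * ‖(φ t).2.2‖ₑ ^ 2)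
    ≤ ENNReal.ofReal (C * s ^ 9) * ∫⁻ t in Ioo 0 T,
        ENNReal.ofReal (Real.exp (-4 * s * α t 0 + 2 * s * α t (-L)) * ϕ t 0 ^ 9)
          * ‖(φ t).2.1‖ₑ ^ 2

end AdvDiff

end

/-! ### Interpolation: derivatives at a point from `L²` data and one high-order bound. -/

open MeasureTheory Set
noncomputable section
namespace AdvDiff

open scoped Nat

/-! Replacing t by t/ε turns (i) into the equation of (ii), with a = 1/ε ≥ 1 the only parameter. The
Carleman inequality is then deduced from an observability estimate at each single time,
`state_le_observation`: for δ ≤ 1 and t + δ < T, the squared H¹ norm and traces of φ(t) are at most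
e^{C/δ} ∫_t^{t+δ} |φ(r,0)|² dr, with C depending only on L.

Symmetrisation. The function θ = e^{-a²t/4 + ax/2} φ solves θ_t + θ_xx = 0 with dynamic boundary
conditions for which the generator is symmetric and nonpositive in the norm ‖·‖² + (traces)²/a.
Hence the energy of θ increases in t, and time derivatives at t are bounded by the energy at later
times. Mollification in time reduces everything to smooth solutions, the graph of the generator
being closed.

Continuation from x = 0. The dynamic condition expresses θ_x(t,0) through θ(t,0) and θ_t(t,0), so
the trace determines all Cauchy data at x = 0, and θ(t,x) is expanded in powers of x with time
derivatives of the trace as coefficients. These derivatives are interpolated between the `L²` norm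
of the trace on [t,t+δ] and the smoothing bound at order n. For n of size 1/δ + a this gives E(t) ≤
e^{19n} ∫|trace|² + e^{-19n} E(t+δ) (`energy_le_interpolation`). Iteration over windows shrinking
geometrically removes the last term (`energy_le_observation`).

Uniformity in a. Undoing the twist, and observing only after t + δ/2, gains e^{-a²δ/4}; the
remaining costs are exponential in a + 1/δ, and Da ≤ a²δ/4 + D²/δ absorbs them (`exponent_le`).

Weights. Put A = K - e^{2L}, c = e^{2L} - e^L and y = s/(t(T-t)). The weights on the left decay at
least like e^{-2Ay} up to powers of y, the one on the right like e^{-2(A-c)y} up to powers. Since c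
> 0, the surplus pays for e^{C/δ} with δ proportional to min(1, T-t), and for the powers of y
(`exists_weight_comparison`). Tonelli's theorem then integrates the windows over t
(`lintegral_le_of_window`). -/

theorem pow_self_le_exp_mul_factorial (n : ℕ) :
    (n : ℝ) ^ n ≤ Real.exp n * n ! := by
  have h := Real.pow_div_factorial_le_exp (n : ℝ) (by positivity) n
  rwa [div_le_iff₀ (by positivity)] at h

/-- These are the Lagrange denominators at integer nodes. Divided into (n-1)! they become binomial
coefficients, whose sum is a power of 2. -/
theorem prod_erase_abs_sub {n i : ℕ} (hi : i < n) :
    ∏ j ∈ (Finset.range n).erase i, |(i : ℝ) - j| = (i ! : ℝ) * ((n - 1 - i)! : ℝ) := by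
  have hsplit : (Finset.range n).erase i = Finset.range i ∪ Finset.Ico (i + 1) n := by
    ext j; simp only [Finset.mem_erase, Finset.mem_range, Finset.mem_union, Finset.mem_Ico]; omega
  have hdisj : Disjoint (Finset.range i) (Finset.Ico (i + 1) n) := by
    rw [Finset.disjoint_left]; intro j; simp only [Finset.mem_range, Finset.mem_Ico]; omega
  rw [hsplit, Finset.prod_union hdisj]
  congr 1
  · rw [← Finset.prod_range_reflect, ← Finset.prod_range_add_one_eq_factorial]
    push_cast
    refine Finset.prod_congr rfl fun j hj => ?_
    rw [Finset.mem_range] at hj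
    rw [show i - 1 - j = i - (j + 1) by omega, Nat.cast_sub (by omega)]
    push_cast
    rw [show (i : ℝ) - (i - (j + 1)) = j + 1 by ring, abs_of_nonneg (by positivity)]
  · rw [Finset.prod_Ico_eq_prod_range, ← Finset.prod_range_add_one_eq_factorial,
      show n - (i + 1) = n - 1 - i by omega]
    push_cast
    refine Finset.prod_congr rfl fun j _ => ?_
    rw [show (i : ℝ) - (i + 1 + j) = -(j + 1) by ring, abs_neg, abs_of_nonneg (by positivity)]

/-- Nodes in every second of the `2n` subintervals of `[0, 1]` are separated. -/
theorem abs_sub_nodes {n : ℕ} {v : ℕ → ℝ}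
    (hv : ∀ i < n, v i ∈ Icc ((2 * i : ℝ) / (2 * n)) ((2 * i + 1 : ℝ) / (2 * n)))
    {i j : ℕ} (hi : i < n) (hj : j < n) :
    |(i : ℝ) - j| / (2 * n) ≤ |v i - v j| := by
  have hn : (0 : ℝ) < 2 * n := by
    have : 0 < n := by omega
    positivity
  have key : ∀ i j : ℕ, i < n → j < n → j < i → |(i : ℝ) - j| / (2 * n) ≤ |v i - v j| := by
    intro i j hi hj hij
    have h1 := (hv i hi).1
    have h2 := (hv j hj).2
    have h3 : (j : ℝ) + 1 ≤ i := by exact_mod_cast hij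
    rw [abs_of_nonneg (by linarith : (0 : ℝ) ≤ (i : ℝ) - j)]
    refine le_trans ?_ (le_abs_self _)
    have h4 : ((i : ℝ) - j) / (2 * n) ≤ (2 * i : ℝ) / (2 * n) - (2 * j + 1 : ℝ) / (2 * n) := by
      rw [← sub_div]; exact div_le_div_of_nonneg_right (by linarith) hn.le
    linarith
  rcases lt_trichotomy i j with h | h | h
  · rw [abs_sub_comm, abs_sub_comm (v i)]; exact key j i hj hi h
  · simp [h]
  · exact key i j hi hj h

/-- The derivatives at `0` of a polynomial of degree `< n` are controlled by its values at `n`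
separated nodes of `[0, 1]`. -/
theorem abs_eval_iterate_derivative_le {n : ℕ} (hn : 0 < n) {v : ℕ → ℝ}
    (hv : ∀ i < n, v i ∈ Icc ((2 * i : ℝ) / (2 * n)) ((2 * i + 1 : ℝ) / (2 * n)))
    {P : Polynomial ℝ} (hP : P.degree < n) {S : ℝ} (hS : ∀ i < n, |P.eval (v i)| ≤ S)
    {k : ℕ} (hk : k < n) :
    |(Polynomial.derivative^[k] P).eval 0| ≤ k ! * Real.exp 1 ^ n * 8 ^ n * S := by
  have hnR : (0 : ℝ) < n := by exact_mod_cast hn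
  have hS0 : 0 ≤ S := (abs_nonneg _).trans (hS 0 hn)
  have hv1 : ∀ i < n, |v i| ≤ 1 := by
    intro i hi
    have h1 := hv i hi
    have h0 : (0 : ℝ) ≤ (2 * i : ℝ) / (2 * n) := by positivity
    have h2 : (2 * i + 1 : ℝ) / (2 * n) ≤ 1 := by
      rw [div_le_one (by positivity)]
      have : (i : ℝ) + 1 ≤ n := by exact_mod_cast hi
      linarith
    rw [abs_le]; constructor <;> linarith [h1.1, h1.2]
  have hinj : Set.InjOn v (Finset.range n) := by
    intro i hi j hj hij
    simp only [Finset.coe_range, mem_Iio] at hi hj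
    have h := abs_sub_nodes hv hi hj
    rw [hij, sub_self, abs_zero] at h
    have h' : |(i : ℝ) - j| ≤ 0 := by
      by_contra hc
      push Not at hc
      have : 0 < |(i : ℝ) - j| / (2 * n) := by positivity
      linarith
    have := abs_eq_zero.1 (le_antisymm h' (abs_nonneg _))
    exact_mod_cast sub_eq_zero.1 this
  have hcard : (Finset.range n).card = n := Finset.card_range n
  rw [Lagrange.eval_iterate_derivative_eq_sum hinj (by rwa [hcard]) (by rwa [hcard]), abs_mul,
    Nat.abs_cast, mul_assoc, mul_assoc]
  refine mul_le_mul_of_nonneg_left ?_ (by positivity)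
  -- A value at most S is divided by a node product, bounded below by separation, and multiplied by
  -- an elementary symmetric sum of at most 2^(n-1) products of numbers in [-1, 1].
  have hterm : ∀ i ∈ Finset.range n,
      |(P.eval (v i) / ∏ j ∈ (Finset.range n).erase i, (v i - v j)) *
        ∑ t ∈ ((Finset.range n).erase i).powersetCard ((Finset.range n).card - (k + 1)),
          ∏ a ∈ t, (0 - v a)| ≤
      S * (2 * n) ^ (n - 1) * 2 ^ (n - 1) / (n - 1)! * ((n - 1).choose i) := by
    intro i hi
    have hi' : i < n := Finset.mem_range.1 hi
    have hA : |∑ t ∈ ((Finset.range n).erase i).powersetCard ((Finset.range n).card - (k + 1)),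
          ∏ a ∈ t, (0 - v a)| ≤ 2 ^ (n - 1) := by
      refine (Finset.abs_sum_le_sum_abs _ _).trans ?_
      have : ∀ t ∈ ((Finset.range n).erase i).powersetCard ((Finset.range n).card - (k + 1)),
          |∏ a ∈ t, (0 - v a)| ≤ 1 := by
        intro t ht
        rw [Finset.abs_prod]
        refine Finset.prod_le_one (fun _ _ => abs_nonneg _) fun b hb => ?_
        have hb' := Finset.mem_range.1
          (Finset.mem_of_mem_erase ((Finset.mem_powersetCard.1 ht).1 hb))
        simpa using hv1 b hb'
      refine (Finset.sum_le_sum this).trans ?_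
      rw [Finset.sum_const, nsmul_eq_mul, mul_one, Finset.card_powersetCard,
        Finset.card_erase_of_mem hi, hcard]
      exact_mod_cast Nat.choose_le_two_pow _ _
    have hB : (1 / (2 * n : ℝ)) ^ (n - 1) * ((i ! : ℝ) * ((n - 1 - i)! : ℝ)) ≤
        |∏ j ∈ (Finset.range n).erase i, (v i - v j)| := by
      rw [← prod_erase_abs_sub hi', Finset.abs_prod]
      have hc : ((Finset.range n).erase i).card = n - 1 := by
        rw [Finset.card_erase_of_mem hi, hcard]
      rw [← hc, ← Finset.prod_const, ← Finset.prod_mul_distrib]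
      refine Finset.prod_le_prod (fun _ _ => by positivity) fun j hj => ?_
      have hj' := Finset.mem_range.1 (Finset.mem_of_mem_erase hj)
      have := abs_sub_nodes hv hi' hj'
      rw [one_div_mul_eq_div]; exact this
    rw [abs_mul, abs_div]
    have hpos : 0 < (1 / (2 * n : ℝ)) ^ (n - 1) * ((i ! : ℝ) * ((n - 1 - i)! : ℝ)) := by
      positivity
    have hC : ((n - 1).choose i : ℝ) = (n - 1)! / ((i ! : ℝ) * ((n - 1 - i)! : ℝ)) :=
      Nat.cast_choose ℝ (by omega)
    calc _ ≤ S / ((1 / (2 * n : ℝ)) ^ (n - 1) * ((i ! : ℝ) * ((n - 1 - i)! : ℝ)))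
            * 2 ^ (n - 1) := by
          gcongr
          exact hS i hi'
      _ = _ := by
          rw [hC, one_div, inv_pow]
          field_simp
  refine (Finset.abs_sum_le_sum_abs _ _).trans ((Finset.sum_le_sum hterm).trans ?_)
  rw [← Finset.mul_sum]
  obtain ⟨m, rfl⟩ : ∃ m, n = m + 1 := ⟨n - 1, by omega⟩
  have hsum : ∑ i ∈ Finset.range (m + 1), ((m + 1 - 1).choose i : ℝ) = 2 ^ m := by
    exact_mod_cast Nat.sum_range_choose m
  rw [hsum]
  have hexp := pow_self_le_exp_mul_factorial (m + 1)
  simp only [add_tsub_cancel_right]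
  rw [← Real.exp_nat_mul, mul_one]
  have hfac : ((m + 1)! : ℝ) = (m + 1) * m ! := by rw [Nat.factorial_succ]; push_cast; ring
  rw [hfac] at hexp
  have h2 : ((m + 1 : ℕ) : ℝ) ^ m ≤ Real.exp ((m + 1 : ℕ) : ℝ) * m ! := by
    have h3 : ((m + 1 : ℕ) : ℝ) ^ (m + 1) = ((m + 1 : ℕ) : ℝ) ^ m * (m + 1) := by
      rw [pow_succ]; push_cast; ring
    rw [h3] at hexp
    have h4 : (0 : ℝ) < m + 1 := by positivity
    nlinarith
  -- The three powers of 2 come from the node spacing 1/(2n), the symmetric sums and the sum of the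
  -- binomial coefficients.
  calc S * (2 * ((m + 1 : ℕ) : ℝ)) ^ m * 2 ^ m / m ! * 2 ^ m
      = S * 8 ^ m * (((m + 1 : ℕ) : ℝ) ^ m / m !) := by
        rw [mul_pow, show (8 : ℝ) = 2 * 2 * 2 by norm_num, mul_pow, mul_pow]; ring
    _ ≤ S * 8 ^ m * Real.exp ((m + 1 : ℕ) : ℝ) := by
        gcongr
        rw [div_le_iff₀ (by positivity)]; exact h2
    _ ≤ S * 8 ^ (m + 1) * Real.exp ((m + 1 : ℕ) : ℝ) := by
        gcongr <;> norm_num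
    _ = _ := by ring

/-- Taylor's formula for a sequence of successive derivatives. -/
theorem abs_sub_taylor_le (n : ℕ) (t h D : ℝ) (F : ℕ → ℝ → ℝ)
    (hF : ∀ j, ∀ r ∈ Icc t (t + h), HasDerivAt (F j) (F (j + 1) r) r)
    (hD : ∀ r ∈ Icc t (t + h), |F n r| ≤ D) :
    ∀ r ∈ Icc 0 h, |F 0 (t + r) - ∑ j ∈ Finset.range n, F j t * r ^ j / j !| ≤
      D * r ^ n / n ! := by
  induction n generalizing F with
  | zero =>
    intro r hr
    simpa using hD (t + r) ⟨by linarith [hr.1], by linarith [hr.2]⟩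
  | succ n ih =>
    intro r hr
    -- The induction hypothesis for the shifted sequence bounds the derivative of the remainder; the
    -- mean value inequality integrates this bound.
    have ih' := ih (fun j => F (j + 1)) (fun j => hF (j + 1)) hD
    have hmem : ∀ y ∈ Icc 0 h, t + y ∈ Icc t (t + h) := fun y hy =>
      ⟨by linarith [hy.1], by linarith [hy.2]⟩
    have hsum : ∀ y : ℝ, HasDerivAt
        (fun y => ∑ j ∈ Finset.range (n + 1), F j t * y ^ j / j !)
        (∑ j ∈ Finset.range n, F (j + 1) t * y ^ j / j !) y := by
      intro y
      have h1 : ∀ j ∈ Finset.range (n + 1), HasDerivAt (fun y : ℝ => F j t * y ^ j / j !)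
          (F j t * (j * y ^ (j - 1)) / j !) y := fun j _ =>
        ((hasDerivAt_pow j y).const_mul _).div_const _
      have h2 := HasDerivAt.fun_sum h1
      refine h2.congr_deriv ?_
      rw [Finset.sum_range_succ']
      simp only [Nat.cast_zero, zero_mul, mul_zero, zero_div, add_zero, add_tsub_cancel_right]
      refine Finset.sum_congr rfl fun j _ => ?_
      rw [Nat.factorial_succ]
      push_cast
      field_simp
    have hG : ∀ y ∈ Icc 0 h, HasDerivAt
        (fun y => F 0 (t + y) - ∑ j ∈ Finset.range (n + 1), F j t * y ^ j / j !)
        (F 1 (t + y) - ∑ j ∈ Finset.range n, F (j + 1) t * y ^ j / j !) y := by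
      intro y hy
      refine HasDerivAt.sub ?_ (hsum y)
      have h3 := (hF 0 (t + y) (hmem y hy))
      exact HasDerivAt.comp_const_add t y h3
    have hB : ∀ y : ℝ, HasDerivAt (fun y => D * y ^ (n + 1) / (n + 1)!) (D * y ^ n / n !) y := by
      intro y
      have h4 := ((hasDerivAt_pow (n + 1) y).const_mul D).div_const ((n + 1)! : ℝ)
      refine h4.congr_deriv ?_
      rw [Nat.factorial_succ]
      push_cast
      field_simp
    have := image_norm_le_of_norm_deriv_right_le_deriv_boundary (a := 0) (b := h)
      (f := fun y => F 0 (t + y) - ∑ j ∈ Finset.range (n + 1), F j t * y ^ j / j !)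
      (f' := fun y => F 1 (t + y) - ∑ j ∈ Finset.range n, F (j + 1) t * y ^ j / j !)
      (B := fun y => D * y ^ (n + 1) / (n + 1)!) (B' := fun y => D * y ^ n / n !)
      (fun y hy => (hG y hy).continuousAt.continuousWithinAt)
      (fun y hy => (hG y ⟨hy.1, hy.2.le⟩).hasDerivWithinAt)
      (by
        rw [Finset.sum_range_succ']
        simp)
      hB (fun y hy => by
        simpa [Real.norm_eq_abs] using ih' y ⟨hy.1, hy.2.le⟩)
    simpa [Real.norm_eq_abs] using this hr

/-- A continuous function cannot exceed its mean everywhere. This turns `L²` information into values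
at well-placed nodes. -/
theorem exists_sq_le_integral {f : ℝ → ℝ} {α β : ℝ} (hαβ : α < β)
    (hf : ContinuousOn f (Icc α β)) :
    ∃ r ∈ Icc α β, f r ^ 2 ≤ (∫ y in α..β, f y ^ 2) / (β - α) := by
  by_contra hc
  push Not at hc
  set m := (∫ y in α..β, f y ^ 2) / (β - α) with hm
  have hf2 : ContinuousOn (fun y => f y ^ 2) (Icc α β) := hf.pow 2
  have h1 : ∫ _ in α..β, m < ∫ y in α..β, f y ^ 2 :=
    intervalIntegral.integral_lt_integral_of_continuousOn_of_le_of_exists_lt hαβ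
      continuousOn_const hf2 (fun y hy => (hc y (Ioc_subset_Icc_self hy)).le)
      ⟨α, left_mem_Icc.2 hαβ.le, hc α (left_mem_Icc.2 hαβ.le)⟩
  rw [intervalIntegral.integral_const, smul_eq_mul, hm, mul_div_cancel₀ _ (by linarith)] at h1
  exact lt_irrefl _ h1

/-- Interpolation: the derivatives of order `< n` of a function at `t` are controlled by its
`L²` norm on `[t, t + h]` and a bound of its `n`-th derivative. -/
theorem abs_deriv_le_interpolation {n : ℕ} (hn : 0 < n) {t h D : ℝ} (hh : 0 < h) {F : ℕ → ℝ → ℝ}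
    (hF : ∀ j, ∀ r ∈ Icc t (t + h), HasDerivAt (F j) (F (j + 1) r) r)
    (hD : ∀ r ∈ Icc t (t + h), |F n r| ≤ D) {k : ℕ} (hk : k < n) :
    |F k t| * h ^ k ≤ k ! * Real.exp 1 ^ n * 8 ^ n *
      (√(2 * n / h * ∫ r in t..t + h, F 0 r ^ 2) + D * h ^ n / n !) := by
  have hnR : (0 : ℝ) < n := by exact_mod_cast hn
  have hcont : ContinuousOn (F 0) (Icc t (t + h)) := fun r hr =>
    (hF 0 r hr).continuousAt.continuousWithinAt
  have hD0 : 0 ≤ D := (abs_nonneg _).trans (hD t ⟨le_rfl, by linarith⟩)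
  have hsub : ∀ i < n, t + h * (2 * i / (2 * n)) ∈ Icc t (t + h) ∧
      t + h * ((2 * i + 1) / (2 * n)) ∈ Icc t (t + h) := by
    intro i hi
    have h1 : (i : ℝ) + 1 ≤ n := by exact_mod_cast hi
    have h2 : (2 * i : ℝ) / (2 * n) ≤ 1 := by rw [div_le_one (by positivity)]; linarith
    have h3 : (2 * i + 1 : ℝ) / (2 * n) ≤ 1 := by rw [div_le_one (by positivity)]; linarith
    have h4 : (0 : ℝ) ≤ (2 * i : ℝ) / (2 * n) := by positivity
    have h5 : (0 : ℝ) ≤ (2 * i + 1 : ℝ) / (2 * n) := by positivity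
    refine ⟨⟨by nlinarith, by nlinarith⟩, ⟨by nlinarith, by nlinarith⟩⟩
  -- One node in each selected subinterval of length h/(2n), where the square is at most its mean.
  -- Indices i ≥ n receive the irrelevant node 0.
  have hnode : ∀ i : ℕ, ∃ y : ℝ, i < n →
      y ∈ Icc ((2 * i : ℝ) / (2 * n)) ((2 * i + 1 : ℝ) / (2 * n)) ∧
      |F 0 (t + h * y)| ≤ √(2 * n / h * ∫ r in t..t + h, F 0 r ^ 2) := by
    intro i
    by_cases hi : i < n
    swap
    · exact ⟨0, fun h => absurd h hi⟩
    obtain ⟨hs1, hs2⟩ := hsub i hi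
    have hlt : t + h * (2 * i / (2 * n)) < t + h * ((2 * i + 1) / (2 * n)) := by
      gcongr; linarith
    have hIcc : Icc (t + h * (2 * i / (2 * n))) (t + h * ((2 * i + 1) / (2 * n)) : ℝ) ⊆
        Icc t (t + h) := Icc_subset_Icc hs1.1 hs2.2
    obtain ⟨r, hr, hr2⟩ := exists_sq_le_integral hlt (hcont.mono hIcc)
    refine ⟨(r - t) / h, fun _ => ⟨⟨?_, ?_⟩, ?_⟩⟩
    · rw [le_div_iff₀ hh]; linarith [hr.1]
    · rw [div_le_iff₀ hh]; linarith [hr.2]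
    · rw [mul_div_cancel₀ _ hh.ne', add_sub_cancel]
      apply Real.abs_le_sqrt
      refine hr2.trans ?_
      have hlen : t + h * ((2 * i + 1) / (2 * n)) - (t + h * (2 * i / (2 * n))) = h / (2 * n) := by
        field_simp; ring
      rw [hlen, div_div_eq_mul_div, div_mul_eq_mul_div, mul_comm (2 * (n : ℝ))]
      gcongr
      refine intervalIntegral.integral_mono_interval hs1.1 hlt.le hs2.2
        (Filter.Eventually.of_forall fun y => sq_nonneg _) ?_
      exact ((hcont.pow 2).mono (by rw [uIcc_of_le (by linarith)])).intervalIntegrable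
  choose v hv using hnode
  -- The Taylor polynomial of `F 0` at t in the variable (r - t)/h. Its k-th derivative at 0 is `F k
  -- t * h ^ k`, and at the nodes it differs from `F 0` by at most D hⁿ/n!.
  set P : Polynomial ℝ := ∑ j ∈ Finset.range n, Polynomial.C (F j t * h ^ j / j !) *
    Polynomial.X ^ j with hP
  have hPdeg : P.degree < n := by
    have := Polynomial.degree_sum_fin_lt (n := n) (fun j : Fin n => F j t * h ^ (j : ℕ) / (j : ℕ)!)
    rwa [Fin.sum_univ_eq_sum_range
      (fun j => Polynomial.C (F j t * h ^ j / j !) * Polynomial.X ^ j)] at this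
  have hPeval : ∀ y, P.eval y = ∑ j ∈ Finset.range n, F j t * (h * y) ^ j / j ! := by
    intro y
    rw [hP, Polynomial.eval_finsetSum]
    refine Finset.sum_congr rfl fun j _ => ?_
    simp only [Polynomial.eval_mul, Polynomial.eval_C, Polynomial.eval_pow, Polynomial.eval_X]
    rw [mul_pow]; ring
  have hPk : (Polynomial.derivative^[k] P).eval 0 = F k t * h ^ k := by
    rw [← Polynomial.coeff_zero_eq_eval_zero, Polynomial.coeff_iterate_derivative, zero_add,
      Nat.descFactorial_self, hP, Polynomial.finsetSum_coeff, Finset.sum_eq_single k]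
    · rw [Polynomial.coeff_C_mul, Polynomial.coeff_X_pow, if_pos rfl, nsmul_eq_mul, mul_one]
      field_simp
    · intro j _ hjk
      rw [Polynomial.coeff_C_mul, Polynomial.coeff_X_pow, if_neg (Ne.symm hjk), mul_zero]
    · intro hk'
      exact absurd (Finset.mem_range.2 hk) hk'
  have := abs_eval_iterate_derivative_le hn (fun i hi => (hv i hi).1) hPdeg
    (S := √(2 * n / h * ∫ r in t..t + h, F 0 r ^ 2) + D * h ^ n / n !) (fun i hi => by
      have h1 := (hv i hi).2
      have h01 : v i ∈ Icc (0 : ℝ) 1 := by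
        have h2 := (hv i hi).1
        obtain ⟨-, h4⟩ := hsub i hi
        refine ⟨le_trans (by positivity) h2.1, h2.2.trans ?_⟩
        have := h4.2
        nlinarith
      have h2 := abs_sub_taylor_le n t h D F hF hD (h * v i)
        ⟨mul_nonneg hh.le h01.1, by nlinarith [h01.2]⟩
      rw [hPeval]
      have h3 : D * (h * v i) ^ n / n ! ≤ D * h ^ n / n ! := by
        gcongr
        · exact mul_nonneg hh.le h01.1
        · nlinarith [h01.2]
      have h4 := abs_sub_abs_le_abs_sub (∑ j ∈ Finset.range n, F j t * (h * v i) ^ j / j !)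
        (F 0 (t + h * v i))
      rw [abs_sub_comm] at h4
      linarith) hk
  rw [hPk, abs_mul, abs_of_pos (pow_pos hh k)] at this
  exact this

end AdvDiff
end

/-! ### Calculus in H¹(-L, 0) and the symmetrised generator. -/

open MeasureTheory Set
noncomputable section
namespace AdvDiff

variable {L : ℝ}

theorem intervalIntegral_eq_integral_Ioo (hL : 0 < L) (g : ℝ → ℝ) :
    ∫ x in (-L)..0, g x = ∫ x, g x ∂(volume.restrict (Ioo (-L) 0)) := by
  rw [intervalIntegral.integral_of_le (by linarith), integral_Ioc_eq_integral_Ioo]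

theorem MemLp.intervalIntegrable_Ioo (hL : 0 < L) {g : ℝ → ℝ}
    (hg : MemLp g 2 (volume.restrict (Ioo (-L) 0))) : IntervalIntegrable g volume (-L) 0 := by
  rw [intervalIntegrable_iff_integrableOn_Ioo_of_le (by linarith)]
  exact hg.integrable (by norm_num)

theorem IntervalIntegrable.of_mem_Icc {g : ℝ → ℝ} (hL : 0 < L)
    (hg : IntervalIntegrable g volume (-L) 0) {x y : ℝ} (hx : x ∈ Icc (-L) 0)
    (hy : y ∈ Icc (-L) 0) : IntervalIntegrable g volume x y := by
  refine hg.mono_set ?_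
  rw [uIcc_of_le (by linarith : -L ≤ 0)]
  exact uIcc_subset_Icc hx hy

namespace IsH1

variable {v g w h : ℝ → ℝ}

theorem intervalIntegrable (hL : 0 < L) (hv : IsH1 L v g) :
    IntervalIntegrable g volume (-L) 0 := MemLp.intervalIntegrable_Ioo hL hv.1

theorem sub_eq_integral (hL : 0 < L) (hv : IsH1 L v g) {x y : ℝ} (hx : x ∈ Icc (-L) 0)
    (hy : y ∈ Icc (-L) 0) : v y - v x = ∫ r in x..y, g r := by
  have hl : -L ∈ Icc (-L) 0 := ⟨le_rfl, by linarith⟩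
  have hi := hv.intervalIntegrable hL
  rw [hv.2 x hx, hv.2 y hy, ← intervalIntegral.integral_add_adjacent_intervals
    (IntervalIntegrable.of_mem_Icc hL hi hl hx) (IntervalIntegrable.of_mem_Icc hL hi hx hy)]
  ring

theorem congr_deriv (hv : IsH1 L v g)
    (hg : ∀ᵐ x ∂(volume.restrict (Ioo (-L) 0)), h x = g x) : IsH1 L v h := by
  refine ⟨hv.1.ae_eq (hg.mono fun x hx => hx.symm), fun x hx => ?_⟩
  rw [hv.2 x hx]
  congr 1
  refine intervalIntegral.integral_congr_ae ?_
  rw [ae_restrict_iff' measurableSet_Ioo] at hg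
  have h0 : ∀ᵐ y : ℝ, y ≠ 0 := by simp [ae_iff]
  filter_upwards [hg, h0] with y hy hy0 hy'
  rw [uIoc_of_le hx.1] at hy'
  exact (hy ⟨hy'.1, lt_of_le_of_ne (hy'.2.trans hx.2) hy0⟩).symm

/-- Formulated for the primitive, whose derivative is `g` almost everywhere; `v` itself is
prescribed only on the closed interval. -/
theorem absolutelyContinuous (hL : 0 < L) (hv : IsH1 L v g) :
    AbsolutelyContinuousOnInterval (fun x => v (-L) + ∫ y in (-L)..x, g y) (-L) 0 := by
  have h1 := (hv.intervalIntegrable hL).absolutelyContinuousOnInterval_intervalIntegral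
    (c := -L) left_mem_uIcc
  have h2 : AbsolutelyContinuousOnInterval (fun _ : ℝ => v (-L)) (-L) 0 :=
    (LipschitzWith.const (v (-L))).lipschitzOnWith.absolutelyContinuousOnInterval
  exact h2.fun_add h1

theorem continuousOn (hL : 0 < L) (hv : IsH1 L v g) : ContinuousOn v (Icc (-L) 0) := by
  have h := (hv.absolutelyContinuous hL).continuousOn
  rw [uIcc_of_le (by linarith)] at h
  exact h.congr fun x hx => hv.2 x hx

theorem memLp_of_continuousOn {v : ℝ → ℝ} (hv : ContinuousOn v (Icc (-L) 0)) :
    MemLp v 2 (volume.restrict (Ioo (-L) 0)) := by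
  have h1 : MemLp v ⊤ (volume.restrict (Icc (-L) 0)) := by
    obtain ⟨C, hC⟩ := isCompact_Icc.exists_bound_of_continuousOn hv
    refine memLp_top_of_bound (hv.aestronglyMeasurable measurableSet_Icc) C ?_
    exact (ae_restrict_iff' measurableSet_Icc).2 (Filter.Eventually.of_forall hC)
  exact (h1.mono_measure (Measure.restrict_mono Ioo_subset_Icc_self le_rfl)).mono_exponent le_top

theorem memLp (hL : 0 < L) (hv : IsH1 L v g) : MemLp v 2 (volume.restrict (Ioo (-L) 0)) :=
  memLp_of_continuousOn (hv.continuousOn hL)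

theorem memLp_mul {v g : ℝ → ℝ} (hv : ContinuousOn v (Icc (-L) 0))
    (hg : MemLp g 2 (volume.restrict (Ioo (-L) 0))) :
    MemLp (fun x => v x * g x) 2 (volume.restrict (Ioo (-L) 0)) := by
  have h1 : MemLp v ⊤ (volume.restrict (Ioo (-L) 0)) := by
    obtain ⟨C, hC⟩ := isCompact_Icc.exists_bound_of_continuousOn hv
    refine memLp_top_of_bound
      ((hv.mono Ioo_subset_Icc_self).aestronglyMeasurable measurableSet_Ioo) C ?_
    exact (ae_restrict_iff' measurableSet_Ioo).2
      (Filter.Eventually.of_forall fun x hx => hC x (Ioo_subset_Icc_self hx))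
  exact hg.mul h1

/-- Product rule. -/
theorem mul (hL : 0 < L) (hv : IsH1 L v g) (hw : IsH1 L w h) :
    IsH1 L (fun x => v x * w x) (fun x => g x * w x + v x * h x) := by
  have hvc := hv.continuousOn hL
  have hwc := hw.continuousOn hL
  refine ⟨?_, fun x hx => ?_⟩
  · have h1 := memLp_mul hwc hv.1
    have h2 := memLp_mul hvc hw.1
    simp only [mul_comm (w _)] at h1
    exact h1.add h2
  · have hx' : (-L) ∈ Icc (-L) (0 : ℝ) := ⟨le_rfl, by linarith⟩
    set V := fun x => v (-L) + ∫ y in (-L)..x, g y with hV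
    set W := fun x => w (-L) + ∫ y in (-L)..x, h y with hW
    have hsub : uIcc (-L) x ⊆ uIcc (-L) 0 := by
      rw [uIcc_of_le hx.1, uIcc_of_le (by linarith)]; exact Icc_subset_Icc_right hx.2
    have hVa : AbsolutelyContinuousOnInterval V (-L) x := (hv.absolutelyContinuous hL).mono hsub
    have hWa : AbsolutelyContinuousOnInterval W (-L) x := (hw.absolutelyContinuous hL).mono hsub
    -- Integration by parts for absolutely continuous functions; Lebesgue differentiation then
    -- identifies the derivatives with `g` and `h`.
    have key := hVa.integral_deriv_mul_eq_sub hWa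
    have e1 : ∀ y ∈ Icc (-L) 0, V y = v y := fun y hy => (hv.2 y hy).symm
    have e2 : ∀ y ∈ Icc (-L) 0, W y = w y := fun y hy => (hw.2 y hy).symm
    rw [e1 x hx, e2 x hx, e1 _ hx', e2 _ hx'] at key
    have : ∫ y in (-L)..x, (g y * w y + v y * h y) =
        ∫ y in (-L)..x, (deriv V y * W y + V y * deriv W y) := by
      refine intervalIntegral.integral_congr_ae ?_
      filter_upwards [(hv.intervalIntegrable hL).ae_hasDerivAt_integral,
        (hw.intervalIntegrable hL).ae_hasDerivAt_integral] with y hy1 hy2 hy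
      have hyI : y ∈ Icc (-L) 0 := by
        rw [uIoc_of_le hx.1] at hy; exact ⟨hy.1.le, hy.2.trans hx.2⟩
      have hyu : y ∈ uIcc (-L) 0 := by rwa [uIcc_of_le (by linarith)]
      have d1 : deriv V y = g y := ((hy1 hyu (-L) left_mem_uIcc).const_add _).deriv
      have d2 : deriv W y = h y := ((hy2 hyu (-L) left_mem_uIcc).const_add _).deriv
      rw [d1, d2, e1 y hyI, e2 y hyI]
    linarith

theorem integral_mul_add_mul (hL : 0 < L) (hv : IsH1 L v g) (hw : IsH1 L w h) :
    ∫ x in (-L)..0, (g x * w x + v x * h x) = v 0 * w 0 - v (-L) * w (-L) := by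
  have := (hv.mul hL hw).2 0 ⟨by linarith, le_rfl⟩
  simp only at this
  linarith

theorem of_hasDerivAt {v g : ℝ → ℝ} (hv : ∀ x, HasDerivAt v (g x) x)
    (hg : Continuous g) : IsH1 L v g := by
  refine ⟨memLp_of_continuousOn hg.continuousOn, fun x hx => ?_⟩
  rw [intervalIntegral.integral_eq_sub_of_hasDerivAt (fun y _ => hv y)
    (hg.intervalIntegrable _ _)]
  ring

theorem add (hv : IsH1 L v g) (hw : IsH1 L w h) :
    IsH1 L (fun x => v x + w x) (fun x => g x + h x) := by
  refine ⟨hv.1.add hw.1, fun x hx => ?_⟩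
  have hL : -L ≤ 0 := hx.1.trans hx.2
  have hi : ∀ {g : ℝ → ℝ}, MemLp g 2 (volume.restrict (Ioo (-L) 0)) →
      IntervalIntegrable g volume (-L) x := by
    intro g hg
    have : IntervalIntegrable g volume (-L) 0 := by
      rw [intervalIntegrable_iff_integrableOn_Ioo_of_le hL]
      exact hg.integrable (by norm_num)
    refine this.mono_set ?_
    rw [uIcc_of_le hx.1, uIcc_of_le hL]; exact Icc_subset_Icc_right hx.2
  simp only
  rw [intervalIntegral.integral_add (hi hv.1) (hi hw.1), hv.2 x hx, hw.2 x hx]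
  ring

theorem const_mul (c : ℝ) (hv : IsH1 L v g) :
    IsH1 L (fun x => c * v x) (fun x => c * g x) := by
  refine ⟨hv.1.const_mul c, fun x hx => ?_⟩
  simp only
  rw [intervalIntegral.integral_const_mul, hv.2 x hx]
  ring

end IsH1

theorem Represents.add {u u' : StateSpace L} {v v' : ℝ → ℝ} (h : Represents L v u)
    (h' : Represents L v' u') : Represents L (fun x => v x + v' x) (u + u') := by
  refine ⟨?_, by simp [h.2.1, h'.2.1], by simp [h.2.2, h'.2.2]⟩
  filter_upwards [h.1, h'.1, Lp.coeFn_add u.1 u'.1] with x h1 h2 h3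
  rw [Prod.fst_add, h3, Pi.add_apply, h1, h2]

theorem Represents.smul {u : StateSpace L} {v : ℝ → ℝ} (c : ℝ) (h : Represents L v u) :
    Represents L (fun x => c * v x) (c • u) := by
  refine ⟨?_, by simp [h.2.1], by simp [h.2.2]⟩
  filter_upwards [h.1, Lp.coeFn_smul c u.1] with x h1 h3
  rw [Prod.smul_fst, h3, Pi.smul_apply, h1, smul_eq_mul]

/-- The generator of the system obtained from
`φ_t + a φ_x + φ_xx = 0`, `φ_t - a ∂_ν φ - a² φ = 0` at `0`, `φ_t - a ∂_ν φ = 0` at `-L` by the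
change of unknown `e^{-a²t/4 + ax/2} φ`. -/
def IsSymGenerator (a L : ℝ) (u f : StateSpace L) : Prop :=
  ∃ v w z : ℝ → ℝ, IsH1 L v w ∧ IsH1 L w z ∧ Represents L v u ∧
    (∀ᵐ x ∂(volume.restrict (Ioo (-L) 0)), f.1 x = z x) ∧
    f.2.1 = -(a * w 0) - a ^ 2 / 4 * v 0 ∧
    f.2.2 = a * w (-L) - a ^ 2 / 4 * v (-L)

theorem IsSymGenerator.add {a : ℝ} {u f u' f' : StateSpace L} (h : IsSymGenerator a L u f)
    (h' : IsSymGenerator a L u' f') : IsSymGenerator a L (u + u') (f + f') := by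
  obtain ⟨v, w, z, h1, h2, h3, h4, h5, h6⟩ := h
  obtain ⟨v', w', z', h1', h2', h3', h4', h5', h6'⟩ := h'
  refine ⟨_, _, _, h1.add h1', h2.add h2', h3.add h3', ?_, ?_, ?_⟩
  · filter_upwards [h4, h4', Lp.coeFn_add f.1 f'.1] with x e1 e2 e3
    rw [Prod.fst_add, e3, Pi.add_apply, e1, e2]
  · simp only [Prod.snd_add, Prod.fst_add, h5, h5']; ring
  · simp only [Prod.snd_add, h6, h6']; ring

theorem IsSymGenerator.smul {a : ℝ} {u f : StateSpace L} (c : ℝ) (h : IsSymGenerator a L u f) :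
    IsSymGenerator a L (c • u) (c • f) := by
  obtain ⟨v, w, z, h1, h2, h3, h4, h5, h6⟩ := h
  refine ⟨_, _, _, h1.const_mul c, h2.const_mul c, h3.smul c, ?_, ?_, ?_⟩
  · filter_upwards [h4, Lp.coeFn_smul c f.1] with x e1 e3
    rw [Prod.smul_fst, e3, Pi.smul_apply, e1, smul_eq_mul]
  · simp only [Prod.smul_snd, Prod.smul_fst, h5, smul_eq_mul]; ring
  · simp only [Prod.smul_snd, h6, smul_eq_mul]; ring

theorem IsSymGenerator.zero (a : ℝ) :
    IsSymGenerator a L (0 : StateSpace L) 0 := by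
  have h0 : IsH1 L (fun _ => 0) (fun _ => 0) :=
    IsH1.of_hasDerivAt (fun x => hasDerivAt_const x 0) continuous_const
  have hz : ∀ᵐ x ∂(volume.restrict (Ioo (-L) 0)), (0 : StateSpace L).1 x = 0 := by
    filter_upwards [Lp.coeFn_zero ℝ 2 (volume.restrict (Ioo (-L) 0))] with x hx
    exact hx
  exact ⟨_, _, _, h0, h0, ⟨hz, by simp, by simp⟩, hz, by simp, by simp⟩

/-- The graph of the generator. -/
def symGraph (a L : ℝ) : Submodule ℝ (StateSpace L × StateSpace L) where
  carrier := {p | IsSymGenerator a L p.1 p.2}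
  add_mem' h h' := IsSymGenerator.add h h'
  zero_mem' := IsSymGenerator.zero a
  smul_mem' c _ h := IsSymGenerator.smul c h

/-! ### Closedness of the graph of the generator. -/

theorem norm_sq_eq_integral (f : Lp ℝ 2 (volume.restrict (Ioo (-L) 0))) :
    ‖f‖ ^ 2 = ∫ x, f x ^ 2 ∂(volume.restrict (Ioo (-L) 0)) := by
  rw [← real_inner_self_eq_norm_sq, L2.inner_def]
  simp [sq]

/-- Cauchy–Schwarz, read off from the nonnegativity of the variance ∫(|g| - I/L)². -/
theorem integral_abs_sq_le (hL : 0 < L) {g : ℝ → ℝ}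
    (hg : MemLp g 2 (volume.restrict (Ioo (-L) 0))) :
    (∫ x, |g x| ∂(volume.restrict (Ioo (-L) 0))) ^ 2 ≤
      L * ∫ x, g x ^ 2 ∂(volume.restrict (Ioo (-L) 0)) := by
  set μ := volume.restrict (Ioo (-L) (0 : ℝ)) with hμ
  have h1 : Integrable (fun x => |g x|) μ := (hg.integrable (by norm_num)).abs
  have h2 : Integrable (fun x => g x ^ 2) μ := hg.integrable_sq
  set I := ∫ x, |g x| ∂μ with hI
  have hμ1 : μ.real univ = L := by simp [hμ, Measure.real, hL.le]
  have h3 : 0 ≤ ∫ x, (|g x| - I / L) ^ 2 ∂μ := integral_nonneg fun x => sq_nonneg _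
  have h4 : ∫ x, (|g x| - I / L) ^ 2 ∂μ =
      (∫ x, g x ^ 2 ∂μ) - 2 * (I / L) * I + (I / L) ^ 2 * L := by
    have : ∀ x, (|g x| - I / L) ^ 2 = g x ^ 2 - 2 * (I / L) * |g x| + (I / L) ^ 2 := by
      intro x; rw [sub_sq, sq_abs]; ring
    simp_rw [this]
    have h6 : Integrable (fun x => 2 * (I / L) * |g x|) μ := h1.const_mul _
    have h7 : Integrable (fun x => g x ^ 2 - 2 * (I / L) * |g x|) μ := h2.sub h6
    rw [integral_add h7 (integrable_const _), integral_sub h2 h6, integral_const_mul, integral_const, hμ1, smul_eq_mul]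
    ring
  rw [h4] at h3
  have h5 : (∫ x, g x ^ 2 ∂μ) - 2 * (I / L) * I + (I / L) ^ 2 * L =
      (∫ x, g x ^ 2 ∂μ) - I ^ 2 / L := by field_simp; ring
  rw [h5, sub_nonneg, div_le_iff₀ hL] at h3
  linarith

theorem abs_intervalIntegral_le (hL : 0 < L) (f : Lp ℝ 2 (volume.restrict (Ioo (-L) 0)))
    {x y : ℝ} (hx : x ∈ Icc (-L) 0) (hy : y ∈ Icc (-L) 0) :
    |∫ r in x..y, f r| ≤ √L * ‖f‖ := by
  have hf := Lp.memLp f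
  have hi := MemLp.intervalIntegrable_Ioo hL hf
  have h1 : |∫ r in x..y, f r| ≤ ∫ r, |f r| ∂(volume.restrict (Ioo (-L) 0)) := by
    rw [← intervalIntegral_eq_integral_Ioo hL]
    rw [← Real.norm_eq_abs]
    refine (intervalIntegral.norm_integral_le_integral_norm_uIoc (f := fun r => f r)).trans ?_
    simp only [Real.norm_eq_abs]
    rw [intervalIntegral.integral_of_le (by linarith)]
    refine setIntegral_mono_set ((intervalIntegrable_iff_integrableOn_Ioc_of_le
      (by linarith)).1 hi.abs) (Filter.Eventually.of_forall fun r => abs_nonneg _)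
      (Filter.Eventually.of_forall fun r hr => ?_)
    rcases le_total x y with h | h
    · rw [uIoc_of_le h] at hr; exact ⟨hx.1.trans_lt hr.1, hr.2.trans hy.2⟩
    · rw [uIoc_of_ge h] at hr; exact ⟨hy.1.trans_lt hr.1, hr.2.trans hx.2⟩
  refine h1.trans (abs_le_of_sq_le_sq' ?_ (by positivity)).2
  rw [mul_pow, Real.sq_sqrt hL.le, norm_sq_eq_integral]
  exact integral_abs_sq_le hL hf

theorem continuousOn_primitive (hL : 0 < L) (f : Lp ℝ 2 (volume.restrict (Ioo (-L) 0))) :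
    ContinuousOn (fun x => ∫ r in (0 : ℝ)..x, f r) (Icc (-L) 0) := by
  have h := intervalIntegral.continuousOn_primitive_interval' (a := 0)
    (MemLp.intervalIntegrable_Ioo hL (Lp.memLp f)) right_mem_uIcc
  rwa [uIcc_of_le (by linarith)] at h

/-- The function with second derivative `f.1` and with Cauchy data at `0` read off from `u, f`. -/
def cauchyExtension (a : ℝ) (p : StateSpace L × StateSpace L) (x : ℝ) : ℝ :=
  p.1.2.1 + -(p.2.2.1 + a ^ 2 / 4 * p.1.2.1) / a * x +
    ∫ y in (0 : ℝ)..x, ∫ r in (0 : ℝ)..y, p.2.1 r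

/-- The boundary condition at 0 is solved for u_x(0), and u_xx = f is integrated twice from 0. The
domain condition becomes three identities without derivatives of u, which pass to limits in X × X.
-/
theorem isSymGenerator_iff (hL : 0 < L) {a : ℝ} (ha : 0 < a) (p : StateSpace L × StateSpace L) :
    IsSymGenerator a L p.1 p.2 ↔
      (∀ᵐ x ∂(volume.restrict (Ioo (-L) 0)), p.1.1 x = cauchyExtension a p x) ∧
      p.1.2.2 = cauchyExtension a p (-L) ∧
      p.2.2.2 = a * (-(p.2.2.1 + a ^ 2 / 4 * p.1.2.1) / a + ∫ r in (0 : ℝ)..(-L), p.2.1 r) -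
        a ^ 2 / 4 * p.1.2.2 := by
  obtain ⟨u, f⟩ := p
  have h0 : (0 : ℝ) ∈ Icc (-L) 0 := ⟨by linarith, le_rfl⟩
  have hl : -L ∈ Icc (-L) (0 : ℝ) := ⟨le_rfl, by linarith⟩
  constructor
  · rintro ⟨v, w, z, h1, h2, h3, h4, h5, h6⟩
    simp only at h3 h4 h5 h6 ⊢
    have h2' := h2.congr_deriv h4
    have hw0 : -(f.2.1 + a ^ 2 / 4 * u.2.1) / a = w 0 := by
      rw [h3.2.1, h5]; field_simp; ring
    have hw : ∀ x ∈ Icc (-L) 0, w x = w 0 + ∫ r in (0 : ℝ)..x, f.1 r := fun x hx => by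
      rw [← h2'.sub_eq_integral hL h0 hx]; ring
    have hv : ∀ x ∈ Icc (-L) 0, v x = cauchyExtension a (u, f) x := by
      intro x hx
      have hc := (continuousOn_primitive hL f.1).mono (uIcc_subset_Icc h0 hx)
      simp only [cauchyExtension]
      rw [hw0, h3.2.1]
      have h7 := h1.sub_eq_integral hL h0 hx
      have h8 : ∫ y in (0 : ℝ)..x, w y = ∫ y in (0 : ℝ)..x, (w 0 + ∫ r in (0 : ℝ)..y, f.1 r) :=
        intervalIntegral.integral_congr fun y hy => hw y (uIcc_subset_Icc h0 hx hy)
      rw [h8, intervalIntegral.integral_add intervalIntegrable_const hc.intervalIntegrable,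
        intervalIntegral.integral_const, smul_eq_mul] at h7
      linarith
    refine ⟨?_, ?_, ?_⟩
    · filter_upwards [h3.1, ae_restrict_mem measurableSet_Ioo] with x hx hx'
      rw [hx, hv x (Ioo_subset_Icc_self hx')]
    · rw [h3.2.2, hv _ hl]
    · rw [hw0, ← hw _ hl, h6, h3.2.2]
  · rintro ⟨h1, h2, h3⟩
    simp only at h1 h2 h3
    set w0 := -(f.2.1 + a ^ 2 / 4 * u.2.1) / a with hw0
    set w : ℝ → ℝ := fun x => w0 + ∫ r in (0 : ℝ)..x, f.1 r with hw
    have hfi := MemLp.intervalIntegrable_Ioo hL (Lp.memLp f.1)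
    have hwc : ContinuousOn w (Icc (-L) 0) := continuousOn_const.add (continuousOn_primitive hL f.1)
    have hwi : IntervalIntegrable w volume (-L) 0 := by
      refine ContinuousOn.intervalIntegrable ?_
      rwa [uIcc_of_le (by linarith)]
    have hext : ∀ x ∈ Icc (-L) 0, cauchyExtension a (u, f) x = u.2.1 + ∫ y in (0 : ℝ)..x, w y := by
      intro x hx
      have hc := (continuousOn_primitive hL f.1).mono (uIcc_subset_Icc h0 hx)
      simp only [cauchyExtension, hw]
      rw [intervalIntegral.integral_add intervalIntegrable_const hc.intervalIntegrable,
        intervalIntegral.integral_const, smul_eq_mul]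
      ring
    refine ⟨cauchyExtension a (u, f), w, f.1, ⟨IsH1.memLp_of_continuousOn hwc, ?_⟩,
      ⟨Lp.memLp _, ?_⟩, ⟨h1, ?_, h2⟩, Filter.Eventually.of_forall fun _ => rfl, ?_, ?_⟩
    · intro x hx
      rw [hext x hx, hext _ hl, add_assoc, intervalIntegral.integral_add_adjacent_intervals
        (IntervalIntegrable.of_mem_Icc hL hwi h0 hl) (IntervalIntegrable.of_mem_Icc hL hwi hl hx)]
    · intro x hx
      simp only [hw]
      rw [add_assoc, intervalIntegral.integral_add_adjacent_intervals
        (IntervalIntegrable.of_mem_Icc hL hfi h0 hl) (IntervalIntegrable.of_mem_Icc hL hfi hl hx)]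
    · simp [cauchyExtension]
    · simp only [hw, cauchyExtension, intervalIntegral.integral_same, mul_zero, add_zero, hw0]
      field_simp
      ring
    · rw [← h2]; exact h3

theorem tendsto_primitive (hL : 0 < L) {F : ℕ → Lp ℝ 2 (volume.restrict (Ioo (-L) 0))}
    {f : Lp ℝ 2 (volume.restrict (Ioo (-L) 0))} (hF : Filter.Tendsto F Filter.atTop (nhds f))
    {x : ℝ} (hx : x ∈ Icc (-L) 0) :
    Filter.Tendsto (fun n => ∫ r in (0 : ℝ)..x, F n r) Filter.atTop
      (nhds (∫ r in (0 : ℝ)..x, f r)) := by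
  have h0 : (0 : ℝ) ∈ Icc (-L) 0 := ⟨by linarith, le_rfl⟩
  rw [tendsto_iff_norm_sub_tendsto_zero] at hF ⊢
  refine squeeze_zero (fun _ => norm_nonneg _) (fun n => ?_)
    (by simpa using hF.const_mul (√L))
  rw [Real.norm_eq_abs, ← intervalIntegral.integral_sub
    (IntervalIntegrable.of_mem_Icc hL (MemLp.intervalIntegrable_Ioo hL (Lp.memLp _)) h0 hx)
    (IntervalIntegrable.of_mem_Icc hL (MemLp.intervalIntegrable_Ioo hL (Lp.memLp _)) h0 hx)]
  refine le_trans (le_of_eq ?_) (abs_intervalIntegral_le hL (F n - f) h0 hx)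
  congr 1
  refine intervalIntegral.integral_congr_ae ?_
  have h1 := (ae_restrict_iff' measurableSet_Ioo).1 (Lp.coeFn_sub (F n) f)
  have h2 : ∀ᵐ y : ℝ, y ≠ 0 := by simp [ae_iff]
  filter_upwards [h1, h2] with y hy hy0 hy'
  rw [uIoc_of_ge hx.2] at hy'
  rw [hy ⟨hx.1.trans_lt hy'.1, lt_of_le_of_ne hy'.2 hy0⟩, Pi.sub_apply]

theorem tendsto_cauchyExtension (hL : 0 < L) (a : ℝ) {P : ℕ → StateSpace L × StateSpace L}
    {p : StateSpace L × StateSpace L} (hP : Filter.Tendsto P Filter.atTop (nhds p))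
    {x : ℝ} (hx : x ∈ Icc (-L) 0) :
    Filter.Tendsto (fun n => cauchyExtension a (P n) x) Filter.atTop
      (nhds (cauchyExtension a p x)) := by
  have h0 : (0 : ℝ) ∈ Icc (-L) 0 := ⟨by linarith, le_rfl⟩
  have hF : Filter.Tendsto (fun n => (P n).2.1) Filter.atTop (nhds p.2.1) :=
    (continuous_snd.fst.tendsto p).comp hP
  have h1 : Filter.Tendsto (fun n => (P n).1.2.1) Filter.atTop (nhds p.1.2.1) :=
    (continuous_fst.snd.fst.tendsto p).comp hP
  have h2 : Filter.Tendsto (fun n => (P n).2.2.1) Filter.atTop (nhds p.2.2.1) :=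
    (continuous_snd.snd.fst.tendsto p).comp hP
  obtain ⟨C, hC⟩ := hF.norm.bddAbove_range
  refine (h1.add ((((h2.add (h1.const_mul _)).neg).div_const a).mul_const x)).add ?_
  refine intervalIntegral.tendsto_integral_filter_of_dominated_convergence (fun _ => √L * C)
    (Filter.Eventually.of_forall fun n => ?_) (Filter.Eventually.of_forall fun n => ?_)
    intervalIntegrable_const ?_
  · refine ((continuousOn_primitive hL (P n).2.1).mono ?_).aestronglyMeasurable measurableSet_uIoc
    exact uIoc_subset_uIcc.trans (uIcc_subset_Icc h0 hx)
  · refine Filter.Eventually.of_forall fun y hy => ?_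
    have hy' := uIcc_subset_Icc h0 hx (uIoc_subset_uIcc hy)
    refine (abs_intervalIntegral_le hL _ h0 hy').trans ?_
    gcongr
    exact hC ⟨n, rfl⟩
  · refine Filter.Eventually.of_forall fun y hy => ?_
    exact tendsto_primitive hL hF (uIcc_subset_Icc h0 hx (uIoc_subset_uIcc hy))

/-- The three identities of `isSymGenerator_iff` are stable: the Cauchy extension converges
pointwise, and `L²` convergence gives almost everywhere convergence of the left side along a
subsequence. -/
theorem isClosed_symGraph (hL : 0 < L) {a : ℝ} (ha : 0 < a) :
    IsClosed (symGraph a L : Set (StateSpace L × StateSpace L)) := by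
  refine IsSeqClosed.isClosed fun P p hmem hP => ?_
  have hl : -L ∈ Icc (-L) (0 : ℝ) := ⟨le_rfl, by linarith⟩
  have hmem' := fun n => (isSymGenerator_iff hL ha (P n)).1 (hmem n)
  refine (isSymGenerator_iff hL ha p).2 ⟨?_, ?_, ?_⟩
  · have h1 : Filter.Tendsto (fun n => (P n).1.1) Filter.atTop (nhds p.1.1) :=
      (continuous_fst.fst.tendsto p).comp hP
    obtain ⟨ns, hns, hae⟩ := (tendstoInMeasure_of_tendsto_Lp h1).exists_seq_tendsto_ae
    have hall := ae_all_iff.2 fun n => (hmem' n).1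
    filter_upwards [hae, hall, ae_restrict_mem measurableSet_Ioo] with x hx1 hx2 hx3
    refine tendsto_nhds_unique hx1 ?_
    simp only [hx2]
    exact (tendsto_cauchyExtension hL a hP (Ioo_subset_Icc_self hx3)).comp hns.tendsto_atTop
  · have h1 : Filter.Tendsto (fun n => (P n).1.2.2) Filter.atTop (nhds p.1.2.2) :=
      (continuous_fst.snd.snd.tendsto p).comp hP
    refine tendsto_nhds_unique h1 ?_
    simp only [(hmem' _).2.1]
    exact tendsto_cauchyExtension hL a hP hl
  · have h1 : Filter.Tendsto (fun n => (P n).2.2.2) Filter.atTop (nhds p.2.2.2) :=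
      (continuous_snd.snd.snd.tendsto p).comp hP
    refine tendsto_nhds_unique h1 ?_
    have hF : Filter.Tendsto (fun n => (P n).2.1) Filter.atTop (nhds p.2.1) :=
      (continuous_snd.fst.tendsto p).comp hP
    have h2 : Filter.Tendsto (fun n => (P n).1.2.1) Filter.atTop (nhds p.1.2.1) :=
      (continuous_fst.snd.fst.tendsto p).comp hP
    have h3 : Filter.Tendsto (fun n => (P n).2.2.1) Filter.atTop (nhds p.2.2.1) :=
      (continuous_snd.snd.fst.tendsto p).comp hP
    have h4 : Filter.Tendsto (fun n => (P n).1.2.2) Filter.atTop (nhds p.1.2.2) :=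
      (continuous_fst.snd.snd.tendsto p).comp hP
    simp only [(hmem' _).2.2]
    exact ((((h3.add (h2.const_mul _)).neg.div_const a).add
      (tendsto_primitive hL hF hl)).const_mul a).sub (h4.const_mul _)

/-! ### Symmetry and dissipativity in the energy form. -/

/-- The energy bilinear form. -/
def energyForm (a : ℝ) (u u' : StateSpace L) : ℝ :=
  inner ℝ u.1 u'.1 + (u.2.1 * u'.2.1 + u.2.2 * u'.2.2) / a

/-- The energy. -/
def energy (a : ℝ) (u : StateSpace L) : ℝ := energyForm a u u

theorem energyForm_comm (a : ℝ) (u u' : StateSpace L) :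
    energyForm a u u' = energyForm a u' u := by
  simp only [energyForm, real_inner_comm, mul_comm]

theorem energy_eq (a : ℝ) (u : StateSpace L) :
    energy a u = ‖u.1‖ ^ 2 + (u.2.1 ^ 2 + u.2.2 ^ 2) / a := by
  simp only [energy, energyForm, real_inner_self_eq_norm_sq, sq]

theorem energy_nonneg {a : ℝ} (ha : 0 < a) (u : StateSpace L) : 0 ≤ energy a u := by
  rw [energy_eq]; positivity

/-- Integration by parts. The weight 1/a on the traces makes the flux terms of the dynamic boundary
conditions cancel the boundary terms; what is left is visibly symmetric, and nonpositive on the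
diagonal. -/
theorem energyForm_generator (hL : 0 < L) {a : ℝ} (ha : 0 < a) {f u' : StateSpace L}
    {v w z v' w' : ℝ → ℝ} (h2 : IsH1 L w z)
    (h4 : ∀ᵐ x ∂(volume.restrict (Ioo (-L) 0)), f.1 x = z x)
    (h5 : f.2.1 = -(a * w 0) - a ^ 2 / 4 * v 0)
    (h6 : f.2.2 = a * w (-L) - a ^ 2 / 4 * v (-L))
    (h1' : IsH1 L v' w') (h3' : Represents L v' u') :
    energyForm a f u' =
      -(∫ x in (-L)..0, w x * w' x) - a / 4 * (v 0 * v' 0 + v (-L) * v' (-L)) := by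
  have hb := h2.integral_mul_add_mul hL h1'
  have hz : IntervalIntegrable (fun x => z x * v' x) volume (-L) 0 := by
    have := IsH1.memLp_mul (h1'.continuousOn hL) h2.1
    simp only [mul_comm (v' _)] at this
    exact MemLp.intervalIntegrable_Ioo hL this
  have hw : IntervalIntegrable (fun x => w x * w' x) volume (-L) 0 :=
    MemLp.intervalIntegrable_Ioo hL (IsH1.memLp_mul (h2.continuousOn hL) h1'.1)
  rw [intervalIntegral.integral_add hz hw] at hb
  have hin : inner ℝ f.1 u'.1 = ∫ x in (-L)..0, z x * v' x := by
    rw [L2.inner_def, intervalIntegral_eq_integral_Ioo hL]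
    refine integral_congr_ae ?_
    filter_upwards [h4, h3'.1] with x e1 e2
    rw [e1, e2]
    simp [mul_comm]
  rw [energyForm, hin, h5, h6, h3'.2.1, h3'.2.2]
  field_simp
  linarith

theorem IsSymGenerator.symm_energyForm (hL : 0 < L) {a : ℝ} (ha : 0 < a)
    {u f u' f' : StateSpace L} (h : IsSymGenerator a L u f) (h' : IsSymGenerator a L u' f') :
    energyForm a f u' = energyForm a f' u := by
  obtain ⟨v, w, z, h1, h2, h3, h4, h5, h6⟩ := h
  obtain ⟨v', w', z', h1', h2', h3', h4', h5', h6'⟩ := h'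
  rw [energyForm_generator hL ha h2 h4 h5 h6 h1' h3',
    energyForm_generator hL ha h2' h4' h5' h6' h1 h3]
  simp only [mul_comm]

/-- The source of the bound on the space derivative: it reduces u_x to the energies of u and of its
image. -/
theorem IsSymGenerator.exists_deriv (hL : 0 < L) {a : ℝ} (ha : 0 < a)
    {u f : StateSpace L} (h : IsSymGenerator a L u f) :
    ∃ v w, IsH1 L v w ∧ Represents L v u ∧ ∫ x in (-L)..0, w x ^ 2 ≤ - energyForm a f u := by
  obtain ⟨v, w, z, h1, h2, h3, h4, h5, h6⟩ := h
  refine ⟨v, w, h1, h3, ?_⟩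
  rw [energyForm_generator hL ha h2 h4 h5 h6 h1 h3]
  simp only [← sq]
  have : 0 ≤ a / 4 * (v 0 ^ 2 + v (-L) ^ 2) := by positivity
  linarith

theorem IsSymGenerator.energyForm_nonpos (hL : 0 < L) {a : ℝ} (ha : 0 < a)
    {u f : StateSpace L} (h : IsSymGenerator a L u f) : energyForm a f u ≤ 0 := by
  obtain ⟨v, w, -, -, hw⟩ := h.exists_deriv hL ha
  have : 0 ≤ ∫ x in (-L)..0, w x ^ 2 :=
    intervalIntegral.integral_nonneg (by linarith) fun _ _ => sq_nonneg _
  linarith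

end AdvDiff
end

/-! ### Energy monotonicity and smoothing for smooth solutions. -/

open MeasureTheory Set
noncomputable section
namespace AdvDiff

open scoped Nat

variable {L : ℝ}

theorem le_of_hasDerivAt_nonneg {g g' : ℝ → ℝ} {x y : ℝ} (hxy : x ≤ y)
    (hg : ∀ r ∈ Icc x y, HasDerivAt g (g' r) r) (hg' : ∀ r ∈ Icc x y, 0 ≤ g' r) : g x ≤ g y := by
  have hm : MonotoneOn g (Icc x y) := by
    refine monotoneOn_of_hasDerivWithinAt_nonneg (f' := g') (convex_Icc x y)
      (fun r hr => (hg r hr).continuousAt.continuousWithinAt)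
      (fun r hr => (hg r (interior_subset hr)).hasDerivWithinAt)
      (fun r hr => hg' r (interior_subset hr))
  exact hm (left_mem_Icc.2 hxy) (right_mem_Icc.2 hxy) hxy

theorem trace_sq_le_energy {a : ℝ} (ha : 0 < a) (u : StateSpace L) :
    u.2.1 ^ 2 ≤ a * energy a u := by
  rw [energy_eq]
  have : a * (‖u.1‖ ^ 2 + (u.2.1 ^ 2 + u.2.2 ^ 2) / a) =
      a * ‖u.1‖ ^ 2 + u.2.1 ^ 2 + u.2.2 ^ 2 := by field_simp; ring
  rw [this]
  nlinarith [sq_nonneg u.2.2, mul_nonneg ha.le (sq_nonneg ‖u.1‖)]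

theorem trace_left_sq_le_energy {a : ℝ} (ha : 0 < a) (u : StateSpace L) :
    u.2.2 ^ 2 ≤ a * energy a u := by
  rw [energy_eq]
  have : a * (‖u.1‖ ^ 2 + (u.2.1 ^ 2 + u.2.2 ^ 2) / a) =
      a * ‖u.1‖ ^ 2 + u.2.1 ^ 2 + u.2.2 ^ 2 := by field_simp; ring
  rw [this]
  nlinarith [sq_nonneg u.2.1, mul_nonneg ha.le (sq_nonneg ‖u.1‖)]

theorem norm_sq_le_energy {a : ℝ} (ha : 0 < a) (u : StateSpace L) :
    ‖u.1‖ ^ 2 ≤ energy a u := by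
  rw [energy_eq]
  have : 0 ≤ (u.2.1 ^ 2 + u.2.2 ^ 2) / a := by positivity
  linarith

theorem continuous_energy (a : ℝ) : Continuous (energy a : StateSpace L → ℝ) := by
  have : (energy a : StateSpace L → ℝ) = fun u => ‖u.1‖ ^ 2 + (u.2.1 ^ 2 + u.2.2 ^ 2) / a := by
    funext u; exact energy_eq a u
  rw [this]
  fun_prop

theorem HasDerivAt.energyForm (a : ℝ) {u u' : ℝ → StateSpace L} {du du' : StateSpace L} {t : ℝ}
    (hu : HasDerivAt u du t) (hu' : HasDerivAt u' du' t) :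
    HasDerivAt (fun r => energyForm a (u r) (u' r))
      (energyForm a du (u' t) + energyForm a (u t) du') t := by
  have hf : ∀ {u : ℝ → StateSpace L} {du : StateSpace L}, HasDerivAt u du t →
      HasDerivAt (fun r => (u r).1) du.1 t ∧ HasDerivAt (fun r => (u r).2.1) du.2.1 t ∧
      HasDerivAt (fun r => (u r).2.2) du.2.2 t := fun {u du} hu =>
    ⟨(ContinuousLinearMap.fst ℝ (Lp ℝ 2 (volume.restrict (Ioo (-L) 0))) (ℝ × ℝ)).hasFDerivAt
        |>.comp_hasDerivAt t hu,
      ((ContinuousLinearMap.fst ℝ ℝ ℝ).comp (ContinuousLinearMap.snd ℝ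
        (Lp ℝ 2 (volume.restrict (Ioo (-L) 0))) (ℝ × ℝ))).hasFDerivAt.comp_hasDerivAt t hu,
      ((ContinuousLinearMap.snd ℝ ℝ ℝ).comp (ContinuousLinearMap.snd ℝ
        (Lp ℝ 2 (volume.restrict (Ioo (-L) 0))) (ℝ × ℝ))).hasFDerivAt.comp_hasDerivAt t hu⟩
  obtain ⟨h1, h3, h5⟩ := hf hu
  obtain ⟨h2, h4, h6⟩ := hf hu'
  have := (h1.inner ℝ h2).add (((h3.mul h4).add (h5.mul h6)).div_const a)
  refine this.congr_deriv ?_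
  simp only [AdvDiff.energyForm]
  ring

/-- A smooth solution on `[t₀, t₁]`, given with all its time derivatives. -/
structure IsSmoothSolution (a L t₀ t₁ : ℝ) (U : ℕ → ℝ → StateSpace L) : Prop where
  hasDerivAt : ∀ j, ∀ t ∈ Icc t₀ t₁, HasDerivAt (U j) (U (j + 1) t) t
  generator : ∀ j, ∀ t ∈ Icc t₀ t₁, IsSymGenerator a L (U j t) (-U (j + 1) t)

namespace IsSmoothSolution

variable {a t₀ t₁ : ℝ} {U : ℕ → ℝ → StateSpace L}

theorem mono {t₀' t₁' : ℝ} (h : IsSmoothSolution a L t₀ t₁ U) (h0 : t₀ ≤ t₀') (h1 : t₁' ≤ t₁) :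
    IsSmoothSolution a L t₀' t₁' U :=
  ⟨fun j t ht => h.hasDerivAt j t ⟨h0.trans ht.1, ht.2.trans h1⟩,
    fun j t ht => h.generator j t ⟨h0.trans ht.1, ht.2.trans h1⟩⟩

theorem sub {V : ℕ → ℝ → StateSpace L} (h : IsSmoothSolution a L t₀ t₁ U)
    (h' : IsSmoothSolution a L t₀ t₁ V) :
    IsSmoothSolution a L t₀ t₁ (fun j t => U j t - V j t) := by
  refine ⟨fun j t ht => (h.hasDerivAt j t ht).sub (h'.hasDerivAt j t ht), fun j t ht => ?_⟩
  have h1 := (h.generator j t ht).add ((h'.generator j t ht).smul (-1))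
  simp only [neg_smul, one_smul, neg_neg] at h1
  convert! h1 using 1
  · abel
  · abel

theorem energyForm_neg_left (u u' : StateSpace L) : energyForm a (-u) u' = -energyForm a u u' := by
  simp only [energyForm, Prod.fst_neg, Prod.snd_neg, inner_neg_left]; ring

theorem energyForm_symm (hL : 0 < L) (ha : 0 < a) (h : IsSmoothSolution a L t₀ t₁ U) (i j : ℕ)
    {t : ℝ} (ht : t ∈ Icc t₀ t₁) :
    energyForm a (U (i + 1) t) (U j t) = energyForm a (U i t) (U (j + 1) t) := by
  have := (h.generator i t ht).symm_energyForm hL ha (h.generator j t ht)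
  rw [energyForm_neg_left, energyForm_neg_left, energyForm_comm a (U (j + 1) t)] at this
  linarith

theorem energyForm_nonneg (hL : 0 < L) (ha : 0 < a) (h : IsSmoothSolution a L t₀ t₁ U) (j : ℕ)
    {t : ℝ} (ht : t ∈ Icc t₀ t₁) : 0 ≤ energyForm a (U (j + 1) t) (U j t) := by
  have := (h.generator j t ht).energyForm_nonpos hL ha
  rw [energyForm_neg_left] at this
  linarith

/-- The equation is solved backward from the final time: u' is minus a nonpositive symmetric
operator applied to u, so the energy grows with t. -/
theorem energy_mono (hL : 0 < L) (ha : 0 < a) (h : IsSmoothSolution a L t₀ t₁ U) (j : ℕ)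
    {x y : ℝ} (hx : t₀ ≤ x) (hxy : x ≤ y) (hy : y ≤ t₁) :
    energy a (U j x) ≤ energy a (U j y) := by
  have hI : ∀ r ∈ Icc x y, r ∈ Icc t₀ t₁ := fun r hr => ⟨hx.trans hr.1, hr.2.trans hy⟩
  refine le_of_hasDerivAt_nonneg (g := fun r => energy a (U j r)) hxy
    (fun r hr => HasDerivAt.energyForm a (h.hasDerivAt j r (hI r hr)) (h.hasDerivAt j r (hI r hr)))
    (fun r hr => ?_)
  rw [← h.energyForm_symm hL ha j j (hI r hr)]
  have := h.energyForm_nonneg hL ha j (hI r hr)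
  linarith

/-- Smoothing effect. -/
theorem energy_succ_le (hL : 0 < L) (ha : 0 < a) (h : IsSmoothSolution a L t₀ t₁ U) (j : ℕ)
    {t δ : ℝ} (hδ : 0 ≤ δ) (ht : t₀ ≤ t) (htδ : t + δ ≤ t₁) :
    2 * δ ^ 2 * energy a (U (j + 1) t) ≤ energy a (U j (t + δ)) := by
  have hI : ∀ r ∈ Icc t (t + δ), r ∈ Icc t₀ t₁ := fun r hr => ⟨ht.trans hr.1, hr.2.trans htδ⟩
  set N := energy a (U (j + 1) t) with hN
  -- `m` is the derivative of the energy of `U j`. By symmetry its own derivative is four times the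
  -- energy of `U (j + 1)`, hence at least 4N by monotonicity; since `m t ≥ 0`, integrating twice
  -- gives the factor 2δ².
  set m : ℝ → ℝ := fun r => energyForm a (U (j + 1) r) (U j r) + energyForm a (U j r) (U (j + 1) r)
    with hm
  have hmder : ∀ r ∈ Icc t (t + δ), HasDerivAt (fun r => m r - 4 * N * (r - t))
      (4 * energy a (U (j + 1) r) - 4 * N) r := by
    intro r hr
    have d0 := h.hasDerivAt j r (hI r hr)
    have d1 := h.hasDerivAt (j + 1) r (hI r hr)
    have d2 := (HasDerivAt.energyForm a d1 d0).add (HasDerivAt.energyForm a d0 d1)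
    have d3 := ((hasDerivAt_id r).sub_const t).const_mul (4 * N)
    refine (d2.sub d3).congr_deriv ?_
    have e1 := h.energyForm_symm hL ha (j + 1) j (hI r hr)
    have e2 := energyForm_comm a (U j r) (U (j + 1 + 1) r)
    simp only [energy]
    rw [e2, e1]
    ring
  have hmge : ∀ r ∈ Icc t (t + δ), 0 ≤ m r - 4 * N * (r - t) := by
    intro r hr
    have hsub : ∀ y ∈ Icc t r, y ∈ Icc t (t + δ) := fun y hy => ⟨hy.1, hy.2.trans hr.2⟩
    have h1 := le_of_hasDerivAt_nonneg hr.1 (fun y hy => hmder y (hsub y hy)) (fun y hy => by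
      have := h.energy_mono hL ha (j + 1) ht hy.1 ((hsub y hy).2.trans htδ)
      linarith)
    refine le_trans ?_ h1
    have ht' : t ∈ Icc t₀ t₁ := hI t ⟨le_rfl, by linarith⟩
    simp only [hm, sub_self, mul_zero, sub_zero]
    rw [← h.energyForm_symm hL ha j j ht']
    have := h.energyForm_nonneg hL ha j ht'
    linarith
  have h2 := le_of_hasDerivAt_nonneg (x := t) (y := t + δ)
    (g := fun r => energy a (U j r) - 2 * N * (r - t) ^ 2)
    (g' := fun r => m r - 4 * N * (r - t)) (by linarith) (fun r hr => by
      have d0 := h.hasDerivAt j r (hI r hr)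
      have d3 := (((hasDerivAt_id r).sub_const t).pow 2).const_mul (2 * N)
      refine ((HasDerivAt.energyForm a d0 d0).sub d3).congr_deriv ?_
      simp only [hm, id_eq]
      push_cast
      ring) hmge
  simp only [sub_self, add_sub_cancel_left] at h2
  have := energy_nonneg ha (U j t)
  nlinarith

/-- Smoothing iterated over j steps of length η, the factors 2 being dropped. -/
theorem pow_mul_energy_le (hL : 0 < L) (ha : 0 < a) (h : IsSmoothSolution a L t₀ t₁ U) (j : ℕ)
    {t η : ℝ} (hη : 0 ≤ η) (ht : t₀ ≤ t) (htη : t + j * η ≤ t₁) :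
    (η ^ j) ^ 2 * energy a (U j t) ≤ energy a (U 0 (t + j * η)) := by
  induction j generalizing t with
  | zero => simp
  | succ j ih =>
    push_cast at htη ⊢
    have h1 := h.energy_succ_le hL ha j hη ht (by nlinarith [mul_nonneg (Nat.cast_nonneg j) hη])
    have h2 := ih (t := t + η) (by linarith) (by linarith)
    rw [show t + η + j * η = t + (j + 1) * η by ring] at h2
    refine le_trans ?_ h2
    have h3 := energy_nonneg ha (U (j + 1) t)
    calc (η ^ (j + 1)) ^ 2 * energy a (U (j + 1) t)
        = (η ^ j) ^ 2 * (η ^ 2 * energy a (U (j + 1) t)) := by ring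
      _ ≤ (η ^ j) ^ 2 * energy a (U j (t + η)) := by
        gcongr
        nlinarith [mul_nonneg (sq_nonneg η) h3]

/-- All derivatives of order at most `n` are bounded in terms of the later energy. -/
theorem sqrt_energy_le (hL : 0 < L) (ha : 0 < a) (h : IsSmoothSolution a L t₀ t₁ U) {j n : ℕ}
    (hjn : j ≤ n) {t δ : ℝ} (hδ : 0 < δ) (hn : δ ≤ n) (ht : t₀ ≤ t) (htδ : t + δ ≤ t₁) :
    √(energy a (U j t)) ≤ (n / δ) ^ n * √(energy a (U 0 (t + δ))) := by
  have hn0 : (0 : ℝ) < n := hδ.trans_le hn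
  have hjn' : (j : ℝ) ≤ n := by exact_mod_cast hjn
  have hη : 0 < δ / n := by positivity
  have hle : j * (δ / n) ≤ δ := by
    rw [← mul_div_assoc, div_le_iff₀ hn0]; nlinarith
  have h1 := h.pow_mul_energy_le hL ha j hη.le ht (by linarith)
  have h2 := h.energy_mono hL ha 0 (x := t + j * (δ / n)) (y := t + δ)
    (by nlinarith [mul_nonneg (Nat.cast_nonneg j) hη.le]) (by linarith) htδ
  have h3 := h1.trans h2
  have h4 : √((((δ / n) ^ j) ^ 2) * energy a (U j t)) ≤ √(energy a (U 0 (t + δ))) :=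
    Real.sqrt_le_sqrt h3
  rw [Real.sqrt_mul (by positivity), Real.sqrt_sq (by positivity)] at h4
  -- Because δ ≤ n the base is at least 1, so the exponent j may be raised to n and one bound serves
  -- all orders.
  have h5 : (1 : ℝ) ≤ n / δ := by rwa [le_div_iff₀ hδ, one_mul]
  calc √(energy a (U j t)) = (n / δ) ^ j * ((δ / n) ^ j * √(energy a (U j t))) := by
        rw [← mul_assoc, ← mul_pow, div_mul_div_cancel₀ hδ.ne', div_self hn0.ne', one_pow, one_mul]
    _ ≤ (n / δ) ^ n * √(energy a (U 0 (t + δ))) := by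
        gcongr

end IsSmoothSolution

/-! ### Continuation in the space variable -/

/-- Majorants depend on -x, the distance to the observed end, and are integrated from there. -/
theorem abs_primitive_le {g b b' : ℝ → ℝ}
    (hg : ∀ᵐ x ∂(volume.restrict (Ioo (-L) 0)), |g x| ≤ b' (-x))
    (hb : ∀ y, HasDerivAt b (b' y) y) (hb' : Continuous b') (hb0 : b 0 = 0)
    (hpos : ∀ y, 0 ≤ y → 0 ≤ b y) {x : ℝ} (hx : x ∈ Icc (-L) 0) :
    |∫ r in (0 : ℝ)..x, g r| ≤ b (-x) := by
  have h1 : ∀ᵐ r ∂(volume.restrict (uIoc (0 : ℝ) x)), ‖g r‖ ≤ b' (-r) := by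
    rw [ae_restrict_iff' measurableSet_Ioo] at hg
    rw [ae_restrict_iff' measurableSet_uIoc]
    have h2 : ∀ᵐ y : ℝ, y ≠ 0 := by simp [ae_iff]
    filter_upwards [hg, h2] with y hy hy0 hy'
    rw [uIoc_of_ge hx.2] at hy'
    exact hy ⟨hx.1.trans_lt hy'.1, lt_of_le_of_ne hy'.2 hy0⟩
  have hc : Continuous fun r => b' (-r) := hb'.comp continuous_neg
  have h3 := intervalIntegral.norm_integral_le_abs_of_norm_le h1 (hc.intervalIntegrable _ _)
  refine h3.trans (le_of_eq ?_)
  have hd : ∀ y : ℝ, HasDerivAt (fun r => -b (-r)) (b' (-y)) y := by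
    intro y
    have := ((hb (-y)).comp y (hasDerivAt_neg y)).neg
    refine this.congr_deriv (by ring)
  rw [intervalIntegral.integral_eq_sub_of_hasDerivAt (fun y _ => hd y) (hc.intervalIntegrable _ _)]
  rw [neg_zero, hb0, neg_zero, sub_zero, abs_neg, abs_of_nonneg (hpos _ (by linarith [hx.2]))]

/-- The majorant series. -/
def majorant (F G : ℕ → ℝ) (S : ℝ) (n k : ℕ) (y : ℝ) : ℝ :=
  ∑ i ∈ Finset.range n, (F i * (y ^ (2 * i + k) / (2 * i + k)!) +
    G i * (y ^ (2 * i + 1 + k) / (2 * i + 1 + k)!)) + S * (y ^ (2 * n + k) / (2 * n + k)!)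

theorem hasDerivAt_pow_succ_div_factorial (m : ℕ) (y : ℝ) :
    HasDerivAt (fun y : ℝ => y ^ (m + 1) / (m + 1)!) (y ^ m / m !) y := by
  refine ((hasDerivAt_pow (m + 1) y).div_const _).congr_deriv ?_
  rw [Nat.factorial_succ, add_tsub_cancel_right]
  push_cast
  field_simp

/-- The index k counts integrations in x: a primitive vanishing at 0 raises it by one. -/
theorem hasDerivAt_majorant (F G : ℕ → ℝ) (S : ℝ) (n k : ℕ) (y : ℝ) :
    HasDerivAt (majorant F G S n (k + 1)) (majorant F G S n k y) y := by
  unfold majorant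
  refine HasDerivAt.add (HasDerivAt.fun_sum fun i _ => HasDerivAt.add ?_ ?_) ?_
  · exact (hasDerivAt_pow_succ_div_factorial (2 * i + k) y).const_mul _
  · exact (hasDerivAt_pow_succ_div_factorial (2 * i + 1 + k) y).const_mul _
  · exact (hasDerivAt_pow_succ_div_factorial (2 * n + k) y).const_mul _

theorem continuous_majorant (F G : ℕ → ℝ) (S : ℝ) (n k : ℕ) : Continuous (majorant F G S n k) := by
  unfold majorant
  fun_prop

theorem majorant_nonneg {F G : ℕ → ℝ} (hF : ∀ i, 0 ≤ F i) (hG : ∀ i, 0 ≤ G i) {S : ℝ} (hS : 0 ≤ S)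
    (n k : ℕ) {y : ℝ} (hy : 0 ≤ y) : 0 ≤ majorant F G S n k y := by
  unfold majorant
  have := fun i => hF i
  have := fun i => hG i
  refine add_nonneg (Finset.sum_nonneg fun i _ => add_nonneg (mul_nonneg (hF i) (by positivity))
    (mul_nonneg (hG i) (by positivity))) (by positivity)

/-- The Cauchy data in `x` at `x = 0` of a solution, in terms of the trace. -/
def slope (a : ℝ) (u : ℕ → StateSpace L) (j : ℕ) : ℝ :=
  ((u (j + 1)).2.1 - a ^ 2 / 4 * (u j).2.1) / a

theorem cauchyExtension_eq (a : ℝ) (u : ℕ → StateSpace L) (j : ℕ) (x : ℝ) :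
    cauchyExtension a (u j, -u (j + 1)) x = (u j).2.1 + slope a u j * x +
      ∫ y in (0 : ℝ)..x, ∫ r in (0 : ℝ)..y, (-u (j + 1)).1 r := by
  simp only [cauchyExtension, slope, Prod.snd_neg, Prod.fst_neg]
  ring

/-- Since u_xx = -u_t, u is its Cauchy data at x = 0 plus a double primitive of -u_t. Substituting
the same formula for u_t, n times in all, yields the series, with S bounding the n-th time
derivative. In the induction the two primitives move k from 0 to 2. -/
theorem abs_cauchyExtension_le_majorant (hL : 0 < L) {a : ℝ} (ha : 0 < a)
    {u : ℕ → StateSpace L} (hu : ∀ j, IsSymGenerator a L (u j) (-u (j + 1))) {S : ℝ} (hS : 0 ≤ S)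
    (n j : ℕ) (hSn : ∀ x ∈ Icc (-L) 0, |cauchyExtension a (u (j + n), -u (j + n + 1)) x| ≤ S) :
    ∀ x ∈ Icc (-L) 0, |cauchyExtension a (u j, -u (j + 1)) x| ≤
      majorant (fun i => |(u (j + i)).2.1|) (fun i => |slope a u (j + i)|) S n 0 (-x) := by
  induction n generalizing j with
  | zero =>
    intro x hx
    simpa [majorant] using hSn x hx
  | succ n ih =>
    intro x hx
    set F : ℕ → ℝ := fun i => |(u (j + 1 + i)).2.1| with hF
    set G : ℕ → ℝ := fun i => |slope a u (j + 1 + i)| with hG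
    have ih' := ih (j + 1) (fun x hx => by
      have := hSn x hx
      rwa [show j + (n + 1) = j + 1 + n by ring] at this)
    have hFp : ∀ i, 0 ≤ F i := fun i => abs_nonneg _
    have hGp : ∀ i, 0 ≤ G i := fun i => abs_nonneg _
    have hrep := ((isSymGenerator_iff hL ha (u (j + 1), -u (j + 1 + 1))).1 (hu (j + 1))).1
    have h1 : ∀ᵐ r ∂(volume.restrict (Ioo (-L) 0)), |(-u (j + 1)).1 r| ≤
        majorant F G S n 0 (-r) := by
      filter_upwards [hrep, Lp.coeFn_neg (u (j + 1)).1, ae_restrict_mem measurableSet_Ioo]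
        with r hr1 hr2 hr3
      rw [Prod.fst_neg, hr2, Pi.neg_apply, abs_neg, hr1]
      exact ih' r (Ioo_subset_Icc_self hr3)
    have hz : ∀ k, majorant F G S n (k + 1) 0 = 0 := by intro k; simp [majorant]
    have h2 : ∀ y ∈ Icc (-L) 0, |∫ r in (0 : ℝ)..y, (-u (j + 1)).1 r| ≤
        majorant F G S n 1 (-y) := fun y hy =>
      abs_primitive_le h1 (hasDerivAt_majorant F G S n 0) (continuous_majorant F G S n 0) (hz 0)
        (fun y hy => majorant_nonneg hFp hGp hS n 1 hy) hy
    have h3 : |∫ y in (0 : ℝ)..x, ∫ r in (0 : ℝ)..y, (-u (j + 1)).1 r| ≤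
        majorant F G S n 2 (-x) :=
      abs_primitive_le ((ae_restrict_iff' measurableSet_Ioo).2
        (Filter.Eventually.of_forall fun y hy => h2 y (Ioo_subset_Icc_self hy)))
        (hasDerivAt_majorant F G S n 1) (continuous_majorant F G S n 1) (hz 1)
        (fun y hy => majorant_nonneg hFp hGp hS n 2 hy) hx
    rw [cauchyExtension_eq]
    have h4 : |(u j).2.1 + slope a u j * x + ∫ y in (0 : ℝ)..x, ∫ r in (0 : ℝ)..y,
        (-u (j + 1)).1 r| ≤ |(u j).2.1| + |slope a u j| * (-x) + majorant F G S n 2 (-x) := by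
      refine (abs_add_le _ _).trans (add_le_add ((abs_add_le _ _).trans ?_) h3)
      rw [abs_mul, abs_of_nonpos hx.2]
    refine h4.trans (le_of_eq ?_)
    unfold majorant
    rw [Finset.sum_range_succ']
    have e : ∀ i, |(u (j + (i + 1))).2.1| * ((-x) ^ (2 * (i + 1) + 0) / (2 * (i + 1) + 0)!) +
        |slope a u (j + (i + 1))| * ((-x) ^ (2 * (i + 1) + 1 + 0) / (2 * (i + 1) + 1 + 0)!) =
        F i * ((-x) ^ (2 * i + 2) / (2 * i + 2)!) +
          G i * ((-x) ^ (2 * i + 1 + 2) / (2 * i + 1 + 2)!) := by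
      intro i
      rw [show j + (i + 1) = j + 1 + i by ring, show 2 * (i + 1) + 1 + 0 = 2 * i + 1 + 2 by ring,
        show 2 * (i + 1) + 0 = 2 * i + 2 by ring]
    rw [Finset.sum_congr rfl fun i _ => e i, show 2 * (n + 1) + 0 = 2 * n + 2 by ring]
    norm_num
    ring

/-- A crude bound, needed only for the remainder S of the series. -/
theorem abs_cauchyExtension_le (hL : 0 < L) (a : ℝ) (u : ℕ → StateSpace L) (j : ℕ) {x : ℝ}
    (hx : x ∈ Icc (-L) 0) :
    |cauchyExtension a (u j, -u (j + 1)) x| ≤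
      |(u j).2.1| + |slope a u j| * L + √L * L * ‖(u (j + 1)).1‖ := by
  have h0 : (0 : ℝ) ∈ Icc (-L) 0 := ⟨by linarith, le_rfl⟩
  rw [cauchyExtension_eq]
  refine (abs_add_le _ _).trans (add_le_add ((abs_add_le _ _).trans ?_) ?_)
  · rw [abs_mul]
    gcongr
    rw [abs_le]; constructor <;> linarith [hx.1, hx.2]
  · have h1 : ∀ y ∈ uIoc (0 : ℝ) x, ‖∫ r in (0 : ℝ)..y, (-u (j + 1)).1 r‖ ≤
        √L * ‖(u (j + 1)).1‖ := by
      intro y hy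
      have := abs_intervalIntegral_le hL (-u (j + 1)).1 h0
        (uIcc_subset_Icc h0 hx (uIoc_subset_uIcc hy))
      rwa [Prod.fst_neg, norm_neg] at this
    have h2 := intervalIntegral.norm_integral_le_of_norm_le_const h1
    rw [Real.norm_eq_abs, sub_zero, abs_of_nonpos hx.2] at h2
    refine h2.trans ?_
    have : -x ≤ L := by linarith [hx.1]
    calc √L * ‖(u (j + 1)).1‖ * -x ≤ √L * ‖(u (j + 1)).1‖ * L := by gcongr
      _ = _ := by ring

/-- The interior contributes L and the two traces 2/a. -/
theorem energy_le_of_cauchyExtension (hL : 0 < L) {a : ℝ} (ha : 0 < a) {u f : StateSpace L}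
    (h : IsSymGenerator a L u f) {B : ℝ}
    (hB : ∀ x ∈ Icc (-L) 0, |cauchyExtension a (u, f) x| ≤ B) :
    energy a u ≤ (L + 2 / a) * B ^ 2 := by
  obtain ⟨h1, h2, -⟩ := (isSymGenerator_iff hL ha (u, f)).1 h
  simp only at h1 h2
  have hB2 : ∀ x ∈ Icc (-L) 0, cauchyExtension a (u, f) x ^ 2 ≤ B ^ 2 := fun x hx => by
    rw [← sq_abs]; exact pow_le_pow_left₀ (abs_nonneg _) (hB x hx) 2
  have e1 : ‖u.1‖ ^ 2 ≤ L * B ^ 2 := by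
    rw [norm_sq_eq_integral]
    have h3 : ∫ x, u.1 x ^ 2 ∂(volume.restrict (Ioo (-L) 0)) ≤
        ∫ _, B ^ 2 ∂(volume.restrict (Ioo (-L) 0)) := by
      refine integral_mono_ae (Lp.memLp u.1).integrable_sq (integrable_const _) ?_
      filter_upwards [h1, ae_restrict_mem measurableSet_Ioo] with x hx hx'
      rw [hx]; exact hB2 x (Ioo_subset_Icc_self hx')
    rw [integral_const] at h3
    simpa [Measure.real, hL.le] using h3
  have e2 : u.2.2 ^ 2 ≤ B ^ 2 := by rw [h2]; exact hB2 _ ⟨le_rfl, by linarith⟩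
  have e3 : u.2.1 ^ 2 ≤ B ^ 2 := by
    have := hB2 0 ⟨by linarith, le_rfl⟩
    simpa [cauchyExtension] using this
  rw [energy_eq]
  have : (u.2.1 ^ 2 + u.2.2 ^ 2) / a ≤ (B ^ 2 + B ^ 2) / a := by gcongr
  calc _ ≤ L * B ^ 2 + (B ^ 2 + B ^ 2) / a := add_le_add e1 this
    _ = _ := by ring

end AdvDiff
end

/-! ### Observability of smooth solutions from the trace at x = 0. -/

open MeasureTheory Set
noncomputable section
namespace AdvDiff

open scoped Nat

variable {L : ℝ}

theorem nat_le_exp (n : ℕ) : (n : ℝ) ≤ Real.exp n :=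
  (by linarith [Real.add_one_le_exp (n : ℝ)])

/-- Bound of the majorant series when the data are controlled as analytic functions. -/
theorem majorant_le {F G : ℕ → ℝ} {S W Λ h a y : ℝ} {m : ℕ} (hW : 0 ≤ W) (hh : 0 < h)
    (hS : 0 ≤ S) (hΛ : 1 ≤ Λ) (ha : 0 ≤ a) (hy : y ∈ Icc 0 Λ)
    (hF : ∀ i ≤ m, F i * h ^ i ≤ i ! * W) (hG : ∀ i < m, G i ≤ F (i + 1) + a * F i) :
    majorant F G S m 0 y ≤
      (1 + Λ / h + Λ * a) * Real.exp (Λ ^ 2 / h) * W + S * (Λ ^ (2 * m) / (2 * m)!) := by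
  have hy0 := hy.1
  have hF' : ∀ i ≤ m, F i ≤ i ! * W / h ^ i := fun i hi => by
    rw [le_div_iff₀ (pow_pos hh i)]; exact hF i hi
  have hterm : ∀ i ∈ Finset.range m, F i * (y ^ (2 * i + 0) / (2 * i + 0)!) +
      G i * (y ^ (2 * i + 1 + 0) / (2 * i + 1 + 0)!) ≤
      (1 + Λ / h + Λ * a) * W * ((Λ ^ 2 / h) ^ i / i !) := by
    intro i hi
    have him := Finset.mem_range.1 hi
    simp only [add_zero]
    -- Two space integrations per time derivative: (2i)! beats the growth i!/hⁱ of the data by a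
    -- further i!, leaving the exponential series in Λ²/h.
    have f1 : (i ! : ℝ) * i ! ≤ (2 * i)! := by
      have := Nat.factorial_mul_factorial_dvd_factorial_add i i
      rw [two_mul]
      exact_mod_cast Nat.le_of_dvd (Nat.factorial_pos _) this
    have f2 : ((i + 1)! : ℝ) * i ! ≤ (2 * i + 1)! := by
      have := Nat.factorial_mul_factorial_dvd_factorial_add (i + 1) i
      rw [show 2 * i + 1 = i + 1 + i by ring]
      exact_mod_cast Nat.le_of_dvd (Nat.factorial_pos _) this
    have f3 : (i ! : ℝ) * i ! ≤ (2 * i + 1)! := by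
      refine f1.trans ?_
      exact_mod_cast Nat.factorial_le (by omega)
    have g1 : y ^ (2 * i) ≤ Λ ^ (2 * i) := pow_le_pow_left₀ hy0 hy.2 _
    have g2 : y ^ (2 * i + 1) ≤ Λ ^ (2 * i + 1) := pow_le_pow_left₀ hy0 hy.2 _
    have i1 : (i ! : ℝ) / (2 * i)! ≤ 1 / i ! := by
      rw [div_le_div_iff₀ (by positivity) (by positivity)]; linarith
    have i2 : ((i + 1)! : ℝ) / (2 * i + 1)! ≤ 1 / i ! := by
      rw [div_le_div_iff₀ (by positivity) (by positivity)]; linarith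
    have i3 : (i ! : ℝ) / (2 * i + 1)! ≤ 1 / i ! := by
      rw [div_le_div_iff₀ (by positivity) (by positivity)]; linarith
    have t1 : F i * (y ^ (2 * i) / (2 * i)!) ≤ W * ((Λ ^ 2 / h) ^ i / i !) := by
      calc F i * (y ^ (2 * i) / (2 * i)!) ≤ (i ! * W / h ^ i) * (Λ ^ (2 * i) / (2 * i)!) := by
            refine mul_le_mul (hF' i him.le) (by gcongr) (by positivity) (by positivity)
        _ = W * (Λ ^ 2 / h) ^ i * ((i ! : ℝ) / (2 * i)!) := by
            rw [div_pow, pow_mul]; ring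
        _ ≤ W * (Λ ^ 2 / h) ^ i * (1 / i !) := by gcongr
        _ = _ := by ring
    have t2 : F (i + 1) * (y ^ (2 * i + 1) / (2 * i + 1)!) ≤
        Λ / h * W * ((Λ ^ 2 / h) ^ i / i !) := by
      calc F (i + 1) * (y ^ (2 * i + 1) / (2 * i + 1)!)
          ≤ ((i + 1)! * W / h ^ (i + 1)) * (Λ ^ (2 * i + 1) / (2 * i + 1)!) := by
            refine mul_le_mul (hF' _ him) (by gcongr) (by positivity) (by positivity)
        _ = Λ / h * W * (Λ ^ 2 / h) ^ i * (((i + 1)! : ℝ) / (2 * i + 1)!) := by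
            rw [div_pow, ← pow_mul, pow_succ, pow_succ]; ring
        _ ≤ Λ / h * W * (Λ ^ 2 / h) ^ i * (1 / i !) := by gcongr
        _ = _ := by ring
    have t3 : a * F i * (y ^ (2 * i + 1) / (2 * i + 1)!) ≤
        Λ * a * W * ((Λ ^ 2 / h) ^ i / i !) := by
      calc a * F i * (y ^ (2 * i + 1) / (2 * i + 1)!)
          ≤ (a * (i ! * W / h ^ i)) * (Λ ^ (2 * i + 1) / (2 * i + 1)!) := by
            refine mul_le_mul (mul_le_mul_of_nonneg_left (hF' _ him.le) ha) (by gcongr)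
              (by positivity) (by positivity)
        _ = Λ * a * W * (Λ ^ 2 / h) ^ i * ((i ! : ℝ) / (2 * i + 1)!) := by
            rw [div_pow, ← pow_mul, pow_succ]; ring
        _ ≤ Λ * a * W * (Λ ^ 2 / h) ^ i * (1 / i !) := by gcongr
        _ = _ := by ring
    have t4 : G i * (y ^ (2 * i + 1) / (2 * i + 1)!) ≤
        (F (i + 1) + a * F i) * (y ^ (2 * i + 1) / (2 * i + 1)!) :=
      mul_le_mul_of_nonneg_right (hG i him) (by positivity)
    linarith
  unfold majorant
  refine add_le_add ((Finset.sum_le_sum hterm).trans ?_) ?_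
  · rw [← Finset.mul_sum]
    have := Real.sum_le_exp_of_nonneg (x := Λ ^ 2 / h) (by positivity) m
    calc _ ≤ (1 + Λ / h + Λ * a) * W * Real.exp (Λ ^ 2 / h) := by gcongr
      _ = _ := by ring
  · rw [add_zero]
    gcongr
    exact hy.2

/-- The remainder balances a smoothing cost of order nⁿ against a gain of order n^{-2n} from the
factorial. The base on the right is small as soon as n is a large multiple of 1/δ. -/
theorem div_factorial_two_mul_le {n : ℕ} (hn : 0 < n) {δ Λ : ℝ} (hδ : 0 < δ) (hΛ : 1 ≤ Λ) :
    (2 * n / δ) ^ n * (Λ ^ (2 * (n - 1)) / (2 * (n - 1))!) ≤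
      (2 * n) ^ 2 * (2 * Real.exp 1 * Λ ^ 2 / (δ * n)) ^ n := by
  have hnR : (0 : ℝ) < n := by exact_mod_cast hn
  obtain ⟨m, rfl⟩ : ∃ m, n = m + 1 := ⟨n - 1, by omega⟩
  simp only [add_tsub_cancel_right]
  have h1 : ((2 * (m + 1))! : ℝ) ≤ (2 * ((m + 1 : ℕ) : ℝ)) ^ 2 * (2 * m)! := by
    rw [show 2 * (m + 1) = (2 * m + 1) + 1 by ring, Nat.factorial_succ, Nat.factorial_succ]
    push_cast
    have : (0 : ℝ) < (2 * m)! := by positivity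
    have h3 : (2 * (m : ℝ) + 1 + 1) * (2 * m + 1) ≤ (2 * (m + 1)) ^ 2 := by nlinarith
    calc _ = (2 * (m : ℝ) + 1 + 1) * (2 * m + 1) * (2 * m)! := by ring
      _ ≤ _ := by gcongr
  have h2 : ((m + 1)! : ℝ) * ((m + 1 : ℕ) : ℝ) ^ (m + 1) ≤ (2 * (m + 1))! := by
    have := Nat.factorial_mul_pow_sub_le_factorial (n := m + 1) (m := 2 * (m + 1)) (by omega)
    rw [show 2 * (m + 1) - (m + 1) = m + 1 by omega] at this
    exact_mod_cast this
  have h4 := pow_self_le_exp_mul_factorial (m + 1)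
  set n : ℕ := m + 1 with hn'
  have h5 : (1 : ℝ) / (2 * m)! ≤ (2 * n) ^ 2 * (Real.exp n / ((n : ℝ) ^ n * (n : ℝ) ^ n)) := by
    rw [mul_div_assoc', div_le_div_iff₀ (by positivity) (by positivity), one_mul]
    have hE : 0 < Real.exp (n : ℝ) := Real.exp_pos _
    calc (n : ℝ) ^ n * (n : ℝ) ^ n ≤ (Real.exp n * n !) * (n : ℝ) ^ n := by gcongr
      _ = Real.exp n * (n ! * (n : ℝ) ^ n) := by ring
      _ ≤ Real.exp n * ((2 * n) ^ 2 * (2 * m)!) := by exact mul_le_mul_of_nonneg_left (h2.trans h1) hE.le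
      _ = _ := by ring
  have h6 : Λ ^ (2 * m) ≤ Λ ^ (2 * n) := pow_le_pow_right₀ hΛ (by omega)
  calc (2 * n / δ) ^ n * (Λ ^ (2 * m) / (2 * m)!)
      = (2 * n / δ) ^ n * Λ ^ (2 * m) * (1 / (2 * m)!) := by ring
    _ ≤ (2 * n / δ) ^ n * Λ ^ (2 * n) *
        ((2 * n) ^ 2 * (Real.exp n / ((n : ℝ) ^ n * (n : ℝ) ^ n))) := by
        gcongr
    _ = _ := by
        have : Real.exp (n : ℝ) = Real.exp 1 ^ n := by rw [← Real.exp_nat_mul, mul_one]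
        rw [this, pow_mul]
        simp only [div_pow, mul_pow]
        field_simp

/-- The constant in the interpolation estimate. -/
def interpConst (L : ℝ) : ℝ :=
  2 * (1 + L) ^ 2 * Real.exp 19 + 8 * (L + 2) + (1 + 2 * L + L * √L)

theorem interpConst_pos (hL : 0 < L) : 0 < interpConst L := by unfold interpConst; positivity

/-- All requirements on n, collected. The first summand of `interpConst` serves those involving δ or
a; the other two serve the constants depending on L alone. -/
theorem interpConst_bounds (hL : 0 < L) {a δ : ℝ} {n : ℕ} (ha : 1 ≤ a) (hδ : 0 < δ)
    (hδ1 : δ ≤ 1) (hn : interpConst L * (1 / δ + a) ≤ n) :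
    (1 + L) ^ 2 / (Real.exp (-19) / 2 * δ) ≤ n ∧ (1 + L) * a ≤ n ∧ 1 + 2 * L + L * √L ≤ n ∧
      a ≤ n ∧ 2 * Real.exp 1 * (1 + L) ^ 2 / (δ * n) ≤ Real.exp (-18) ∧ 8 * (L + 2) ≤ n := by
  set Λ := 1 + L with hΛ
  have hΛ1 : 1 ≤ Λ := by linarith
  have hC0 := interpConst_pos hL
  have hδinv : 1 ≤ 1 / δ := by rw [le_div_iff₀ hδ]; linarith
  have hn0 : (0 : ℝ) < n := lt_of_lt_of_le (by positivity) hn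
  have hCge : ∀ c, c ≤ interpConst L → 0 ≤ c → c ≤ n ∧ c * (1 / δ) ≤ n ∧ c * a ≤ n := by
    intro c hc hc0
    have e1 : c * (1 / δ + a) ≤ n := (mul_le_mul_of_nonneg_right hc (by positivity)).trans hn
    have e2 : 0 ≤ c * (1 / δ) := by positivity
    have e3 : 0 ≤ c * a := by positivity
    have e4 : c ≤ c * a := by nlinarith
    refine ⟨by linarith, by linarith, by linarith⟩
  have p0 : 0 < 2 * Λ ^ 2 * Real.exp 19 := by positivity
  have p1 : 0 < 8 * (L + 2) := by positivity
  have p2 : 0 < 1 + 2 * L + L * √L := by positivity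
  have hκinv : 1 / (Real.exp (-19) / 2) = 2 * Real.exp 19 := by
    rw [Real.exp_neg]; field_simp
  have hexp19 : 1 ≤ Real.exp 19 := by rw [Real.one_le_exp_iff]; norm_num
  have c2 : Λ * a ≤ n := (hCge Λ (by
    unfold interpConst
    have : Λ ≤ 2 * Λ ^ 2 * Real.exp 19 := by
      have : Λ ≤ Λ ^ 2 := by nlinarith
      nlinarith
    linarith) (by linarith)).2.2
  have c0 := (hCge (2 * Λ ^ 2 * Real.exp 19) (by unfold interpConst; linarith) p0.le).2.1
  refine ⟨?_, c2, (hCge _ (by unfold interpConst; linarith) p2.le).1, by nlinarith, ?_,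
    (hCge _ (by unfold interpConst; linarith) p1.le).1⟩
  · refine le_trans (le_of_eq ?_) c0
    rw [div_mul_eq_div_div, div_eq_mul_one_div (Λ ^ 2), hκinv]; ring
  · rw [div_le_iff₀ (by positivity)]
    rw [mul_one_div, div_le_iff₀ hδ] at c0
    have e19 : Real.exp 19 = Real.exp 1 * Real.exp 18 := by rw [← Real.exp_add]; norm_num
    rw [e19] at c0
    have e18 : Real.exp (-18) * Real.exp 18 = 1 := by rw [← Real.exp_add]; norm_num
    have h18 : 0 < Real.exp (-18) := Real.exp_pos _
    calc 2 * Real.exp 1 * Λ ^ 2 = Real.exp (-18) * (2 * Λ ^ 2 * (Real.exp 1 * Real.exp 18)) := by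
          linear_combination (-2 * Real.exp 1 * Λ ^ 2) * e18
      _ ≤ Real.exp (-18) * (δ * n) := mul_le_mul_of_nonneg_left (by linarith) h18.le

theorem sqrt_le_exp_of_le {a : ℝ} {n : ℕ} (ha : 1 ≤ a) (han : a ≤ n) : √a ≤ Real.exp n := by
  refine le_trans ?_ (han.trans (nat_le_exp n))
  rw [Real.sqrt_le_left (by linarith)]; nlinarith

theorem exp_mul_nat (c : ℝ) (n : ℕ) : Real.exp (c * n) = Real.exp c ^ n := by
  rw [← Real.exp_nat_mul, mul_comm]

theorem two_mul_sq_le_exp (n : ℕ) : (2 * (n : ℝ)) ^ 2 ≤ Real.exp (2 * n) ^ 2 := by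
  gcongr
  linarith [Real.add_one_le_exp (2 * (n : ℝ))]

theorem exp_one_mul_eight_pow_le (n : ℕ) : (Real.exp 1 * 8) ^ n ≤ Real.exp (4 * n) := by
  rw [exp_mul_nat]
  refine pow_le_pow_left₀ (by positivity) ?_ n
  have : (8 : ℝ) ≤ Real.exp 3 := by
    have h2 : (2 : ℝ) ≤ Real.exp 1 := by linarith [Real.add_one_le_exp (1 : ℝ)]
    have h3 : Real.exp 3 = Real.exp 1 ^ 3 := by rw [← Real.exp_nat_mul]; norm_num
    rw [h3]
    calc (8 : ℝ) = 2 ^ 3 := by norm_num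
      _ ≤ _ := by gcongr
  calc Real.exp 1 * 8 ≤ Real.exp 1 * Real.exp 3 := by gcongr
    _ = Real.exp 4 := by rw [← Real.exp_add]; norm_num

/-- Interpolation for functions with analytic bounds on the derivatives. -/
theorem abs_deriv_le_of_analytic {a δ t M : ℝ} {n : ℕ} (ha : 1 ≤ a) (han : a ≤ n) (hδ : 0 < δ)
    (hM : 0 ≤ M) {h : ℝ} (hh : h = Real.exp (-19) / 2 * δ) (hhδ : h ≤ δ) (hhn : 1 / h ≤ n)
    {F : ℕ → ℝ → ℝ} (hF : ∀ j, ∀ r ∈ Icc t (t + δ), HasDerivAt (F j) (F (j + 1) r) r)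
    (hD : ∀ r ∈ Icc t (t + h), |F n r| ≤ √a * ((2 * n / δ) ^ n * M)) {k : ℕ} (hk : k < n) :
    |F k t| * h ^ k ≤ k ! * (Real.exp (4 * n) *
      (Real.exp (2 * n) * √(∫ r in t..t + δ, F 0 r ^ 2) + Real.exp (-17 * n) * M)) := by
  have hh0 : 0 < h := by rw [hh]; positivity
  have hnpos : 0 < n := by omega
  have h1 := abs_deriv_le_interpolation hnpos hh0 (F := F)
    (fun j r hr => hF j r ⟨hr.1, hr.2.trans (by linarith)⟩) hD hk
  refine h1.trans ?_
  rw [mul_assoc, mul_assoc]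
  refine mul_le_mul_of_nonneg_left ?_ (by positivity)
  rw [← mul_assoc, ← mul_pow]
  have e2 : √(2 * n / h * ∫ r in t..t + h, F 0 r ^ 2) ≤
      Real.exp (2 * n) * √(∫ r in t..t + δ, F 0 r ^ 2) := by
    have hint : ∫ r in t..t + h, F 0 r ^ 2 ≤ ∫ r in t..t + δ, F 0 r ^ 2 := by
      refine intervalIntegral.integral_mono_interval le_rfl (by linarith) (by linarith)
        (Filter.Eventually.of_forall fun y => sq_nonneg _) ?_
      refine ContinuousOn.intervalIntegrable ?_
      rw [uIcc_of_le (by linarith)]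
      exact fun r hr => ((hF 0 r hr).continuousAt.continuousWithinAt).pow 2
    have hinv : 2 * n / h ≤ Real.exp (2 * n) ^ 2 := by
      calc 2 * n / h = 2 * n * (1 / h) := by ring
        _ ≤ 2 * n * n := by gcongr
        _ ≤ (2 * n) ^ 2 := by nlinarith
        _ ≤ _ := two_mul_sq_le_exp n
    calc √(2 * n / h * ∫ r in t..t + h, F 0 r ^ 2)
        ≤ √(Real.exp (2 * n) ^ 2 * ∫ r in t..t + δ, F 0 r ^ 2) := by
          refine Real.sqrt_le_sqrt (mul_le_mul hinv hint ?_ (by positivity))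
          exact intervalIntegral.integral_nonneg (by linarith) fun _ _ => sq_nonneg _
      _ = _ := by rw [Real.sqrt_mul (by positivity), Real.sqrt_sq (by positivity)]
  -- The choice h = e^{-19}δ/2 makes (2nh/δ)ⁿ/n! = (e^{-19}n)ⁿ/n! ≤ e^{-18n}; one factor eⁿ is spent
  -- on √a.
  have e3 : √a * ((2 * n / δ) ^ n * M) * h ^ n / n ! ≤ Real.exp (-17 * n) * M := by
    have hfac := pow_self_le_exp_mul_factorial n
    have hQh : (2 * n / δ) ^ n * h ^ n / n ! ≤ Real.exp (-18 * n) := by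
      rw [div_le_iff₀ (by positivity), ← mul_pow, hh]
      rw [show 2 * (n : ℝ) / δ * (Real.exp (-19) / 2 * δ) = Real.exp (-19) * n by field_simp,
        mul_pow]
      calc Real.exp (-19) ^ n * (n : ℝ) ^ n ≤ Real.exp (-19) ^ n * (Real.exp n * n !) := by
            gcongr
        _ = _ := by rw [← exp_mul_nat, ← mul_assoc, ← Real.exp_add]; ring_nf
    calc √a * ((2 * n / δ) ^ n * M) * h ^ n / n ! =
          √a * ((2 * n / δ) ^ n * h ^ n / n !) * M := by ring
      _ ≤ Real.exp n * Real.exp (-18 * n) * M := by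
        gcongr
        exact sqrt_le_exp_of_le ha han
      _ = _ := by rw [← Real.exp_add]; ring_nf
  refine mul_le_mul (exp_one_mul_eight_pow_le n) (add_le_add e2 e3) (by positivity) (by positivity)

theorem abs_slope_le {a : ℝ} (ha : 1 ≤ a) (u : ℕ → StateSpace L) (j : ℕ) :
    |slope a u j| ≤ |(u (j + 1)).2.1| + a * |(u j).2.1| := by
  have ha0 : 0 < a := by linarith
  rw [slope, abs_div, abs_of_pos ha0, div_le_iff₀ ha0]
  have h1 := abs_sub (u (j + 1)).2.1 (a ^ 2 / 4 * (u j).2.1)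
  rw [abs_mul, abs_of_nonneg (by positivity : 0 ≤ a ^ 2 / 4)] at h1
  have h2 := abs_nonneg (u (j + 1)).2.1
  have h3 := mul_nonneg (sq_nonneg a) (abs_nonneg (u j).2.1)
  nlinarith

/-- Crude pointwise bound in terms of the energies. -/
theorem abs_cauchyExtension_le_of_energy (hL : 0 < L) {a Q : ℝ} (ha : 1 ≤ a) (hQ : 0 ≤ Q)
    {u : ℕ → StateSpace L} {m : ℕ} (h1 : √(energy a (u m)) ≤ Q)
    (h2 : √(energy a (u (m + 1))) ≤ Q) {x : ℝ} (hx : x ∈ Icc (-L) 0) :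
    |cauchyExtension a (u m, -u (m + 1)) x| ≤ a ^ 2 * (1 + 2 * L + L * √L) * Q := by
  have ha0 : 0 < a := by linarith
  have htr : ∀ j, √(energy a (u j)) ≤ Q → |(u j).2.1| ≤ a * Q := by
    intro j hj
    have h1 := Real.abs_le_sqrt (trace_sq_le_energy ha0 (u j))
    rw [Real.sqrt_mul ha0.le] at h1
    have hsa : √a ≤ a := by rw [Real.sqrt_le_left (by linarith)]; nlinarith
    exact h1.trans (mul_le_mul hsa hj (Real.sqrt_nonneg _) ha0.le)
  refine (abs_cauchyExtension_le hL a u m hx).trans ?_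
  have e3 := abs_slope_le ha u m
  have e4 : ‖(u (m + 1)).1‖ ≤ Q :=
    (Real.le_sqrt_of_sq_le (norm_sq_le_energy ha0 _)).trans h2
  have f1 := htr m h1
  have f2 := htr (m + 1) h2
  have f4 : a * Q ≤ a ^ 2 * Q := by gcongr; nlinarith
  have f5 : Q ≤ a ^ 2 * Q := by nlinarith
  have f3 : |slope a u m| ≤ 2 * a ^ 2 * Q := by
    have h1 : a * |(u m).2.1| ≤ a * (a * Q) := by gcongr
    nlinarith
  have g1 : |slope a u m| * L ≤ 2 * a ^ 2 * Q * L := by gcongr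
  have g2 : √L * L * ‖(u (m + 1)).1‖ ≤ √L * L * (a ^ 2 * Q) := by
    gcongr; exact e4.trans f5
  calc _ ≤ a ^ 2 * Q + 2 * a ^ 2 * Q * L + √L * L * (a ^ 2 * Q) := by linarith
    _ = _ := by ring

/-- Exponent budget: 2 + 1 + 4 + 2 = 9 for the observation, 2 + 1 + 4 - 17 = -10 for the later
energy. -/
theorem main_part_le {a h Λ σ M : ℝ} {n : ℕ} (hh : 0 < h) (hΛ : 1 ≤ Λ) (hσ : 0 ≤ σ) (hM : 0 ≤ M)
    (c1 : Λ ^ 2 / h ≤ n) (c2 : Λ * a ≤ n) :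
    (1 + Λ / h + Λ * a) * Real.exp (Λ ^ 2 / h) *
      (Real.exp (4 * n) * (Real.exp (2 * n) * σ + Real.exp (-17 * n) * M)) ≤
      Real.exp (9 * n) * σ + Real.exp (-10 * n) * M := by
  have r1 : Λ / h ≤ n := by
    refine le_trans ?_ c1
    gcongr
    nlinarith
  have r2 : 1 + Λ / h + Λ * a ≤ Real.exp (2 * n) := by
    linarith [Real.add_one_le_exp (2 * (n : ℝ))]
  have r3 : Real.exp (Λ ^ 2 / h) ≤ Real.exp n := Real.exp_le_exp.2 c1
  calc _ ≤ Real.exp (2 * n) * Real.exp n *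
        (Real.exp (4 * n) * (Real.exp (2 * n) * σ + Real.exp (-17 * n) * M)) := by
        gcongr
    _ = Real.exp (9 * n) * σ + Real.exp (-10 * n) * M := by
        have s1 : Real.exp (9 * n) =
            Real.exp (2 * n) * Real.exp n * Real.exp (4 * n) * Real.exp (2 * n) := by
          simp only [← Real.exp_add]; ring_nf
        have s2 : Real.exp (-10 * n) =
            Real.exp (2 * n) * Real.exp n * Real.exp (4 * n) * Real.exp (-17 * n) := by
          simp only [← Real.exp_add]; ring_nf
        rw [s1, s2]; ring

/-- Exponent budget: 2 for a², 1 for c, 4 for (2n)² and -18 for the remainder, in total -11. -/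
theorem tail_le {a c δ Λ M : ℝ} {n : ℕ} (hn : 0 < n) (hδ : 0 < δ) (hΛ : 1 ≤ Λ) (hM : 0 ≤ M)
    (ha : 0 ≤ a) (hc : 0 ≤ c) (han : a ≤ n) (hcn : c ≤ n)
    (c5 : 2 * Real.exp 1 * Λ ^ 2 / (δ * n) ≤ Real.exp (-18)) :
    a ^ 2 * c * ((2 * n / δ) ^ n * M) * (Λ ^ (2 * (n - 1)) / (2 * (n - 1))!) ≤
      Real.exp (-10 * n) * M := by
  have r0 := div_factorial_two_mul_le hn hδ hΛ
  have r1 : (2 * Real.exp 1 * Λ ^ 2 / (δ * n)) ^ n ≤ Real.exp (-18 * n) := by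
    rw [exp_mul_nat]; exact pow_le_pow_left₀ (by positivity) c5 n
  have r2 : (2 * (n : ℝ)) ^ 2 ≤ Real.exp (4 * n) := by
    refine (two_mul_sq_le_exp n).trans (le_of_eq ?_)
    rw [← Real.exp_nat_mul]; push_cast; ring_nf
  have r3 : a ^ 2 ≤ Real.exp (2 * n) := by
    have : Real.exp (2 * n) = Real.exp n ^ 2 := by
      rw [← Real.exp_nat_mul]; push_cast; ring_nf
    rw [this]
    gcongr
    exact han.trans (nat_le_exp n)
  have r4 : c ≤ Real.exp n := hcn.trans (nat_le_exp n)
  calc _ = a ^ 2 * c * ((2 * n / δ) ^ n * (Λ ^ (2 * (n - 1)) / (2 * (n - 1))!)) * M := by ring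
    _ ≤ Real.exp (2 * n) * Real.exp n * (Real.exp (4 * n) * Real.exp (-18 * n)) * M := by
        refine mul_le_mul_of_nonneg_right (mul_le_mul (mul_le_mul r3 r4 hc (by positivity))
          (r0.trans (mul_le_mul r2 r1 (by positivity) (by positivity)))
          (by positivity) (by positivity)) hM
    _ = Real.exp (-11 * n) * M := by
        simp only [← Real.exp_add]; ring_nf
    _ ≤ Real.exp (-10 * n) * M := by
        gcongr
        norm_num

/-- A pointwise bound of a smooth solution by its trace at `x = 0` at later times, up to a small
multiple of its later energy. -/
theorem abs_cauchyExtension_le_trace (hL : 0 < L) {a δ t : ℝ} {n : ℕ} (ha : 1 ≤ a) (hδ : 0 < δ)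
    (hδ1 : δ ≤ 1) (hn : interpConst L * (1 / δ + a) ≤ n) {U : ℕ → ℝ → StateSpace L}
    (hU : IsSmoothSolution a L t (t + δ) U) :
    ∀ x ∈ Icc (-L) 0, |cauchyExtension a (U 0 t, -U 1 t) x| ≤
      Real.exp (9 * n) * √(∫ r in t..t + δ, (U 0 r).2.1 ^ 2) +
        2 * Real.exp (-10 * n) * √(energy a (U 0 (t + δ))) := by
  have ha0 : 0 < a := by linarith
  obtain ⟨c1, c2, c3, c4, c5, -⟩ := interpConst_bounds hL ha hδ hδ1 hn
  have hΛ1 : 1 ≤ 1 + L := by linarith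
  obtain ⟨h, hh⟩ : ∃ h, h = Real.exp (-19) / 2 * δ := ⟨_, rfl⟩
  rw [← hh] at c1
  have hh0 : 0 < h := by rw [hh]; positivity
  have hhδ : h ≤ δ / 2 := by
    have : Real.exp (-19) ≤ 1 := by rw [Real.exp_le_one_iff]; norm_num
    rw [hh]; nlinarith
  have hn1 : (1 : ℝ) ≤ n := ha.trans c4
  have hnpos : 0 < n := by exact_mod_cast (lt_of_lt_of_le one_pos hn1)
  obtain ⟨M, hM⟩ : ∃ M, M = √(energy a (U 0 (t + δ))) := ⟨_, rfl⟩
  obtain ⟨σ, hσ⟩ : ∃ σ, σ = √(∫ r in t..t + δ, (U 0 r).2.1 ^ 2) := ⟨_, rfl⟩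
  have hM0 : 0 ≤ M := hM ▸ Real.sqrt_nonneg _
  have hσ0 : 0 ≤ σ := hσ ▸ Real.sqrt_nonneg _
  -- As h ≤ δ/2, every r leaves a length δ/2 for smoothing before t + δ.
  have hE : ∀ j ≤ n, ∀ r ∈ Icc t (t + h), √(energy a (U j r)) ≤ (2 * n / δ) ^ n * M := by
    intro j hj r hr
    have h1 := hU.sqrt_energy_le hL ha0 hj (t := r) (δ := δ / 2) (by positivity) (by linarith)
      hr.1 (by linarith [hr.2])
    have h2 := hU.energy_mono hL ha0 0 (x := r + δ / 2) (y := t + δ) (by linarith [hr.1])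
      (by linarith [hr.2]) le_rfl
    refine h1.trans ?_
    rw [show (n : ℝ) / (δ / 2) = 2 * n / δ by field_simp, hM]
    exact mul_le_mul_of_nonneg_left (Real.sqrt_le_sqrt h2) (by positivity)
  have htr : ∀ r ∈ Icc t (t + h), |(U n r).2.1| ≤ √a * ((2 * n / δ) ^ n * M) := by
    intro r hr
    have h1 := Real.abs_le_sqrt (trace_sq_le_energy ha0 (U n r))
    rw [Real.sqrt_mul ha0.le] at h1
    exact h1.trans (mul_le_mul_of_nonneg_left (hE n le_rfl r hr) (Real.sqrt_nonneg _))
  have htmem : t ∈ Icc t (t + h) := ⟨le_rfl, by linarith⟩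
  have hF : ∀ j, ∀ r ∈ Icc t (t + δ), HasDerivAt (fun r => (U j r).2.1) (U (j + 1) r).2.1 r := by
    intro j r hr
    exact ((ContinuousLinearMap.fst ℝ ℝ ℝ).comp (ContinuousLinearMap.snd ℝ
        (Lp ℝ 2 (volume.restrict (Ioo (-L) 0))) (ℝ × ℝ))).hasFDerivAt.comp_hasDerivAt r
        (hU.hasDerivAt j r hr)
  have hhn : 1 / h ≤ n := by
    refine le_trans ?_ c1
    gcongr
    nlinarith
  have hfk : ∀ k < n, |(U k t).2.1| * h ^ k ≤ k ! * (Real.exp (4 * n) *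
      (Real.exp (2 * n) * σ + Real.exp (-17 * n) * M)) := fun k hk =>
    hσ ▸ abs_deriv_le_of_analytic (F := fun j r => (U j r).2.1) ha c4 hδ hM0 hh (by linarith) hhn
      hF htr hk
  have hmain := main_part_le hh0 hΛ1 hσ0 hM0 c1 c2
  have hc0 : 0 ≤ 1 + 2 * L + L * √L := by positivity
  have htail := tail_le hnpos hδ hΛ1 hM0 ha0.le hc0 c4 c3 c5
  intro x hx
  have hmn : n - 1 + 1 = n := Nat.sub_add_cancel hnpos
  have hS0 : 0 ≤ a ^ 2 * (1 + 2 * L + L * √L) * ((2 * n / δ) ^ n * M) := by positivity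
  -- Only n - 1 steps: the slopes and the remainder involve one more time derivative, and
  -- interpolation reaches only orders below n.
  have hmaj := abs_cauchyExtension_le_majorant hL ha0 (u := fun j => U j t)
    (fun j => hU.generator j t ⟨le_rfl, by linarith⟩) hS0 (n - 1) 0
    (fun x hx => by
      rw [zero_add]
      exact abs_cauchyExtension_le_of_energy (u := fun j => U j t)
        (Q := (2 * n / δ) ^ n * M) hL ha (by positivity)
        (hE (n - 1) (by omega) t htmem) (by rw [hmn]; exact hE n le_rfl t htmem) hx) x hx
  simp only [zero_add] at hmaj
  have hfin := majorant_le (F := fun i => |(U i t).2.1|)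
    (G := fun i => |slope a (fun j => U j t) i|) (Λ := 1 + L) (h := h) (a := a) (y := -x)
    (m := n - 1) (by positivity) hh0 hS0 hΛ1 ha0.le ⟨by linarith [hx.2], by linarith [hx.1]⟩
    (fun i hi => hfk i (by omega)) (fun i _ => abs_slope_le ha _ i)
  rw [← hσ, ← hM]
  linarith [hmaj.trans hfin]

/-- Squaring the pointwise bound gives exponents 18 and -20, and eⁿ absorbs the constants. The
resulting opposite exponents 19 and -19 are what lets the iteration telescope. -/
theorem energy_le_interpolation (hL : 0 < L) {a δ t : ℝ} {n : ℕ} (ha : 1 ≤ a) (hδ : 0 < δ)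
    (hδ1 : δ ≤ 1) (hn : interpConst L * (1 / δ + a) ≤ n) {U : ℕ → ℝ → StateSpace L}
    (hU : IsSmoothSolution a L t (t + δ) U) :
    energy a (U 0 t) ≤ Real.exp (19 * n) * (∫ r in t..t + δ, (U 0 r).2.1 ^ 2) +
      Real.exp (-19 * n) * energy a (U 0 (t + δ)) := by
  have ha0 : 0 < a := by linarith
  have h1 := abs_cauchyExtension_le_trace hL ha hδ hδ1 hn hU
  have h2 := energy_le_of_cauchyExtension hL ha0 (hU.generator 0 t ⟨le_rfl, by linarith⟩) h1
  have hI : 0 ≤ ∫ r in t..t + δ, (U 0 r).2.1 ^ 2 :=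
    intervalIntegral.integral_nonneg (by linarith) fun _ _ => sq_nonneg _
  have hE := energy_nonneg ha0 (U 0 (t + δ))
  set I := ∫ r in t..t + δ, (U 0 r).2.1 ^ 2
  set E := energy a (U 0 (t + δ))
  have h3 : (Real.exp (9 * n) * √I + 2 * Real.exp (-10 * n) * √E) ^ 2 ≤
      8 * (Real.exp (18 * n) * I + Real.exp (-20 * n) * E) := by
    have e1 : (Real.exp (9 * n) * √I) ^ 2 = Real.exp (18 * n) * I := by
      rw [mul_pow, Real.sq_sqrt hI, ← Real.exp_nat_mul]; push_cast; ring_nf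
    have e2 : (Real.exp (-10 * n) * √E) ^ 2 = Real.exp (-20 * n) * E := by
      rw [mul_pow, Real.sq_sqrt hE, ← Real.exp_nat_mul]; push_cast; ring_nf
    rw [← e1, ← e2]
    nlinarith [sq_nonneg (Real.exp (9 * n) * √I - 2 * (Real.exp (-10 * n) * √E)),
      sq_nonneg (Real.exp (9 * n) * √I)]
  have h4 : (L + 2 / a) * 8 ≤ Real.exp n := by
    refine le_trans ?_ (nat_le_exp n)
    refine le_trans ?_ (interpConst_bounds hL ha hδ hδ1 hn).2.2.2.2.2
    have : 2 / a ≤ 2 := by rw [div_le_iff₀ ha0]; linarith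
    linarith
  calc energy a (U 0 t) ≤ (L + 2 / a) * (8 * (Real.exp (18 * n) * I + Real.exp (-20 * n) * E)) :=
        h2.trans (by gcongr)
    _ = ((L + 2 / a) * 8) * (Real.exp (18 * n) * I + Real.exp (-20 * n) * E) := by ring
    _ ≤ Real.exp n * (Real.exp (18 * n) * I + Real.exp (-20 * n) * E) := by gcongr
    _ = _ := by
      rw [mul_add, ← mul_assoc, ← mul_assoc, ← Real.exp_add, ← Real.exp_add]; ring_nf

/-- Observability of smooth solutions from the trace at `x = 0`. -/
theorem energy_le_observation (hL : 0 < L) {a δ t : ℝ} {n : ℕ} (ha : 1 ≤ a) (hδ : 0 < δ)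
    (hδ1 : δ ≤ 1) (hn : interpConst L * (2 / δ + a) ≤ n) {U : ℕ → ℝ → StateSpace L}
    (hU : IsSmoothSolution a L t (t + δ) U) :
    energy a (U 0 t) ≤ Real.exp (19 * n) * ∫ r in t..t + δ, (U 0 r).2.1 ^ 2 := by
  have ha0 : 0 < a := by linarith
  -- The k-th window has length δ/2^(k+1) and uses the parameter n2^k. Multiplying by e^{-19n2^k}
  -- makes the coefficient of the observation 1 and that of the energy e^{-19n2^(k+1)}, ready for
  -- the next window.
  set τ : ℕ → ℝ := fun k => t + δ * (1 - (1 / 2) ^ k) with hτ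
  have hpow : ∀ k : ℕ, (0 : ℝ) < (1 / 2) ^ k ∧ ((1 / 2 : ℝ)) ^ k ≤ 1 := fun k =>
    ⟨by positivity, pow_le_one₀ (by norm_num) (by norm_num)⟩
  have hτmem : ∀ k, t ≤ τ k ∧ τ k ≤ t + δ := fun k =>
    ⟨by have := hpow k; simp only [hτ]; nlinarith, by have := hpow k; simp only [hτ]; nlinarith⟩
  have hcont : ContinuousOn (fun r => (U 0 r).2.1 ^ 2) (Icc t (t + δ)) := fun r hr =>
    ((hU.hasDerivAt 0 r hr).continuousAt.snd.fst.pow 2).continuousWithinAt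
  have hint : ∀ {x y : ℝ}, t ≤ x → x ≤ y → y ≤ t + δ →
      IntervalIntegrable (fun r => (U 0 r).2.1 ^ 2) volume x y := fun {x y} h1 h2 h3 =>
    (hcont.mono (by rw [uIcc_of_le h2]; exact Icc_subset_Icc h1 h3)).intervalIntegrable
  have hstep : ∀ k : ℕ, Real.exp (-19 * n) * energy a (U 0 t) ≤
      (∫ r in t..τ k, (U 0 r).2.1 ^ 2) +
        Real.exp (-19 * (n * 2 ^ k)) * energy a (U 0 (τ k)) := by
    intro k
    induction k with
    | zero => simp [hτ]
    | succ k ih =>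
      have hδk : 0 < δ * (1 / 2) ^ (k + 1) := by positivity
      have hτs : τ k + δ * (1 / 2) ^ (k + 1) = τ (k + 1) := by
        simp only [hτ, pow_succ]; ring
      have hnk : interpConst L * (1 / (δ * (1 / 2) ^ (k + 1)) + a) ≤ ((n * 2 ^ k : ℕ) : ℝ) := by
        push_cast
        have h2k : (1 : ℝ) ≤ 2 ^ k := one_le_pow₀ (by norm_num)
        have e : 1 / (δ * (1 / 2) ^ (k + 1)) = 2 / δ * 2 ^ k := by
          rw [one_div_pow, pow_succ]; field_simp
        rw [e]
        calc interpConst L * (2 / δ * 2 ^ k + a) ≤ interpConst L * (2 / δ * 2 ^ k + a * 2 ^ k) := by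
              gcongr
              · exact (interpConst_pos hL).le
              · nlinarith
          _ = interpConst L * (2 / δ + a) * 2 ^ k := by ring
          _ ≤ _ := by gcongr
      have h1 := energy_le_interpolation hL ha hδk
        (by have := hpow (k + 1); nlinarith) hnk
        (hU.mono (hτmem k).1 (by rw [hτs]; exact (hτmem (k + 1)).2))
      rw [hτs] at h1
      push_cast at h1
      refine ih.trans ?_
      rw [← intervalIntegral.integral_add_adjacent_intervals
        (hint le_rfl (hτmem k).1 (hτmem k).2)
        (hint (hτmem k).1 (by rw [← hτs]; linarith) (hτmem (k + 1)).2), add_assoc]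
      refine add_le_add le_rfl ?_
      have h2 : Real.exp (-19 * (n * 2 ^ k)) * energy a (U 0 (τ k)) ≤
          Real.exp (-19 * (n * 2 ^ k)) *
          (Real.exp (19 * (n * 2 ^ k)) * (∫ r in τ k..τ (k + 1), (U 0 r).2.1 ^ 2) +
            Real.exp (-19 * (n * 2 ^ k)) * energy a (U 0 (τ (k + 1)))) := by gcongr
      refine h2.trans (le_of_eq ?_)
      have s1 : Real.exp (-19 * (n * 2 ^ k)) * Real.exp (19 * (n * 2 ^ k)) = 1 := by
        rw [← Real.exp_add]; ring_nf; simp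
      have s2 : Real.exp (-19 * (n * 2 ^ (k + 1))) =
          Real.exp (-19 * (n * 2 ^ k)) * Real.exp (-19 * (n * 2 ^ k)) := by
        rw [← Real.exp_add, pow_succ]; ring_nf
      rw [s2, mul_add, ← mul_assoc, s1]
      ring
  have hnpos : (0 : ℝ) < n := by
    refine lt_of_lt_of_le ?_ hn
    have := interpConst_pos hL
    positivity
  -- The energies at `τ k` never exceed the one at t + δ, so the remainder vanishes in the limit.
  have hlim : Filter.Tendsto (fun k : ℕ => (∫ r in t..t + δ, (U 0 r).2.1 ^ 2) +
      Real.exp (-19 * (n * 2 ^ k)) * energy a (U 0 (t + δ))) Filter.atTop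
      (nhds ((∫ r in t..t + δ, (U 0 r).2.1 ^ 2) + 0 * energy a (U 0 (t + δ)))) := by
    refine tendsto_const_nhds.add (Filter.Tendsto.mul_const _ ?_)
    refine Real.tendsto_exp_atBot.comp ?_
    have h1 : Filter.Tendsto (fun k : ℕ => (n : ℝ) * 2 ^ k) Filter.atTop Filter.atTop :=
      (tendsto_pow_atTop_atTop_of_one_lt (by norm_num)).const_mul_atTop hnpos
    exact h1.const_mul_atTop_of_neg (by norm_num)
  have hfinal : Real.exp (-19 * n) * energy a (U 0 t) ≤
      (∫ r in t..t + δ, (U 0 r).2.1 ^ 2) + 0 * energy a (U 0 (t + δ)) := by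
    refine ge_of_tendsto hlim (Filter.Eventually.of_forall fun k => (hstep k).trans ?_)
    refine add_le_add ?_ ?_
    · exact intervalIntegral.integral_mono_interval le_rfl (hτmem k).1 (hτmem k).2
        (Filter.Eventually.of_forall fun y => sq_nonneg _) (hint le_rfl (by linarith) le_rfl)
    · gcongr
      exact hU.energy_mono hL ha0 0 (hτmem k).1 (hτmem k).2 le_rfl
  rw [zero_mul, add_zero] at hfinal
  calc energy a (U 0 t) = Real.exp (19 * n) * (Real.exp (-19 * n) * energy a (U 0 t)) := by
        rw [← mul_assoc, ← Real.exp_add]; ring_nf; simp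
    _ ≤ _ := by gcongr

end AdvDiff
end

/-! ### Symmetrisation and mollification in time. -/

open MeasureTheory Set
noncomputable section
namespace AdvDiff

open scoped Convolution

variable {L : ℝ}

/-- The integrand vanishes in the quotient by S, which is a normed space because S is closed. -/
theorem integral_mem_of_isClosed {E : Type*} [NormedAddCommGroup E] [NormedSpace ℝ E]
    [CompleteSpace E] (S : Submodule ℝ E) (hS : IsClosed (S : Set E)) {x y : ℝ} {g : ℝ → E}
    (hxy : x ≤ y) (hg : IntervalIntegrable g volume x y) (hgS : ∀ r ∈ Icc x y, g r ∈ S) :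
    ∫ r in x..y, g r ∈ S := by
  have : IsClosed (S : Set E) := hS
  rw [← Submodule.Quotient.mk_eq_zero]
  have h1 := S.mkQL.intervalIntegral_comp_comm hg
  have h2 : ∫ r in x..y, S.mkQL (g r) = ∫ r in x..y, (0 : E ⧸ S) := by
    refine intervalIntegral.integral_congr fun r hr => ?_
    rw [uIcc_of_le hxy] at hr
    simpa using hgS r hr
  rw [h2, intervalIntegral.integral_zero] at h1
  simpa using h1.symm

theorem memLp_exp (a L : ℝ) :
    MemLp (fun x : ℝ => Real.exp (a / 2 * x)) ⊤ (volume.restrict (Ioo (-L) 0)) := by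
  have hc : Continuous fun x : ℝ => Real.exp (a / 2 * x) := by fun_prop
  obtain ⟨C, hC⟩ := isCompact_Icc.exists_bound_of_continuousOn (s := Icc (-L) 0) hc.continuousOn
  exact memLp_top_of_bound hc.aestronglyMeasurable C
    ((ae_restrict_iff' measurableSet_Ioo).2
      (Filter.Eventually.of_forall fun x hx => hC x (Ioo_subset_Icc_self hx)))

/-- Multiplication by `e^{ax/2}` on the state space. -/
def expTwist (a L : ℝ) : StateSpace L →L[ℝ] StateSpace L :=
  ((ContinuousLinearMap.mul ℝ ℝ).holderL (volume.restrict (Ioo (-L) 0)) ⊤ 2 2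
    (memLp_exp a L).toLp).prodMap
    ((ContinuousLinearMap.id ℝ ℝ).prodMap
      (Real.exp (a / 2 * (-L)) • ContinuousLinearMap.id ℝ ℝ))

theorem coeFn_expTwist (a : ℝ) (u : StateSpace L) :
    ∀ᵐ x ∂(volume.restrict (Ioo (-L) 0)), (expTwist a L u).1 x = Real.exp (a / 2 * x) * u.1 x := by
  have h1 := (ContinuousLinearMap.mul ℝ ℝ).coeFn_holder (r := 2) (memLp_exp a L).toLp u.1
  filter_upwards [h1, (memLp_exp a L).coeFn_toLp] with x hx1 hx2
  have : (expTwist a L u).1 = (ContinuousLinearMap.mul ℝ ℝ).holder 2 (memLp_exp a L).toLp u.1 := rfl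
  rw [this, hx1, hx2]
  rfl

theorem expTwist_right (a : ℝ) (u : StateSpace L) : (expTwist a L u).2.1 = u.2.1 := rfl

theorem expTwist_left (a : ℝ) (u : StateSpace L) :
    (expTwist a L u).2.2 = Real.exp (a / 2 * (-L)) * u.2.2 := rfl

/-- Conjugation by e^{ax/2} turns ∂_xx + a∂_x into ∂_xx - a²/4. The coefficient a² at x = 0 is
exactly what leaves the same zeroth-order term a²/4 at both ends. -/
theorem IsGenerator.isSymGenerator (hL : 0 < L) {a : ℝ} {u f : StateSpace L}
    (h : IsGenerator a 1 (a ^ 2) L u f) :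
    IsSymGenerator a L (expTwist a L u) (expTwist a L f + (a ^ 2 / 4) • expTwist a L u) := by
  obtain ⟨v, w, z, h1, h2, h3, h4, h5, h6⟩ := h
  have he : IsH1 L (fun x : ℝ => Real.exp (a / 2 * x))
      (fun x => Real.exp (a / 2 * x) * (a / 2)) := by
    refine IsH1.of_hasDerivAt (fun x => ?_) (by fun_prop)
    have := ((hasDerivAt_id x).const_mul (a / 2)).exp
    simpa using this
  have hv := he.mul hL h1
  have hw := he.mul hL (h2.add (h1.const_mul (a / 2)))
  refine ⟨_, _, fun x => Real.exp (a / 2 * x) * (z x + a * w x + a ^ 2 / 4 * v x), hv, ?_,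
    ⟨?_, ?_, ?_⟩, ?_, ?_, ?_⟩
  · have e1 : (fun x => Real.exp (a / 2 * x) * (a / 2) * v x + Real.exp (a / 2 * x) * w x) =
        fun x => Real.exp (a / 2 * x) * (w x + a / 2 * v x) := by funext x; ring
    have e2 : (fun x => Real.exp (a / 2 * x) * (z x + a * w x + a ^ 2 / 4 * v x)) =
        fun x => Real.exp (a / 2 * x) * (a / 2) * (w x + a / 2 * v x) +
          Real.exp (a / 2 * x) * (z x + a / 2 * w x) := by funext x; ring
    rw [e1, e2]
    exact hw
  · filter_upwards [coeFn_expTwist a u, h3.1] with x e1 e2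
    rw [e1, e2]
  · rw [expTwist_right, h3.2.1]; simp
  · rw [expTwist_left, h3.2.2]
  · filter_upwards [coeFn_expTwist a u, coeFn_expTwist a f, h3.1, h4,
      Lp.coeFn_add (expTwist a L f).1 ((a ^ 2 / 4) • expTwist a L u).1,
      Lp.coeFn_smul (a ^ 2 / 4) (expTwist a L u).1] with x e1 e2 e3 e4 e5 e6
    rw [Prod.fst_add, e5, Pi.add_apply, Prod.smul_fst, e6, Pi.smul_apply, e1, e2, e3, e4,
      smul_eq_mul]
    ring
  · simp only [Prod.snd_add, Prod.fst_add, Prod.smul_snd, Prod.smul_fst, expTwist_right, h5,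
      h3.2.1, smul_eq_mul, mul_zero, Real.exp_zero]
    ring
  · simp only [Prod.snd_add, Prod.smul_snd, expTwist_left, h6, h3.2.2, smul_eq_mul]
    ring

/-- Averages of a mild solution against kernels are in the domain of the generator. -/
theorem kernel_mem_symGraph (hL : 0 < L) {a T : ℝ} (ha : 0 < a) (hT : 0 < T)
    {φT : StateSpace L} {φ ψ : ℝ → StateSpace L} (hφ : IsMildSolution a 1 (a ^ 2) L T φT φ)
    (hψ : Continuous ψ) (hψφ : ∀ t ∈ Icc 0 T, ψ t = φ t) {k k' : ℝ → ℝ}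
    (hk : ∀ r, HasDerivAt k (k' r) r) (hk' : Continuous k') (hk0 : k 0 = 0) (hkT : k T = 0) :
    IsSymGenerator a L (expTwist a L (∫ r in (0 : ℝ)..T, k r • ψ r))
      (expTwist a L (∫ r in (0 : ℝ)..T, k' r • ψ r) +
        (a ^ 2 / 4) • expTwist a L (∫ r in (0 : ℝ)..T, k r • ψ r)) := by
  set Φ : ℝ → StateSpace L := fun t => ∫ r in t..T, ψ r with hΦ
  have hint : ∀ x y : ℝ, IntervalIntegrable ψ volume x y := fun x y => hψ.intervalIntegrable x y
  have hΦd : ∀ t, HasDerivAt Φ (-ψ t) t := fun t =>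
    intervalIntegral.integral_hasDerivAt_left (hint t T)
      (hψ.stronglyMeasurableAtFilter _ _) hψ.continuousAt
  have hΦc : Continuous Φ := continuous_iff_continuousAt.2 fun t => (hΦd t).continuousAt
  have hΦT : Φ T = 0 := by simp [hΦ]
  have hkc : Continuous k := continuous_iff_continuousAt.2 fun t => (hk t).continuousAt
  have hgen : ∀ t ∈ Icc 0 T, IsGenerator a 1 (a ^ 2) L (Φ t) (ψ t - φT) := by
    intro t ht
    have h1 := hφ.equation t ht
    rw [hψφ t ht]
    convert h1 using 1
    refine intervalIntegral.integral_congr fun r hr => hψφ r ?_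
    rw [uIcc_of_le ht.2] at hr
    exact ⟨ht.1.trans hr.1, hr.2⟩
  -- Mildness only places the integrals Φ in the domain, so the average is rewritten through them;
  -- the kernel vanishes at both ends.
  have hparts : ∫ r in (0 : ℝ)..T, k r • ψ r = ∫ r in (0 : ℝ)..T, k' r • Φ r := by
    have h1 := intervalIntegral.integral_smul_deriv_eq_deriv_smul (a := 0) (b := T)
      (u := k) (v := Φ) (u' := k') (v' := fun r => -ψ r) (fun r _ => hk r) (fun r _ => hΦd r)
      (hk'.intervalIntegrable _ _) (hψ.neg.intervalIntegrable _ _)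
    simp only [smul_neg, intervalIntegral.integral_neg, hkT, hk0, zero_smul, sub_zero,
      zero_sub, neg_inj] at h1
    exact h1
  have hk'int : ∫ r in (0 : ℝ)..T, k' r = 0 := by
    rw [intervalIntegral.integral_eq_sub_of_hasDerivAt (fun r _ => hk r)
      (hk'.intervalIntegrable _ _), hk0, hkT, sub_zero]
  -- The final datum disappears since k' has mean zero.
  have hconst : ∫ r in (0 : ℝ)..T, k' r • (ψ r - φT) = ∫ r in (0 : ℝ)..T, k' r • ψ r := by
    simp only [smul_sub]
    have c1 : Continuous fun r => k' r • ψ r := hk'.smul hψ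
    have c2 : Continuous fun r => k' r • φT := hk'.smul continuous_const
    rw [intervalIntegral.integral_sub (c1.intervalIntegrable _ _)
      (c2.intervalIntegrable _ _), intervalIntegral.integral_smul_const,
      hk'int, zero_smul, sub_zero]
  set A : StateSpace L →L[ℝ] StateSpace L := expTwist a L with hA
  set g : ℝ → StateSpace L × StateSpace L := fun r =>
    (A (k' r • Φ r), A (k' r • (ψ r - φT)) + (a ^ 2 / 4) • A (k' r • Φ r)) with hg
  have d1 : Continuous fun r => k' r • Φ r := hk'.smul hΦc
  have d2 : Continuous fun r => k' r • (ψ r - φT) := hk'.smul (hψ.sub continuous_const)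
  have c1 : Continuous fun r => A (k' r • Φ r) := A.continuous.comp d1
  have c2 : Continuous fun r => A (k' r • (ψ r - φT)) := A.continuous.comp d2
  have c3 : Continuous fun r => (a ^ 2 / 4) • A (k' r • Φ r) := c1.const_smul (a ^ 2 / 4)
  have hgc : Continuous g := c1.prodMk (c2.add c3)
  have hmem := integral_mem_of_isClosed (symGraph a L) (isClosed_symGraph hL ha) hT.le
    (hgc.intervalIntegrable 0 T) (fun r hr => by
      have h1 := ((hgen r hr).isSymGenerator hL).smul (k' r)
      change IsSymGenerator a L (A (k' r • Φ r))
        (A (k' r • (ψ r - φT)) + (a ^ 2 / 4) • A (k' r • Φ r))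
      rw [map_smul, map_smul]
      convert h1 using 1
      rw [smul_add, smul_comm])
  have e1 : (∫ r in (0 : ℝ)..T, g r).1 = A (∫ r in (0 : ℝ)..T, k' r • Φ r) := by
    rw [← A.intervalIntegral_comp_comm (d1.intervalIntegrable _ _)]
    exact ((ContinuousLinearMap.fst ℝ (StateSpace L) (StateSpace L)).intervalIntegral_comp_comm
      (hgc.intervalIntegrable 0 T)).symm
  have e2 : (∫ r in (0 : ℝ)..T, g r).2 = A (∫ r in (0 : ℝ)..T, k' r • (ψ r - φT)) +
      (a ^ 2 / 4) • A (∫ r in (0 : ℝ)..T, k' r • Φ r) := by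
    rw [← A.intervalIntegral_comp_comm (d1.intervalIntegrable _ _),
      ← A.intervalIntegral_comp_comm (d2.intervalIntegrable _ _),
      ← intervalIntegral.integral_smul, ← intervalIntegral.integral_add
        (c2.intervalIntegrable _ _) (c3.intervalIntegrable _ _)]
    exact ((ContinuousLinearMap.snd ℝ (StateSpace L) (StateSpace L)).intervalIntegral_comp_comm
      (hgc.intervalIntegrable 0 T)).symm
  have hmem' : IsSymGenerator a L (∫ r in (0 : ℝ)..T, g r).1 (∫ r in (0 : ℝ)..T, g r).2 := hmem
  rwa [e1, e2, hconst, ← hparts] at hmem'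

/-- The transformed solution, extended to `ℝ`. -/
def twisted (a : ℝ) {T : ℝ} (hT : 0 ≤ T) (φ : ℝ → StateSpace L) : ℝ → StateSpace L :=
  IccExtend hT fun t => Real.exp (-(a ^ 2 / 4 * t)) • expTwist a L (φ t)

theorem twisted_of_mem (a : ℝ) {T : ℝ} (hT : 0 ≤ T) (φ : ℝ → StateSpace L) {t : ℝ}
    (ht : t ∈ Icc 0 T) :
    twisted a hT φ t = Real.exp (-(a ^ 2 / 4 * t)) • expTwist a L (φ t) := by
  rw [twisted, IccExtend_of_mem hT _ ht]

theorem uniformContinuous_twisted (a : ℝ) {T : ℝ} (hT : 0 ≤ T) {φ : ℝ → StateSpace L}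
    (hφ : ContinuousOn φ (Icc 0 T)) : UniformContinuous (twisted a hT φ) := by
  have hc : Continuous fun t : Icc 0 T =>
      Real.exp (-(a ^ 2 / 4 * t)) • expTwist a L (φ t) := by
    have h1 : Continuous fun t : Icc 0 T => Real.exp (-(a ^ 2 / 4 * t)) := by fun_prop
    exact h1.smul ((expTwist a L).continuous.comp
      (continuousOn_iff_continuous_domRestrict.1 hφ))
  refine (CompactSpace.uniformContinuous_of_continuous hc).comp ?_
  have hl : LipschitzWith 1 (projIcc 0 T hT) := LipschitzWith.projIcc hT
  exact hl.uniformContinuous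

/-- For t at distance at least η from the ends the kernel vanishes outside (0, T), so the artificial
extension of the solution is not seen. -/
theorem convolution_eq_expTwist {a T : ℝ} (hT : 0 < T)
    {φ ψ : ℝ → StateSpace L} (hψ : Continuous ψ) (hψφ : ∀ t ∈ Icc 0 T, ψ t = φ t)
    {ρ : ℝ → ℝ} (hρ : Continuous ρ) {η t : ℝ} (hη : ∀ y, η ≤ |y| → ρ y = 0)
    (ht : t ∈ Icc η (T - η)) :
    (ρ ⋆[ContinuousLinearMap.lsmul ℝ ℝ, volume] (twisted a hT.le φ)) t =
      expTwist a L (∫ r in (0 : ℝ)..T, (ρ (t - r) * Real.exp (-(a ^ 2 / 4 * r))) • ψ r) := by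
  have hvan : ∀ r, r ∉ Ioo 0 T → ρ (t - r) = 0 := by
    intro r hr
    refine hη _ ?_
    rw [mem_Ioo, not_and_or, not_lt, not_lt] at hr
    rcases hr with hr | hr
    · exact le_trans (by linarith [ht.1]) (le_abs_self _)
    · exact le_trans (by linarith [ht.2]) (neg_le_abs _)
  rw [convolution_eq_swap, ← ContinuousLinearMap.intervalIntegral_comp_comm,
    intervalIntegral.integral_of_le hT.le, ← integral_indicator measurableSet_Ioc]
  · refine integral_congr_ae (Filter.Eventually.of_forall fun r => ?_)
    simp only [ContinuousLinearMap.lsmul_apply]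
    by_cases hr : r ∈ Ioo 0 T
    · rw [indicator_of_mem (Ioo_subset_Ioc_self hr), twisted_of_mem a hT.le φ
        (Ioo_subset_Icc_self hr), hψφ r (Ioo_subset_Icc_self hr), map_smul, smul_smul]
    · rw [hvan r hr, zero_smul]
      by_cases hr' : r ∈ Ioc 0 T
      · rw [indicator_of_mem hr', hvan r hr]; simp
      · rw [indicator_of_notMem hr']
  · refine Continuous.intervalIntegrable ?_ _ _
    fun_prop

theorem iteratedDeriv_eq_zero_of_le {ρ : ℝ → ℝ} {η : ℝ}
    (hη : tsupport ρ ⊆ Metric.closedBall 0 η) (j : ℕ) :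
    tsupport (iteratedDeriv j ρ) ⊆ Metric.closedBall 0 η := by
  induction j with
  | zero => simpa using hη
  | succ j ih =>
    rw [iteratedDeriv_succ]
    exact (tsupport_deriv_subset).trans ih

/-- Time derivatives fall on ρ. Differentiating the factor e^{-a²r/4} of the kernel produces the
term that cancels the shift a²/4 of the symmetrised generator. -/
theorem isSmoothSolution_convolution (hL : 0 < L) {a T : ℝ} (ha : 0 < a) (hT : 0 < T)
    {φT : StateSpace L} {φ : ℝ → StateSpace L} (hφ : IsMildSolution a 1 (a ^ 2) L T φT φ)
    {ρ : ℝ → ℝ} (hρ : ContDiff ℝ (⊤ : ℕ∞) ρ) {η η' : ℝ}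
    (hη : tsupport ρ ⊆ Metric.closedBall 0 η) (hηη' : η < η') :
    IsSmoothSolution a L η' (T - η')
      (fun j => iteratedDeriv j ρ ⋆[ContinuousLinearMap.lsmul ℝ ℝ, volume]
        (twisted a hT.le φ)) := by
  set ψ : ℝ → StateSpace L := IccExtend hT.le fun t : Icc 0 T => φ t with hψ
  have hψc : Continuous ψ := by
    refine Continuous.Icc_extend' ?_
    exact continuousOn_iff_continuous_domRestrict.1 hφ.continuousOn
  have hψφ : ∀ t ∈ Icc 0 T, ψ t = φ t := fun t ht => IccExtend_of_mem hT.le _ ht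
  have hθ := (uniformContinuous_twisted a hT.le hφ.continuousOn).continuous
  have hρj : ∀ j, ContDiff ℝ 1 (iteratedDeriv j ρ) := fun j =>
    by
      rw [iteratedDeriv_eq_iterate]
      exact (hρ.iterate_deriv j).of_le (by exact_mod_cast le_top)
  have hsupp : ∀ j y, η' ≤ |y| → iteratedDeriv j ρ y = 0 := by
    intro j y hy
    by_contra hne
    have := iteratedDeriv_eq_zero_of_le hη j (subset_tsupport _ hne)
    rw [mem_closedBall_zero_iff, Real.norm_eq_abs] at this
    linarith
  refine ⟨fun j t _ => ?_, fun j t ht => ?_⟩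
  · have hcs : HasCompactSupport (iteratedDeriv j ρ) :=
      (isCompact_closedBall 0 η).of_isClosed_subset (isClosed_tsupport _)
        (iteratedDeriv_eq_zero_of_le hη j)
    have := hcs.hasDerivAt_convolution_left (ContinuousLinearMap.lsmul ℝ ℝ) (hρj j)
      (hθ.locallyIntegrable (μ := volume)) t
    rwa [← iteratedDeriv_succ] at this
  · rw [convolution_eq_expTwist hT hψc hψφ (hρj j).continuous (hsupp j) ht,
      convolution_eq_expTwist hT hψc hψφ (hρj (j + 1)).continuous (hsupp (j + 1)) ht]
    have hd : ∀ r, HasDerivAt (fun r => iteratedDeriv j ρ (t - r) * Real.exp (-(a ^ 2 / 4 * r)))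
        (-(iteratedDeriv (j + 1) ρ (t - r) * Real.exp (-(a ^ 2 / 4 * r))) -
          a ^ 2 / 4 * (iteratedDeriv j ρ (t - r) * Real.exp (-(a ^ 2 / 4 * r)))) r := by
      intro r
      have d1 : HasDerivAt (iteratedDeriv j ρ) (iteratedDeriv (j + 1) ρ (t - r)) (t - r) := by
        rw [iteratedDeriv_succ]
        exact ((hρj j).differentiable one_ne_zero _).hasDerivAt
      have d2 : HasDerivAt (fun r => t - r) (-1) r := (hasDerivAt_id r).const_sub t
      have d3 : HasDerivAt (fun r => Real.exp (-(a ^ 2 / 4 * r)))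
          (Real.exp (-(a ^ 2 / 4 * r)) * (-(a ^ 2 / 4 * 1))) r :=
        (((hasDerivAt_id r).const_mul (a ^ 2 / 4)).neg).exp
      refine ((d1.comp r d2).mul d3).congr_deriv ?_
      simp only [Function.comp]
      ring
    have c0 : ∀ j, Continuous fun r =>
        iteratedDeriv j ρ (t - r) * Real.exp (-(a ^ 2 / 4 * r)) := fun j => by
      have := (hρj j).continuous
      fun_prop
    have hz : ∀ r, η' ≤ |t - r| →
        iteratedDeriv j ρ (t - r) * Real.exp (-(a ^ 2 / 4 * r)) = 0 := fun r hr => by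
      rw [hsupp j _ hr, zero_mul]
    have key := kernel_mem_symGraph hL ha hT hφ hψc hψφ hd
      ((c0 (j + 1)).neg.sub ((c0 j).const_mul _))
      (hz 0 (by rw [sub_zero]; exact ht.1.trans (le_abs_self _)))
      (hz T (le_trans (by linarith [ht.2]) (neg_le_abs _)))
    convert key using 1
    rw [← map_smul, ← map_add, ← map_neg]
    congr 1
    simp only [sub_smul, neg_smul, mul_smul (a ^ 2 / 4)]
    rw [intervalIntegral.integral_sub, intervalIntegral.integral_neg,
      intervalIntegral.integral_smul]
    · abel
    · exact (((c0 (j + 1)).smul hψc).neg).intervalIntegrable _ _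
    · have d : Continuous fun r => (a ^ 2 / 4) •
          (iteratedDeriv j ρ (t - r) * Real.exp (-(a ^ 2 / 4 * r))) • ψ r :=
        ((c0 j).smul hψc).const_smul (a ^ 2 / 4)
      exact d.intervalIntegrable _ _

end AdvDiff
end

/-! ### Passage to mild solutions. -/

open MeasureTheory Set
noncomputable section
namespace AdvDiff

open scoped Convolution Topology
open Filter

variable {L : ℝ}

/-- Mollifiers of radius η/(n+2) < η, with η the distance to the ends; uniform continuity of the
transformed solution gives uniform convergence. -/
theorem exists_smooth_approximation (hL : 0 < L) {a T t₀ t₁ : ℝ} (ha : 0 < a) (hT : 0 < T)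
    {φT : StateSpace L} {φ : ℝ → StateSpace L} (hφ : IsMildSolution a 1 (a ^ 2) L T φT φ)
    (ht₀ : 0 < t₀) (ht₁ : t₁ < T) :
    ∃ U : ℕ → ℕ → ℝ → StateSpace L, (∀ n, IsSmoothSolution a L t₀ t₁ (U n)) ∧
      ∀ e > 0, ∀ᶠ n in atTop, ∀ r, dist (U n 0 r) (twisted a hT.le φ r) ≤ e := by
  set η := min t₀ (T - t₁) with hη
  have hη0 : 0 < η := lt_min ht₀ (by linarith)
  have hθ := uniformContinuous_twisted a hT.le hφ.continuousOn
  let b : ℕ → ContDiffBump (0 : ℝ) := fun n =>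
    { rIn := η / (n + 3), rOut := η / (n + 2), rIn_pos := by positivity,
      rIn_lt_rOut := by gcongr; linarith }
  refine ⟨fun n j => iteratedDeriv j ((b n).normed volume) ⋆[ContinuousLinearMap.lsmul ℝ ℝ, volume]
    (twisted a hT.le φ), fun n => ?_, fun e he => ?_⟩
  · have h1 := isSmoothSolution_convolution hL ha hT hφ (ρ := (b n).normed volume)
      (b n).contDiff_normed (η := η / (n + 2)) (η' := η) (by rw [(b n).tsupport_normed_eq])
      (div_lt_self hη0 (by have : (0 : ℝ) ≤ n := Nat.cast_nonneg n
                           linarith))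
    exact h1.mono (min_le_left _ _) (by have := min_le_right t₀ (T - t₁); linarith)
  · obtain ⟨d, hd, hdist⟩ := Metric.uniformContinuous_iff.1 hθ e he
    have hlim : Tendsto (fun n : ℕ => η / ((n : ℝ) + 2)) atTop (𝓝 0) :=
      (tendsto_const_nhds).div_atTop (tendsto_natCast_atTop_atTop.atTop_add tendsto_const_nhds)
    filter_upwards [hlim.eventually (gt_mem_nhds hd)] with n hn r
    rw [iteratedDeriv_zero]
    refine ContDiffBump.dist_normed_convolution_le hθ.continuous.aestronglyMeasurable ?_
    intro x hx
    refine (hdist ?_).le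
    rw [Metric.mem_ball] at hx
    exact hx.trans hn

theorem energy_le_norm_sq {a : ℝ} (ha : 1 ≤ a) (u : StateSpace L) : energy a u ≤ 3 * ‖u‖ ^ 2 := by
  rw [energy_eq]
  have h1 : ‖u.1‖ ^ 2 ≤ ‖u‖ ^ 2 := by gcongr; exact norm_fst_le u
  have h2 : u.2.1 ^ 2 ≤ ‖u‖ ^ 2 := by
    rw [← sq_abs]; gcongr
    exact (norm_fst_le u.2).trans (norm_snd_le u)
  have h3 : u.2.2 ^ 2 ≤ ‖u‖ ^ 2 := by
    rw [← sq_abs]; gcongr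
    exact (norm_snd_le u.2).trans (norm_snd_le u)
  have h4 : (u.2.1 ^ 2 + u.2.2 ^ 2) / a ≤ u.2.1 ^ 2 + u.2.2 ^ 2 :=
    div_le_self (by positivity) ha
  linarith

/-- The dependence on a is harmless: this comparison serves convergence only, not the final
constants. -/
theorem norm_sq_le_mul_energy {a : ℝ} (ha : 1 ≤ a) (u : StateSpace L) :
    ‖u‖ ^ 2 ≤ a * energy a u := by
  have ha0 : 0 < a := by linarith
  have hE := energy_nonneg ha0 u
  have h1 : ‖u.1‖ ≤ √(a * energy a u) := by
    refine Real.le_sqrt_of_sq_le ((norm_sq_le_energy ha0 u).trans ?_)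
    nlinarith
  have h2 : ‖u.2.1‖ ≤ √(a * energy a u) :=
    Real.le_sqrt_of_sq_le (by rw [Real.norm_eq_abs, sq_abs]; exact trace_sq_le_energy ha0 u)
  have h3 : ‖u.2.2‖ ≤ √(a * energy a u) :=
    Real.le_sqrt_of_sq_le (by rw [Real.norm_eq_abs, sq_abs]; exact trace_left_sq_le_energy ha0 u)
  have h4 : ‖u‖ ≤ √(a * energy a u) := norm_prod_le_iff.2 ⟨h1, norm_prod_le_iff.2 ⟨h2, h3⟩⟩
  calc ‖u‖ ^ 2 ≤ √(a * energy a u) ^ 2 := by gcongr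
    _ = _ := Real.sq_sqrt (by positivity)

/-- Observability and smoothing for mild solutions. -/
theorem twisted_observation (hL : 0 < L) {a T t δ : ℝ} {n : ℕ} (ha : 1 ≤ a) (hT : 0 < T)
    {φT : StateSpace L} {φ : ℝ → StateSpace L} (hφ : IsMildSolution a 1 (a ^ 2) L T φT φ)
    (ht : 0 < t) (hδ : 0 < δ) (hδ1 : δ ≤ 1) (htδ : t + δ < T)
    (hn : interpConst L * (4 / δ + a) ≤ n) :
    ∃ f : StateSpace L, IsSymGenerator a L (twisted a hT.le φ t) (-f) ∧
      energy a (twisted a hT.le φ t) ≤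
        Real.exp (19 * n) * ∫ r in (t + δ / 2)..(t + δ), (twisted a hT.le φ r).2.1 ^ 2 ∧
      δ ^ 2 / 2 * energy a f ≤
        Real.exp (19 * n) * ∫ r in (t + δ / 2)..(t + δ), (twisted a hT.le φ r).2.1 ^ 2 := by
  have ha0 : 0 < a := by linarith
  obtain ⟨U, hU, hlim⟩ := exists_smooth_approximation hL ha0 hT hφ ht htδ
  set θ := twisted a hT.le φ with hθdef
  have hθ : Continuous θ := (uniformContinuous_twisted a hT.le hφ.continuousOn).continuous
  have hpt : ∀ r, Tendsto (fun k => U k 0 r) atTop (𝓝 (θ r)) := fun r =>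
    Metric.tendsto_atTop.2 fun e he => by
      obtain ⟨N, hN⟩ := eventually_atTop.1 (hlim (e / 2) (by positivity))
      exact ⟨N, fun k hk => (hN k hk r).trans_lt (by linarith)⟩
  -- bounds for the approximations
  have hobs : ∀ k, energy a (U k 0 (t + δ / 2)) ≤
      Real.exp (19 * n) * ∫ r in (t + δ / 2)..(t + δ), (U k 0 r).2.1 ^ 2 := by
    intro k
    -- Only the second half of the window is observed, whence 4/δ. The first half serves the
    -- smoothing of θ_t, and later the gain e^{-a²δ/4}.
    have h1 := energy_le_observation hL ha (δ := δ / 2) (t := t + δ / 2) (n := n) (by positivity)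
      (by linarith) (by rw [show 2 / (δ / 2) = 4 / δ by field_simp; norm_num]; exact hn)
      ((hU k).mono (by linarith) (by linarith))
    rwa [show t + δ / 2 + δ / 2 = t + δ by ring] at h1
  have hE0 : ∀ k, energy a (U k 0 t) ≤ energy a (U k 0 (t + δ / 2)) := fun k =>
    (hU k).energy_mono hL ha0 0 le_rfl (by linarith) (by linarith)
  have hE1 : ∀ k, δ ^ 2 / 2 * energy a (U k 1 t) ≤ energy a (U k 0 (t + δ / 2)) := fun k => by
    have := (hU k).energy_succ_le hL ha0 0 (t := t) (δ := δ / 2) (by positivity) le_rfl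
      (by linarith)
    rwa [show 2 * (δ / 2) ^ 2 = δ ^ 2 / 2 by ring] at this
  -- the time derivatives converge
  have hcau : CauchySeq fun k => U k 1 t := by
    have hc0 : CauchySeq fun k => U k 0 (t + δ / 2) := (hpt _).cauchySeq
    have hle : ∀ k l, dist (U k 1 t) (U l 1 t) ≤
        √(6 * a) / δ * dist (U k 0 (t + δ / 2)) (U l 0 (t + δ / 2)) := by
      intro k l
      have h1 := ((hU k).sub (hU l)).energy_succ_le hL ha0 0 (t := t) (δ := δ / 2) (by positivity)
        le_rfl (by linarith)
      have h2 := norm_sq_le_mul_energy ha (U k 1 t - U l 1 t)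
      have h3 := energy_le_norm_sq ha (U k 0 (t + δ / 2) - U l 0 (t + δ / 2))
      rw [dist_eq_norm, dist_eq_norm]
      refine abs_le_of_sq_le_sq' ?_ (by positivity) |>.2
      rw [mul_pow, div_pow, Real.sq_sqrt (by positivity), div_mul_eq_mul_div,
        le_div_iff₀ (by positivity)]
      simp only [zero_add] at h1
      calc ‖U k 1 t - U l 1 t‖ ^ 2 * δ ^ 2
          ≤ (a * energy a (U k 1 t - U l 1 t)) * δ ^ 2 := by gcongr
        _ = 2 * a * (2 * (δ / 2) ^ 2 * energy a (U k 1 t - U l 1 t)) := by ring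
        _ ≤ 2 * a * (3 * ‖U k 0 (t + δ / 2) - U l 0 (t + δ / 2)‖ ^ 2) :=
          mul_le_mul_of_nonneg_left (h1.trans h3) (by positivity)
        _ = _ := by ring
    rw [Metric.cauchySeq_iff] at hc0 ⊢
    intro e he
    have hC : 0 < √(6 * a) / δ := by positivity
    obtain ⟨N, hN⟩ := hc0 (e / (√(6 * a) / δ)) (by positivity)
    refine ⟨N, fun k hk l hl => (hle k l).trans_lt ?_⟩
    have := hN k hk l hl
    rw [lt_div_iff₀ hC] at this
    linarith
  obtain ⟨f, hf⟩ := cauchySeq_tendsto_of_complete hcau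
  have hRlim : Tendsto (fun k => Real.exp (19 * n) *
      ∫ r in (t + δ / 2)..(t + δ), (U k 0 r).2.1 ^ 2) atTop
      (𝓝 (Real.exp (19 * n) * ∫ r in (t + δ / 2)..(t + δ), (θ r).2.1 ^ 2)) := by
    refine Tendsto.const_mul _ ?_
    obtain ⟨C, hC⟩ := isCompact_Icc.exists_bound_of_continuousOn
      (s := Icc (t + δ / 2) (t + δ)) hθ.continuousOn
    refine intervalIntegral.tendsto_integral_filter_of_dominated_convergence
      (fun _ => (C + 1) ^ 2) ?_ ?_ intervalIntegrable_const ?_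
    · refine Eventually.of_forall fun k => ContinuousOn.aestronglyMeasurable ?_ measurableSet_uIoc
      intro r hr
      rw [uIoc_of_le (by linarith)] at hr
      exact (((hU k).hasDerivAt 0 r ⟨by linarith [hr.1], hr.2⟩).continuousAt.snd.fst.pow
        2).continuousWithinAt
    · filter_upwards [hlim 1 one_pos] with k hk
      refine Eventually.of_forall fun r hr => ?_
      rw [uIoc_of_le (by linarith)] at hr
      have h1 : ‖U k 0 r‖ ≤ C + 1 := by
        have h2 := hk r
        rw [dist_eq_norm] at h2
        have h3 := norm_sub_norm_le (U k 0 r) (θ r)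
        have h4 := hC r ⟨hr.1.le, hr.2⟩
        linarith
      rw [norm_pow]
      gcongr
      exact ((norm_fst_le _).trans (norm_snd_le (U k 0 r))).trans h1
    · refine Eventually.of_forall fun r _ => ?_
      exact ((continuous_snd.fst.tendsto _).comp (hpt r)).pow 2
  refine ⟨f, ?_, ?_, ?_⟩
  · have hmem : ∀ k, (U k 0 t, -U k 1 t) ∈ symGraph a L := fun k =>
      (hU k).generator 0 t ⟨le_rfl, by linarith⟩
    exact (isClosed_symGraph hL ha0).mem_of_tendsto ((hpt t).prodMk_nhds hf.neg)
      (Eventually.of_forall hmem)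
  · exact le_of_tendsto_of_tendsto' (((continuous_energy a).tendsto _).comp (hpt t)) hRlim
      fun k => (hE0 k).trans (hobs k)
  · exact le_of_tendsto_of_tendsto' ((((continuous_energy a).tendsto _).comp hf).const_mul _) hRlim
      fun k => (hE1 k).trans (hobs k)

end AdvDiff
end

/-! ### Return to the original unknown, uniformly in a. -/

open MeasureTheory Set
noncomputable section
namespace AdvDiff

variable {L : ℝ}

theorem neg_energyForm_neg_le {a : ℝ} (ha : 0 < a) (f u : StateSpace L) :
    -energyForm a (-f) u ≤ (energy a f + energy a u) / 2 := by
  have h1 : inner ℝ f.1 u.1 ≤ (‖f.1‖ ^ 2 + ‖u.1‖ ^ 2) / 2 := by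
    have := real_inner_le_norm f.1 u.1
    nlinarith [sq_nonneg (‖f.1‖ - ‖u.1‖)]
  have h2 : (f.2.1 * u.2.1 + f.2.2 * u.2.2) / a ≤
      ((f.2.1 ^ 2 + f.2.2 ^ 2) / a + (u.2.1 ^ 2 + u.2.2 ^ 2) / a) / 2 := by
    rw [← add_div, div_div, div_le_div_iff₀ ha (by positivity)]
    nlinarith [mul_nonneg ha.le (sq_nonneg (f.2.1 - u.2.1)),
      mul_nonneg ha.le (sq_nonneg (f.2.2 - u.2.2))]
  rw [energy_eq, energy_eq, energyForm]
  simp only [Prod.fst_neg, Prod.snd_neg, inner_neg_left]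
  have h3 : (-f.2.1 * u.2.1 + -f.2.2 * u.2.2) / a = -((f.2.1 * u.2.1 + f.2.2 * u.2.2) / a) := by
    ring
  rw [h3]
  linarith

/-- Undoing the exponential twist: `φ = e^{a² t / 4} e^{-a x / 2} θ` inherits the `H¹` regularity
and the bounds of `θ`. -/
theorem exists_spaceDeriv_of_twisted (hL : 0 < L) {a t : ℝ} (ha : 1 ≤ a) {u θ f : StateSpace L}
    (hθ : θ = Real.exp (-(a ^ 2 / 4 * t)) • expTwist a L u) (hf : IsSymGenerator a L θ (-f)) :
    ∃ g, HasSpaceDeriv L u g ∧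
      (∫ x, u.1 x ^ 2 ∂(volume.restrict (Ioo (-L) 0))) +
        (∫ x, g x ^ 2 ∂(volume.restrict (Ioo (-L) 0))) + u.2.1 ^ 2 + u.2.2 ^ 2 ≤
      Real.exp (a ^ 2 / 2 * t + a * L) * (energy a f + 5 * a ^ 2 * energy a θ) := by
  have ha0 : 0 < a := by linarith
  obtain ⟨v, w, hvw, hv, hw⟩ := hf.exists_deriv hL ha0
  set M := Real.exp (a ^ 2 / 2 * t + a * L) with hM
  set m : ℝ → ℝ := fun x => Real.exp (a ^ 2 / 4 * t - a / 2 * x) with hm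
  have hmM : ∀ x ∈ Ioo (-L) 0, m x ^ 2 ≤ M := fun x hx => by
    rw [hm, hM, ← Real.exp_nat_mul, Real.exp_le_exp]
    push_cast
    nlinarith [hx.1]
  have hmd : ∀ x, HasDerivAt m (-(a / 2) * m x) x := fun x => by
    have h1 : HasDerivAt (fun x : ℝ => a ^ 2 / 4 * t - a / 2 * x) (-(a / 2)) x := by
      simpa using ((hasDerivAt_id x).const_mul (a / 2)).const_sub (a ^ 2 / 4 * t)
    exact h1.exp.congr_deriv (mul_comm _ _)
  have hmc : Continuous m := by fun_prop
  have hH : IsH1 L (fun x => m x * v x) (fun x => -(a / 2) * m x * v x + m x * w x) :=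
    (IsH1.of_hasDerivAt hmd (by fun_prop)).mul hL hvw
  have hinv : ∀ x, m x * (Real.exp (-(a ^ 2 / 4 * t)) * Real.exp (a / 2 * x)) = 1 := fun x => by
    rw [hm, ← Real.exp_add, ← Real.exp_add, Real.exp_eq_one_iff]; ring
  have hae : ∀ᵐ x ∂(volume.restrict (Ioo (-L) 0)), u.1 x = m x * θ.1 x := by
    rw [hθ]
    filter_upwards [Lp.coeFn_smul (Real.exp (-(a ^ 2 / 4 * t))) (expTwist a L u).1,
      coeFn_expTwist a u] with x h1 h2
    rw [Prod.smul_fst, h1, Pi.smul_apply, h2, smul_eq_mul]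
    linear_combination (-u.1 x) * hinv x
  have h0 : u.2.1 = m 0 * θ.2.1 := by
    have : θ.2.1 = Real.exp (-(a ^ 2 / 4 * t)) * u.2.1 := by rw [hθ]; rfl
    rw [this]
    have := hinv 0
    rw [mul_zero, Real.exp_zero] at this
    linear_combination (-u.2.1) * this
  have hl : u.2.2 = m (-L) * θ.2.2 := by
    have : θ.2.2 = Real.exp (-(a ^ 2 / 4 * t)) * (Real.exp (a / 2 * (-L)) * u.2.2) := by
      rw [hθ]; rfl
    rw [this]
    linear_combination (-u.2.2) * hinv (-L)
  have hM0 : 0 < M := Real.exp_pos _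
  have hE0 : 0 ≤ energy a θ := energy_nonneg ha0 θ
  have hvE : ∫ x, v x ^ 2 ∂(volume.restrict (Ioo (-L) 0)) ≤ energy a θ := by
    refine le_trans (le_of_eq ?_) (norm_sq_le_energy ha0 θ)
    rw [norm_sq_eq_integral]
    refine integral_congr_ae ?_
    filter_upwards [hv.1] with x hx
    rw [hx]
  have hwE : ∫ x, w x ^ 2 ∂(volume.restrict (Ioo (-L) 0)) ≤ (energy a f + energy a θ) / 2 := by
    rw [← intervalIntegral_eq_integral_Ioo hL (fun x => w x ^ 2)]
    exact hw.trans (neg_energyForm_neg_le ha0 f θ)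
  have hvi : Integrable (fun x => v x ^ 2) (volume.restrict (Ioo (-L) 0)) :=
    (hvw.memLp hL).integrable_sq
  have hwi : Integrable (fun x => w x ^ 2) (volume.restrict (Ioo (-L) 0)) :=
    hvw.1.integrable_sq
  refine ⟨_, ⟨_, hH, ?_, ?_, ?_⟩, ?_⟩
  · filter_upwards [hae, hv.1] with x h1 h2
    rw [h1, h2]
  · rw [h0, hv.2.1]
  · rw [hl, hv.2.2]
  · have i1 : ∫ x, u.1 x ^ 2 ∂(volume.restrict (Ioo (-L) 0)) ≤ M * energy a θ := by
      calc ∫ x, u.1 x ^ 2 ∂(volume.restrict (Ioo (-L) 0))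
          ≤ ∫ x, M * v x ^ 2 ∂(volume.restrict (Ioo (-L) 0)) := by
            refine integral_mono_ae (Lp.memLp u.1).integrable_sq (hvi.const_mul M) ?_
            filter_upwards [hae, hv.1, ae_restrict_mem measurableSet_Ioo] with x h1 h2 h3
            rw [h1, h2, mul_pow]
            exact mul_le_mul_of_nonneg_right (hmM x h3) (sq_nonneg _)
        _ = M * ∫ x, v x ^ 2 ∂(volume.restrict (Ioo (-L) 0)) := integral_const_mul _ _
        _ ≤ _ := by gcongr
    have i2 : ∫ x, (-(a / 2) * m x * v x + m x * w x) ^ 2 ∂(volume.restrict (Ioo (-L) 0)) ≤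
        M * (2 * ((energy a f + energy a θ) / 2) + a ^ 2 / 2 * energy a θ) := by
      calc ∫ x, (-(a / 2) * m x * v x + m x * w x) ^ 2 ∂(volume.restrict (Ioo (-L) 0))
          ≤ ∫ x, M * (2 * w x ^ 2 + a ^ 2 / 2 * v x ^ 2) ∂(volume.restrict (Ioo (-L) 0)) := by
            refine integral_mono_ae hH.1.integrable_sq
              (((hwi.const_mul 2).add (hvi.const_mul _)).const_mul M) ?_
            filter_upwards [ae_restrict_mem measurableSet_Ioo] with x h3
            have e1 : (-(a / 2) * m x * v x + m x * w x) ^ 2 =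
              m x ^ 2 * (w x - a / 2 * v x) ^ 2 := by ring
            rw [e1]
            refine mul_le_mul (hmM x h3) ?_ (sq_nonneg _) hM0.le
            nlinarith [sq_nonneg (w x + a / 2 * v x)]
        _ = M * (2 * (∫ x, w x ^ 2 ∂(volume.restrict (Ioo (-L) 0))) +
              a ^ 2 / 2 * ∫ x, v x ^ 2 ∂(volume.restrict (Ioo (-L) 0))) := by
            rw [integral_const_mul, integral_add (hwi.const_mul 2) (hvi.const_mul _),
              integral_const_mul, integral_const_mul]
        _ ≤ _ := by gcongr
    have i3 : u.2.1 ^ 2 ≤ M * (a * energy a θ) := by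
      rw [h0, mul_pow]
      refine mul_le_mul ?_ (trace_sq_le_energy ha0 θ) (sq_nonneg _) hM0.le
      rw [hm, hM, ← Real.exp_nat_mul, Real.exp_le_exp]
      push_cast
      nlinarith [mul_pos ha0 hL]
    have i4 : u.2.2 ^ 2 ≤ M * (a * energy a θ) := by
      rw [hl, mul_pow]
      refine mul_le_mul ?_ (trace_left_sq_le_energy ha0 θ) (sq_nonneg _) hM0.le
      rw [hm, hM, ← Real.exp_nat_mul, Real.exp_le_exp]
      push_cast
      nlinarith
    have i5 : (2 + a ^ 2 / 2 + 2 * a) * energy a θ ≤ 5 * a ^ 2 * energy a θ := by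
      refine mul_le_mul_of_nonneg_right ?_ hE0
      nlinarith
    have i6 := mul_le_mul_of_nonneg_left i5 hM0.le
    linarith

/-- The constant in the observability estimate of `state_le_observation`. -/
def observationConst (L : ℝ) : ℝ :=
  (L + 30 + 76 * interpConst L) + (L + 30 + 76 * interpConst L) ^ 2

/-- The terms a²t/2 cancel and leave -a²δ/4. All other costs are at most Dy with y = 1/δ + a: L from
the twist, 11 from the prefactor, 76c + 19 from 19n. Completing the square trades Da for a²δ/4 +
D²/δ, and a disappears. -/
theorem exponent_le {a c δ t : ℝ} {n : ℕ} (hL : 0 < L) (ha : 1 ≤ a) (hδ : 0 < δ) (hδ1 : δ ≤ 1)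
    (hc : 0 < c) (hn : n ≤ c * (4 / δ + a) + 1) :
    Real.exp (a ^ 2 / 2 * t + a * L) * ((2 / δ ^ 2 + 5 * a ^ 2) * (Real.exp (19 * n) *
      Real.exp (-(a ^ 2 / 2 * (t + δ / 2))))) ≤
      Real.exp (((L + 30 + 76 * c) + (L + 30 + 76 * c) ^ 2) / δ) := by
  set y := 1 / δ + a with hy
  have hd1 : 1 ≤ 1 / δ := by rw [le_div_iff₀ hδ]; linarith
  have hy2 : 2 ≤ y := by linarith
  have h1 : 2 / δ ^ 2 + 5 * a ^ 2 ≤ Real.exp (11 * y) := by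
    have e1 : 2 / δ ^ 2 = 2 * (1 / δ) ^ 2 := by field_simp
    have e2 : 2 / δ ^ 2 + 5 * a ^ 2 ≤ 10 * (y ^ 2 / 2) := by
      rw [e1, hy]; nlinarith [mul_pos (by linarith : 0 < 1 / δ) (by linarith : 0 < a)]
    have e3 : y ^ 2 / 2 ≤ Real.exp y := by
      have := Real.quadratic_le_exp_of_nonneg (by linarith : 0 ≤ y)
      linarith
    have e4 : (10 : ℝ) ≤ Real.exp (10 * y) := by
      have := Real.add_one_le_exp (10 * y)
      linarith
    calc _ ≤ _ := e2
      _ ≤ Real.exp (10 * y) * Real.exp y := by gcongr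
      _ = _ := by rw [← Real.exp_add]; ring_nf
  calc _ ≤ Real.exp (a ^ 2 / 2 * t + a * L) * (Real.exp (11 * y) * (Real.exp (19 * n) *
      Real.exp (-(a ^ 2 / 2 * (t + δ / 2))))) := by gcongr
    _ = Real.exp ((a ^ 2 / 2 * t + a * L) + (11 * y + (19 * n +
      -(a ^ 2 / 2 * (t + δ / 2))))) := by rw [← Real.exp_add, ← Real.exp_add, ← Real.exp_add]
    _ ≤ _ := by
      rw [Real.exp_le_exp]
      set D := L + 30 + 76 * c with hD
      have e5 : (D + D ^ 2) / δ = D * (1 / δ) + D ^ 2 / δ := by ring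
      have e6 : D * a ≤ a ^ 2 * δ / 4 + D ^ 2 / δ := by
        rw [← sub_nonneg]
        have : a ^ 2 * δ / 4 + D ^ 2 / δ - D * a = (a * δ / 2 - D) ^ 2 / δ := by
          field_simp; ring
        rw [this]; positivity
      have e7 : c * (4 / δ + a) ≤ 4 * c * y := by
        rw [hy, show 4 / δ = 4 * (1 / δ) by ring]
        nlinarith [mul_pos hc (by linarith : 0 < a)]
      have e8 : a * L ≤ L * y := by nlinarith
      have e9 : D * y = D * (1 / δ) + D * a := by rw [hy]; ring
      have e10 : D * y = L * y + 30 * y + 76 * c * y := by rw [hD]; ring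
      rw [e5]
      nlinarith

theorem state_le_observation (hL : 0 < L) {a T t δ : ℝ} (ha : 1 ≤ a) {φT : StateSpace L}
    {φ : ℝ → StateSpace L} (hφ : IsMildSolution a 1 (a ^ 2) L T φT φ) (ht : 0 < t) (hδ : 0 < δ)
    (hδ1 : δ ≤ 1) (htδ : t + δ < T) :
    ∃ g, HasSpaceDeriv L (φ t) g ∧
      (∫ x, (φ t).1 x ^ 2 ∂(volume.restrict (Ioo (-L) 0))) +
        (∫ x, g x ^ 2 ∂(volume.restrict (Ioo (-L) 0))) + (φ t).2.1 ^ 2 + (φ t).2.2 ^ 2 ≤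
      Real.exp (observationConst L / δ) * ∫ r in t..(t + δ), (φ r).2.1 ^ 2 := by
  have hT : 0 < T := by linarith
  have hn := Nat.le_ceil (interpConst L * (4 / δ + a))
  have hc := interpConst_pos hL
  have hn' := (Nat.ceil_lt_add_one (a := interpConst L * (4 / δ + a)) (by positivity)).le
  set n := ⌈interpConst L * (4 / δ + a)⌉₊ with hndef
  obtain ⟨f, hf, hE, hF⟩ := twisted_observation hL ha hT hφ ht hδ hδ1 htδ hn
  obtain ⟨g, hg, hb⟩ := exists_spaceDeriv_of_twisted hL ha
    (twisted_of_mem a hT.le φ (⟨ht.le, by linarith⟩ : t ∈ Icc 0 T)) hf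
  refine ⟨g, hg, hb.trans ?_⟩
  have hcont : ContinuousOn (fun r => (φ r).2.1 ^ 2) (Icc 0 T) :=
    (hφ.continuousOn.snd.fst).pow 2
  have hint : ∀ x y, x ∈ Icc 0 T → y ∈ Icc 0 T →
      IntervalIntegrable (fun r => (φ r).2.1 ^ 2) volume x y := fun x y hx hy =>
    (hcont.mono (uIcc_subset_Icc hx hy)).intervalIntegrable
  have m1 : t ∈ Icc 0 T := ⟨ht.le, by linarith⟩
  have m2 : t + δ / 2 ∈ Icc 0 T := ⟨by linarith, by linarith⟩
  have m3 : t + δ ∈ Icc 0 T := ⟨by linarith, by linarith⟩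
  -- At x = 0 the twist is just e^{-a²r/4}, largest at the left end of the observed half window.
  have hobs : ∫ r in (t + δ / 2)..(t + δ), (twisted a hT.le φ r).2.1 ^ 2 ≤
      Real.exp (-(a ^ 2 / 2 * (t + δ / 2))) * ∫ r in t..(t + δ), (φ r).2.1 ^ 2 := by
    calc ∫ r in (t + δ / 2)..(t + δ), (twisted a hT.le φ r).2.1 ^ 2
        ≤ ∫ r in (t + δ / 2)..(t + δ),
            Real.exp (-(a ^ 2 / 2 * (t + δ / 2))) * (φ r).2.1 ^ 2 := by
          refine intervalIntegral.integral_mono_on (by linarith) ?_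
            ((hint _ _ m2 m3).const_mul _) fun r hr => ?_
          · exact ((uniformContinuous_twisted a hT.le
              hφ.continuousOn).continuous.snd.fst.pow 2).intervalIntegrable _ _
          · rw [twisted_of_mem a hT.le φ ⟨by linarith [hr.1], by linarith [hr.2]⟩]
            rw [Prod.smul_snd, Prod.smul_fst, expTwist_right, smul_eq_mul, mul_pow,
              ← Real.exp_nat_mul]
            refine mul_le_mul_of_nonneg_right ?_ (sq_nonneg _)
            rw [Real.exp_le_exp]
            push_cast
            nlinarith [mul_le_mul_of_nonneg_left hr.1 (sq_nonneg a)]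
      _ = Real.exp (-(a ^ 2 / 2 * (t + δ / 2))) *
            ∫ r in (t + δ / 2)..(t + δ), (φ r).2.1 ^ 2 := by
          rw [intervalIntegral.integral_const_mul]
      _ ≤ _ := by
          refine mul_le_mul_of_nonneg_left ?_ (Real.exp_pos _).le
          rw [← intervalIntegral.integral_add_adjacent_intervals (hint _ _ m1 m2) (hint _ _ m2 m3)]
          have : 0 ≤ ∫ r in t..(t + δ / 2), (φ r).2.1 ^ 2 :=
            intervalIntegral.integral_nonneg (by linarith) fun _ _ => sq_nonneg _
          linarith
  set I := ∫ r in t..(t + δ), (φ r).2.1 ^ 2 with hI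
  set J := ∫ r in (t + δ / 2)..(t + δ), (twisted a hT.le φ r).2.1 ^ 2 with hJ
  have hI0 : 0 ≤ I := intervalIntegral.integral_nonneg (by linarith) fun _ _ => sq_nonneg _
  have hF' : energy a f ≤ 2 / δ ^ 2 * (Real.exp (19 * n) * J) := by
    rw [div_mul_eq_mul_div, le_div_iff₀ (by positivity)]
    linarith
  calc _ ≤ Real.exp (a ^ 2 / 2 * t + a * L) * (2 / δ ^ 2 * (Real.exp (19 * n) * J) +
        5 * a ^ 2 * (Real.exp (19 * n) * J)) := by gcongr
    _ = Real.exp (a ^ 2 / 2 * t + a * L) * ((2 / δ ^ 2 + 5 * a ^ 2) * (Real.exp (19 * n) * J)) := by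
      ring
    _ ≤ Real.exp (a ^ 2 / 2 * t + a * L) * ((2 / δ ^ 2 + 5 * a ^ 2) * (Real.exp (19 * n) *
        (Real.exp (-(a ^ 2 / 2 * (t + δ / 2))) * I))) := by gcongr
    _ = Real.exp (a ^ 2 / 2 * t + a * L) * ((2 / δ ^ 2 + 5 * a ^ 2) * (Real.exp (19 * n) *
        Real.exp (-(a ^ 2 / 2 * (t + δ / 2))))) * I := by ring
    _ ≤ _ := mul_le_mul_of_nonneg_right (exponent_le hL ha hδ hδ1 hc hn') hI0

end AdvDiff
end

/-! ### Comparison of the weights and averaging over windows. -/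

open MeasureTheory Set
noncomputable section
namespace AdvDiff

variable {L : ℝ}

/-- A common bound, in terms of `y = s / (t (T - t))`, for the weights on the left-hand side of the
Carleman inequality. -/
def weightBound (L K y : ℝ) : ℝ :=
  (y ^ 3 + y) * Real.exp (6 * L) * Real.exp (-2 * (K - Real.exp (2 * L)) * y)

theorem weightBound_nonneg (L K : ℝ) {y : ℝ} (hy : 0 ≤ y) : 0 ≤ weightBound L K y := by
  unfold weightBound; positivity

theorem exp_weight_mono {K y E : ℝ} (hy : 0 ≤ y) (hE : E ≤ Real.exp (2 * L)) :
    Real.exp (-2 * (K - E) * y) ≤ Real.exp (-2 * (K - Real.exp (2 * L)) * y) := by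
  rw [Real.exp_le_exp]
  nlinarith

theorem cube_weight_le (L K : ℝ) {s P E : ℝ} (hs : 0 ≤ s) (hP : 0 < P) (hE : 0 < E)
    (hE' : E ≤ Real.exp (2 * L)) :
    s ^ 3 * ((E / P) ^ 3 * Real.exp (-2 * s * ((K - E) / P))) ≤ weightBound L K (s / P) := by
  have hy : 0 ≤ s / P := by positivity
  have h1 : s ^ 3 * ((E / P) ^ 3 * Real.exp (-2 * s * ((K - E) / P))) =
      (s / P) ^ 3 * E ^ 3 * Real.exp (-2 * (K - E) * (s / P)) := by
    rw [show -2 * s * ((K - E) / P) = -2 * (K - E) * (s / P) by ring]; ring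
  have h2 : E ^ 3 ≤ Real.exp (6 * L) := by
    calc E ^ 3 ≤ Real.exp (2 * L) ^ 3 := by gcongr
      _ = _ := by rw [← Real.exp_nat_mul]; push_cast; ring_nf
  rw [h1, weightBound]
  refine mul_le_mul ?_ (exp_weight_mono hy hE') (Real.exp_pos _).le (by positivity)
  gcongr
  linarith

theorem weight_le (hL : 0 < L) (K : ℝ) {s P E : ℝ} (hs : 0 ≤ s) (hP : 0 < P) (hE : 0 < E)
    (hE' : E ≤ Real.exp (2 * L)) :
    s * ((E / P) * Real.exp (-2 * s * ((K - E) / P))) ≤ weightBound L K (s / P) := by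
  have hy : 0 ≤ s / P := by positivity
  have h1 : s * ((E / P) * Real.exp (-2 * s * ((K - E) / P))) =
      (s / P) * E * Real.exp (-2 * (K - E) * (s / P)) := by
    rw [show -2 * s * ((K - E) / P) = -2 * (K - E) * (s / P) by ring]; ring
  have h2 : E ≤ Real.exp (6 * L) := hE'.trans (Real.exp_le_exp.2 (by linarith))
  have h3 : 0 ≤ (s / P) ^ 3 := by positivity
  rw [h1, weightBound]
  refine mul_le_mul ?_ (exp_weight_mono hy hE') (Real.exp_pos _).le (by positivity)
  gcongr
  linarith

theorem cube_add_self_mul_exp_le {b y : ℝ} (hb : 0 < b) (hy : 0 ≤ y) :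
    (y ^ 3 + y) * Real.exp (-(b * y / 2)) ≤ 48 / b ^ 3 + 2 / b := by
  set z := b * y / 2 with hz
  have hz0 : 0 ≤ z := by positivity
  have hyz : y = 2 / b * z := by rw [hz]; field_simp
  have h1 : z ^ 3 ≤ 6 * Real.exp z := by
    have := Real.pow_div_factorial_le_exp z hz0 3
    rw [div_le_iff₀ (by positivity)] at this
    norm_num [Nat.factorial] at this
    linarith
  have h2 : z ≤ Real.exp z := by linarith [Real.add_one_le_exp z]
  rw [Real.exp_neg, ← div_eq_mul_inv, div_le_iff₀ (Real.exp_pos z)]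
  calc y ^ 3 + y = 8 / b ^ 3 * z ^ 3 + 2 / b * z := by rw [hyz]; field_simp; ring
    _ ≤ 8 / b ^ 3 * (6 * Real.exp z) + 2 / b * Real.exp z := by gcongr
    _ = _ := by ring

/-- The origin of the condition s ≥ s₀(T + T²): it forces y·min(1, T-t) ≥ s₀, so y dominates the
inverse window length. -/
theorem mul_sub_le_min_mul {t T : ℝ} (ht : t ∈ Ioo 0 T) :
    t * (T - t) ≤ min 1 (T - t) * (T + T ^ 2) := by
  obtain ⟨h0, h1⟩ := ht
  have hT : 0 < T := h0.trans h1
  have h2 : 0 < T - t := by linarith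
  rcases le_total 1 (T - t) with h | h
  · rw [min_eq_left h]
    calc t * (T - t) ≤ T * T := by gcongr; linarith
      _ ≤ _ := by linarith [sq T]
  · rw [min_eq_right h, mul_comm]
    gcongr
    linarith [sq_nonneg T]

/-- Comparison of the weights at time `t` on the left-hand side with the weights on the
observation window `[t, t + κ min(1, T - t)]` on the right-hand side. -/
theorem exists_weight_comparison (hL : 0 < L) {K : ℝ} (hK : Real.exp (2 * L) < K) (C₁ : ℝ) :
    ∃ κ s₀ C : ℝ, 0 < κ ∧ κ ≤ 1 / 2 ∧ 0 < s₀ ∧ 0 < C ∧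
      ∀ T s t r : ℝ, s₀ * (T + T ^ 2) ≤ s → t ∈ Ioo 0 T → r ∈ Icc t (t + κ * min 1 (T - t)) →
        weightBound L K (s / (t * (T - t))) * Real.exp (C₁ / (κ * min 1 (T - t))) ≤
          C * s ^ 9 * (Real.exp (-4 * s * ((K - Real.exp (2 * L)) / (r * (T - r))) +
            2 * s * ((K - Real.exp L) / (r * (T - r)))) * (Real.exp (2 * L) / (r * (T - r))) ^ 9) := by
  set A := K - Real.exp (2 * L) with hA
  have hA0 : 0 < A := by linarith
  set c := Real.exp (2 * L) - Real.exp L with hc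
  have hc0 : 0 < c := by
    have : Real.exp L < Real.exp (2 * L) := Real.exp_lt_exp.2 (by linarith)
    linarith
  -- The weight on the right has exponent -2(A - c)s/(r(T-r)). As A - c may be negative and
  -- s/(r(T-r)) is controlled only from above, A - c is replaced by its positive part, still below
  -- A.
  set m := max (A - c) 0 with hm
  have hm0 : 0 ≤ m := le_max_right _ _
  have hmA : m < A := max_lt (by linarith) hA0
  have hmc : A - c ≤ m := le_max_left _ _
  set b := A - m with hb
  have hb0 : 0 < b := by linarith
  -- Small enough that 2m ≤ (1 - κ)(A + m): moving from t to r inflates s/(r(T-r)) by at most 1/(1 -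
  -- κ).
  set κ := min (1 / 2) (b / (A + m)) with hκ
  have hAm : 0 < A + m := by linarith
  have hκ0 : 0 < κ := lt_min (by norm_num) (by positivity)
  have hκ2 : κ ≤ 1 / 2 := min_le_left _ _
  have hκb : κ * (A + m) ≤ b := by
    rw [← le_div_iff₀ hAm]; exact min_le_right _ _
  -- Makes the observation cost C₁/(κ min(1, T-t)) at most by/2.
  set s₀ := 1 + |2 * C₁ / (b * κ)| with hs₀
  have hs1 : 1 ≤ s₀ := by linarith [abs_nonneg (2 * C₁ / (b * κ))]
  have hsC : 2 * C₁ ≤ s₀ * (b * κ) := by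
    rw [← div_le_iff₀ (by positivity)]
    linarith [le_abs_self (2 * C₁ / (b * κ))]
  refine ⟨κ, s₀, Real.exp (6 * L) * (48 / b ^ 3 + 2 / b), hκ0, hκ2, by linarith, by positivity, ?_⟩
  intro T s t r hs ht hr
  obtain ⟨ht0, htT⟩ := ht
  have hT0 : 0 < T := ht0.trans htT
  have hs0 : 0 < s := lt_of_lt_of_le (by positivity) hs
  set d := min 1 (T - t) with hd
  have hd0 : 0 < d := lt_min one_pos (by linarith)
  have hdT : d ≤ T - t := min_le_right _ _
  have hP0 : 0 < t * (T - t) := mul_pos ht0 (by linarith)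
  have hκd : κ * d ≤ κ * (T - t) := by gcongr
  have hTr : (1 - κ) * (T - t) ≤ T - r := by linarith [hr.2]
  have hTr0 : 0 < T - r := lt_of_lt_of_le (mul_pos (by linarith) (by linarith)) hTr
  have hr0 : 0 < r := ht0.trans_le hr.1
  have hQ0 : 0 < r * (T - r) := mul_pos hr0 hTr0
  have hQP : (1 - κ) * (t * (T - t)) ≤ r * (T - r) := by
    calc (1 - κ) * (t * (T - t)) = t * ((1 - κ) * (T - t)) := by ring
      _ ≤ r * (T - r) := mul_le_mul hr.1 hTr (mul_nonneg (by linarith) (by linarith)) hr0.le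
  set P := t * (T - t) with hP
  set Q := r * (T - r) with hQ
  set y := s / P with hy
  have hy0 : 0 < y := by positivity
  -- the parameter dominates the observation cost
  have hyd : s₀ ≤ y * d := by
    have hdP : P ≤ d * (T + T ^ 2) := mul_sub_le_min_mul ⟨ht0, htT⟩
    rw [hy, div_mul_eq_mul_div, le_div_iff₀ hP0]
    calc s₀ * P ≤ s₀ * (d * (T + T ^ 2)) := by gcongr
      _ = s₀ * (T + T ^ 2) * d := by ring
      _ ≤ s * d := by gcongr
  have hcost : C₁ / (κ * d) ≤ b * y / 2 := by
    rw [div_le_iff₀ (by positivity)]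
    calc C₁ ≤ s₀ * (b * κ) / 2 := by linarith
      _ ≤ y * d * (b * κ) / 2 := by gcongr
      _ = _ := by ring
  -- the weight on the right-hand side
  have hsQ : 1 ≤ s * (Real.exp (2 * L) / Q) := by
    have h1 : Q ≤ s := by
      have h3 : Q ≤ T * T := by rw [hQ]; gcongr <;> linarith
      have h4 : 1 * (T + T ^ 2) ≤ s₀ * (T + T ^ 2) := by gcongr
      linarith [sq T]
    have h2 : 1 ≤ Real.exp (2 * L) := Real.one_le_exp (by linarith)
    rw [← mul_div_assoc, le_div_iff₀ hQ0, one_mul]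
    exact h1.trans (le_mul_of_one_le_right hs0.le h2)
  have hexp : -(A + m) * y ≤ -4 * s * (A / Q) + 2 * s * ((K - Real.exp L) / Q) := by
    have e1 : -4 * s * (A / Q) + 2 * s * ((K - Real.exp L) / Q) = -(2 * (A - c)) * (s / Q) := by
      rw [hA, hc]; field_simp; ring
    have e2 : 2 * m * (s / Q) ≤ (A + m) * y := by
      rw [hy, mul_div_assoc', mul_div_assoc', div_le_div_iff₀ hQ0 hP0]
      have : 2 * m ≤ (1 - κ) * (A + m) := by linarith
      calc 2 * m * s * P ≤ (1 - κ) * (A + m) * s * P := by gcongr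
        _ = (A + m) * s * ((1 - κ) * P) := by ring
        _ ≤ (A + m) * s * Q := by gcongr
    have e3 : 2 * (A - c) * (s / Q) ≤ 2 * m * (s / Q) := by gcongr
    rw [e1]
    linarith
  have hR : Real.exp (-(A + m) * y) ≤ s ^ 9 * (Real.exp (-4 * s * (A / Q) +
      2 * s * ((K - Real.exp L) / Q)) * (Real.exp (2 * L) / Q) ^ 9) := by
    calc Real.exp (-(A + m) * y) ≤ Real.exp (-4 * s * (A / Q) + 2 * s * ((K - Real.exp L) / Q)) :=
          Real.exp_le_exp.2 hexp
      _ ≤ Real.exp (-4 * s * (A / Q) + 2 * s * ((K - Real.exp L) / Q)) *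
          (s * (Real.exp (2 * L) / Q)) ^ 9 :=
          le_mul_of_one_le_right (Real.exp_pos _).le (one_le_pow₀ hsQ)
      _ = _ := by ring
  -- The surplus 2A - (A + m) = b is split in two: one half pays the observation cost, the other
  -- absorbs y³ + y.
  calc weightBound L K y * Real.exp (C₁ / (κ * d))
      ≤ weightBound L K y * Real.exp (b * y / 2) :=
        mul_le_mul_of_nonneg_left (Real.exp_le_exp.2 hcost) (weightBound_nonneg L K hy0.le)
    _ = Real.exp (6 * L) * ((y ^ 3 + y) * Real.exp (-(b * y / 2))) * Real.exp (-(A + m) * y) := by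
        have : Real.exp (-2 * A * y) * Real.exp (b * y / 2) =
            Real.exp (-(b * y / 2)) * Real.exp (-(A + m) * y) := by
          rw [← Real.exp_add, ← Real.exp_add, hb]; ring_nf
        rw [weightBound]
        linear_combination (y ^ 3 + y) * Real.exp (6 * L) * this
    _ ≤ Real.exp (6 * L) * (48 / b ^ 3 + 2 / b) * (s ^ 9 * (Real.exp (-4 * s * (A / Q) +
          2 * s * ((K - Real.exp L) / Q)) * (Real.exp (2 * L) / Q) ^ 9)) := by
        refine mul_le_mul ?_ hR (Real.exp_pos _).le (by positivity)
        exact mul_le_mul_of_nonneg_left (cube_add_self_mul_exp_le hb0 hy0.le) (Real.exp_pos _).le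
    _ = _ := by ring

/-- Averaging: a function bounded by integrals over forward windows of length at most one. -/
theorem lintegral_le_of_window {T : ℝ} {f H : ℝ → ENNReal} {d : ℝ → ℝ}
    (hH : AEMeasurable H (volume.restrict (Ioo 0 T)))
    (hd : ∀ t ∈ Ioo 0 T, d t ≤ 1) (hdT : ∀ t ∈ Ioo 0 T, t + d t < T)
    (hf : ∀ t ∈ Ioo 0 T, f t ≤ ∫⁻ r in Ioc t (t + d t), H r) :
    ∫⁻ t in Ioo 0 T, f t ≤ ∫⁻ r in Ioo 0 T, H r := by
  set μ := volume.restrict (Ioo 0 T) with hμ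
  -- Enlarging the windows to unit length makes the region measurable whatever `d` is. After
  -- exchanging the integrals, each r is met only by t in [r-1, r], a set of measure 1.
  set S : Set (ℝ × ℝ) := {p | p.2 ∈ Ioc p.1 (p.1 + 1)} with hS
  have hSm : MeasurableSet S :=
    (measurableSet_lt measurable_fst measurable_snd).inter
      (measurableSet_le measurable_snd (measurable_fst.add_const 1))
  calc ∫⁻ t in Ioo 0 T, f t
      ≤ ∫⁻ t in Ioo 0 T, ∫⁻ r in Ioo 0 T, S.indicator (fun p => H p.2) (t, r) := by
        refine setLIntegral_mono' measurableSet_Ioo fun t ht => (hf t ht).trans ?_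
        have h1 : ∫⁻ r in Ioo 0 T, S.indicator (fun p => H p.2) (t, r) =
            ∫⁻ r in Ioo 0 T, (Ioc t (t + 1)).indicator H r := rfl
        rw [h1, setLIntegral_indicator measurableSet_Ioc]
        refine lintegral_mono_set fun r hr => ⟨⟨hr.1, ?_⟩, ht.1.trans hr.1, ?_⟩
        · linarith [hr.2, hd t ht]
        · linarith [hr.2, hdT t ht]
    _ = ∫⁻ r in Ioo 0 T, ∫⁻ t in Ioo 0 T, S.indicator (fun p => H p.2) (t, r) := by
        refine lintegral_lintegral_swap ?_
        exact (hH.comp_snd).indicator hSm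
    _ ≤ ∫⁻ r in Ioo 0 T, H r := by
        refine lintegral_mono fun r => ?_
        calc ∫⁻ t in Ioo 0 T, S.indicator (fun p => H p.2) (t, r)
            ≤ ∫⁻ t in Ioo 0 T, (Icc (r - 1) r).indicator (fun _ => H r) t := by
              refine lintegral_mono fun t => ?_
              by_cases h : (t, r) ∈ S
              · rw [indicator_of_mem h, indicator_of_mem]
                exact ⟨by linarith [h.2], h.1.le⟩
              · rw [indicator_of_notMem h]; exact zero_le
          _ ≤ ∫⁻ t, (Icc (r - 1) r).indicator (fun _ => H r) t := setLIntegral_le_lintegral _ _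
          _ = H r := by
              rw [lintegral_indicator measurableSet_Icc, setLIntegral_const, Real.volume_Icc]
              simp

theorem lintegral_enorm_sq {α : Type*} [MeasurableSpace α] {μ : Measure α} {g : α → ℝ}
    (hg : Integrable (fun x => g x ^ 2) μ) :
    ∫⁻ x, ‖g x‖ₑ ^ 2 ∂μ = ENNReal.ofReal (∫ x, g x ^ 2 ∂μ) := by
  rw [ofReal_integral_eq_lintegral_ofReal hg (Filter.Eventually.of_forall fun x => sq_nonneg _)]
  refine lintegral_congr fun x => ?_
  rw [Real.enorm_eq_ofReal_abs, ← ENNReal.ofReal_pow (abs_nonneg _), sq_abs]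

end AdvDiff
end

/-! ### The Carleman inequality, uniformly in a ≥ 1. -/

open MeasureTheory Set
noncomputable section
namespace AdvDiff

variable {L : ℝ}

theorem eta_zero (L : ℝ) : eta L 0 = 2 * L := by unfold eta; ring

theorem eta_neg_self (L : ℝ) : eta L (-L) = L := by unfold eta; ring

theorem ofReal_mul_setLIntegral_le {k B : ℝ} (hk : 0 ≤ k) {S : Set ℝ} (hS : MeasurableSet S)
    {w g : ℝ → ℝ} (hw : ∀ x ∈ S, k * w x ≤ B) (hg : IntegrableOn (fun x => g x ^ 2) S) :
    ENNReal.ofReal k * ∫⁻ x in S, ENNReal.ofReal (w x) * ‖g x‖ₑ ^ 2 ≤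
      ENNReal.ofReal B * ENNReal.ofReal (∫ x in S, g x ^ 2) := by
  rw [← lintegral_enorm_sq hg, ← lintegral_const_mul' _ _ ENNReal.ofReal_ne_top,
    ← lintegral_const_mul' _ _ ENNReal.ofReal_ne_top]
  refine setLIntegral_mono' hS fun x hx => ?_
  rw [← mul_assoc, ← ENNReal.ofReal_mul hk]
  gcongr
  exact hw x hx

/-- The Carleman inequality for `φ_t + a φ_x + φ_xx = 0`, uniformly in `a ≥ 1`. -/
theorem exists_carleman_estimate (hL : 0 < L) {K : ℝ} (hK : Real.exp (2 * L) < K) :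
    ∃ C : ℝ, 0 < C ∧ ∃ s₀ : ℝ, 0 < s₀ ∧ ∀ a : ℝ, 1 ≤ a → ∀ T : ℝ, 0 < T →
      ∀ s : ℝ, s₀ * (T + T ^ 2) ≤ s → ∀ (φT : StateSpace L) (φ : ℝ → StateSpace L),
        IsMildSolution a 1 (a ^ 2) L T φT φ →
        CarlemanInequality L T s C (fun t x => (K - Real.exp (eta L x)) / (t * (T - t)))
          (fun t x => Real.exp (eta L x) / (t * (T - t))) φ := by
  obtain ⟨κ, s₀, C, hκ0, hκ, hs₀, hC, hcomp⟩ :=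
    exists_weight_comparison hL hK (observationConst L)
  -- Each of the four terms on the left is bounded by the same integral, hence the factor 4.
  refine ⟨4 * C, by positivity, s₀, hs₀, fun a ha T hT s hs φT φ hφ => ?_⟩
  have hs0 : 0 < s := lt_of_lt_of_le (by positivity) hs
  set d : ℝ → ℝ := fun t => κ * min 1 (T - t) with hd
  have hd0 : ∀ t ∈ Ioo 0 T, 0 < d t := fun t ht =>
    mul_pos hκ0 (lt_min one_pos (by linarith [ht.2]))
  have hd1 : ∀ t ∈ Ioo 0 T, d t ≤ 1 := fun t ht => by
    have h1 : d t ≤ κ * 1 := mul_le_mul_of_nonneg_left (min_le_left _ _) hκ0.le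
    linarith
  have hdT : ∀ t ∈ Ioo 0 T, t + d t < T := fun t ht => by
    have h1 : d t ≤ κ * (T - t) := mul_le_mul_of_nonneg_left (min_le_right _ _) hκ0.le
    have h2 : κ * (T - t) ≤ 1 / 2 * (T - t) :=
      mul_le_mul_of_nonneg_right hκ (by linarith [ht.2])
    linarith [ht.2]
  have hex : ∀ t, ∃ g, t ∈ Ioo 0 T → HasSpaceDeriv L (φ t) g ∧
      (∫ x, (φ t).1 x ^ 2 ∂(volume.restrict (Ioo (-L) 0))) +
        (∫ x, g x ^ 2 ∂(volume.restrict (Ioo (-L) 0))) + (φ t).2.1 ^ 2 + (φ t).2.2 ^ 2 ≤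
      Real.exp (observationConst L / d t) * ∫ r in t..(t + d t), (φ r).2.1 ^ 2 := fun t => by
    by_cases ht : t ∈ Ioo 0 T
    · obtain ⟨g, hg⟩ := state_le_observation hL ha hφ ht.1 (hd0 t ht) (hd1 t ht) (hdT t ht)
      exact ⟨g, fun _ => hg⟩
    · exact ⟨0, fun h => absurd h ht⟩
  choose φx hφx using hex
  have hae : ∀ᵐ t ∂(volume.restrict (Ioo 0 T)), HasSpaceDeriv L (φ t) (φx t) := by
    filter_upwards [ae_restrict_mem measurableSet_Ioo] with t ht using (hφx t ht).1
  refine ⟨φx, hae, ?_⟩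
  set W : ℝ → ℝ := fun r => Real.exp (-4 * s * ((K - Real.exp (eta L 0)) / (r * (T - r))) +
    2 * s * ((K - Real.exp (eta L (-L))) / (r * (T - r)))) *
      (Real.exp (eta L 0) / (r * (T - r))) ^ 9 with hW
  set H : ℝ → ENNReal := fun r => ENNReal.ofReal (C * s ^ 9 * W r) * ‖(φ r).2.1‖ₑ ^ 2 with hH
  have htr : ContinuousOn (fun r => (φ r).2.1) (Icc 0 T) := hφ.continuousOn.snd.fst
  have hHm : AEMeasurable H (volume.restrict (Ioo 0 T)) := by
    have h1 : AEMeasurable (fun r => (φ r).2.1) (volume.restrict (Ioo 0 T)) :=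
      (htr.mono Ioo_subset_Icc_self).aemeasurable measurableSet_Ioo
    have h2 : Measurable W := by rw [hW]; fun_prop
    exact ((h2.const_mul _).ennreal_ofReal.aemeasurable).mul (h1.enorm.pow_const 2)
  -- Stated for any q below the observed sum, so that one bound serves the interior, derivative and
  -- trace terms.
  have key : ∀ t ∈ Ioo 0 T, ∀ q : ℝ, q ≤
      (∫ x, (φ t).1 x ^ 2 ∂(volume.restrict (Ioo (-L) 0))) +
        (∫ x, φx t x ^ 2 ∂(volume.restrict (Ioo (-L) 0))) + (φ t).2.1 ^ 2 + (φ t).2.2 ^ 2 →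
      ENNReal.ofReal (weightBound L K (s / (t * (T - t)))) * ENNReal.ofReal q ≤
        ∫⁻ r in Ioc t (t + d t), H r := by
    intro t ht q hq
    have hP : 0 < t * (T - t) := mul_pos ht.1 (by linarith [ht.2])
    have hwb := weightBound_nonneg L K (by positivity : 0 ≤ s / (t * (T - t)))
    have hsub : Icc t (t + d t) ⊆ Icc 0 T := Icc_subset_Icc ht.1.le (hdT t ht).le
    have hint : IntegrableOn (fun r => (φ r).2.1 ^ 2) (Ioc t (t + d t)) :=
      ((htr.mono hsub).pow 2).integrableOn_Icc.mono_set Ioc_subset_Icc_self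
    calc ENNReal.ofReal (weightBound L K (s / (t * (T - t)))) * ENNReal.ofReal q
        ≤ ENNReal.ofReal (weightBound L K (s / (t * (T - t)))) * ENNReal.ofReal
          (Real.exp (observationConst L / d t) * ∫ r in t..(t + d t), (φ r).2.1 ^ 2) := by
          gcongr; exact hq.trans (hφx t ht).2
      _ = ENNReal.ofReal (weightBound L K (s / (t * (T - t))) *
            Real.exp (observationConst L / d t)) *
            ∫⁻ r in Ioc t (t + d t), ‖(φ r).2.1‖ₑ ^ 2 := by
          rw [lintegral_enorm_sq hint, intervalIntegral.integral_of_le (by linarith [hd0 t ht]),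
            ENNReal.ofReal_mul (Real.exp_pos _).le, ENNReal.ofReal_mul hwb, mul_assoc]
      _ ≤ _ := by
          rw [← lintegral_const_mul' _ _ ENNReal.ofReal_ne_top]
          refine setLIntegral_mono' measurableSet_Ioc fun r hr => ?_
          refine mul_le_mul_left (ENNReal.ofReal_le_ofReal ?_) _
          rw [hW, eta_zero, eta_neg_self]
          exact hcomp T s t r hs ht ⟨hr.1.le, hr.2⟩
  have hmain : ∀ (k : ℝ) (f : ℝ → ENNReal),
      (∀ t ∈ Ioo 0 T, ENNReal.ofReal k * f t ≤ ∫⁻ r in Ioc t (t + d t), H r) →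
      ENNReal.ofReal k * ∫⁻ t in Ioo 0 T, f t ≤ ∫⁻ r in Ioo 0 T, H r := fun k f hf => by
    rw [← lintegral_const_mul' _ _ ENNReal.ofReal_ne_top]
    exact lintegral_le_of_window hHm hd1 hdT hf
  have hEx : ∀ x ∈ Icc (-L) 0, Real.exp (eta L x) ≤ Real.exp (2 * L) := fun x hx => by
    rw [Real.exp_le_exp, eta]; linarith [hx.2]
  have hint1 : ∀ t, 0 ≤ ∫ x, (φ t).1 x ^ 2 ∂(volume.restrict (Ioo (-L) 0)) := fun t =>
    integral_nonneg fun _ => sq_nonneg _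
  have hint2 : ∀ t, 0 ≤ ∫ x, φx t x ^ 2 ∂(volume.restrict (Ioo (-L) 0)) := fun t =>
    integral_nonneg fun _ => sq_nonneg _
  have hPpos : ∀ t ∈ Ioo 0 T, 0 < t * (T - t) := fun t ht => mul_pos ht.1 (by linarith [ht.2])
  have htrace : ∀ (x : ℝ) (hx : x ∈ Icc (-L) 0) (t : ℝ) (ht : t ∈ Ioo 0 T) (p : ℝ)
      (_ : p ^ 2 ≤ (∫ x, (φ t).1 x ^ 2 ∂(volume.restrict (Ioo (-L) 0))) +
        (∫ x, φx t x ^ 2 ∂(volume.restrict (Ioo (-L) 0))) + (φ t).2.1 ^ 2 + (φ t).2.2 ^ 2),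
      ENNReal.ofReal (s ^ 3) * (ENNReal.ofReal ((Real.exp (eta L x) / (t * (T - t))) ^ 3 *
        Real.exp (-2 * s * ((K - Real.exp (eta L x)) / (t * (T - t))))) * ‖p‖ₑ ^ 2) ≤
        ∫⁻ r in Ioc t (t + d t), H r := fun x hx t ht p hp => by
    refine le_trans ?_ (key t ht _ hp)
    rw [← mul_assoc, ← ENNReal.ofReal_mul (by positivity), Real.enorm_eq_ofReal_abs,
      ← ENNReal.ofReal_pow (abs_nonneg _), sq_abs]
    gcongr
    exact cube_weight_le L K hs0.le (hPpos t ht) (Real.exp_pos _) (hEx x hx)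
  have b1 : ENNReal.ofReal (s ^ 3) * (∫⁻ t in Ioo 0 T, ∫⁻ x in Ioo (-L) 0,
      ENNReal.ofReal ((Real.exp (eta L x) / (t * (T - t))) ^ 3 *
        Real.exp (-2 * s * ((K - Real.exp (eta L x)) / (t * (T - t))))) * ‖(φ t).1 x‖ₑ ^ 2) ≤
      ∫⁻ r in Ioo 0 T, H r := by
    refine hmain _ _ fun t ht => ?_
    refine le_trans (ofReal_mul_setLIntegral_le (by positivity) measurableSet_Ioo (fun x hx =>
      cube_weight_le L K hs0.le (hPpos t ht) (Real.exp_pos _) (hEx x (Ioo_subset_Icc_self hx)))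
      (Lp.memLp (φ t).1).integrable_sq) (key t ht _ ?_)
    linarith [hint2 t, sq_nonneg (φ t).2.1, sq_nonneg (φ t).2.2]
  have b2 : ENNReal.ofReal s * (∫⁻ t in Ioo 0 T, ∫⁻ x in Ioo (-L) 0,
      ENNReal.ofReal ((Real.exp (eta L x) / (t * (T - t))) *
        Real.exp (-2 * s * ((K - Real.exp (eta L x)) / (t * (T - t))))) * ‖φx t x‖ₑ ^ 2) ≤
      ∫⁻ r in Ioo 0 T, H r := by
    refine hmain _ _ fun t ht => ?_
    obtain ⟨v, hv, -⟩ := (hφx t ht).1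
    refine le_trans (ofReal_mul_setLIntegral_le hs0.le measurableSet_Ioo (fun x hx =>
      weight_le hL K hs0.le (hPpos t ht) (Real.exp_pos _) (hEx x (Ioo_subset_Icc_self hx)))
      hv.1.integrable_sq) (key t ht _ ?_)
    linarith [hint1 t, sq_nonneg (φ t).2.1, sq_nonneg (φ t).2.2]
  have b3 := hmain (s ^ 3) _ fun t ht =>
    htrace 0 ⟨by linarith, le_rfl⟩ t ht (φ t).2.1
      (by linarith [hint1 t, hint2 t, sq_nonneg (φ t).2.2])
  have b4 := hmain (s ^ 3) _ fun t ht =>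
    htrace (-L) ⟨le_rfl, by linarith⟩ t ht (φ t).2.2
      (by linarith [hint1 t, hint2 t, sq_nonneg (φ t).2.1])
  have hRHS : ENNReal.ofReal (4 * C * s ^ 9) * ∫⁻ t in Ioo 0 T,
      ENNReal.ofReal (W t) * ‖(φ t).2.1‖ₑ ^ 2 = 4 * ∫⁻ r in Ioo 0 T, H r := by
    have h1 : ∫⁻ r in Ioo 0 T, H r = ENNReal.ofReal (C * s ^ 9) * ∫⁻ t in Ioo 0 T,
        ENNReal.ofReal (W t) * ‖(φ t).2.1‖ₑ ^ 2 := by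
      rw [← lintegral_const_mul' _ _ ENNReal.ofReal_ne_top]
      refine lintegral_congr fun r => ?_
      rw [hH, ← mul_assoc, ← ENNReal.ofReal_mul (by positivity)]
    rw [h1, mul_assoc 4 C, ENNReal.ofReal_mul (by norm_num), mul_assoc]
    norm_num
  rw [hRHS, mul_add]
  refine (add_le_add (add_le_add b1 b2) (add_le_add b3 b4)).trans (le_of_eq ?_)
  ring

end AdvDiff
end

/-! ### Change of time scale and conclusion. -/

open MeasureTheory Set
noncomputable section
namespace AdvDiff

variable {L : ℝ}

theorem CarlemanInequality.mono {T s C C' : ℝ} {α ϕ : ℝ → ℝ → ℝ} {φ : ℝ → StateSpace L}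
    (hs : 0 ≤ s) (hC : C ≤ C') (h : CarlemanInequality L T s C α ϕ φ) :
    CarlemanInequality L T s C' α ϕ φ := by
  obtain ⟨φx, h1, h2⟩ := h
  refine ⟨φx, h1, h2.trans ?_⟩
  gcongr

theorem setLIntegral_Ioo_mul_left {c : ℝ} (hc : 0 < c) (T : ℝ) (F : ℝ → ENNReal) :
    ∫⁻ t in Ioo 0 (c * T), F t = ENNReal.ofReal c * ∫⁻ t in Ioo 0 T, F (c * t) := by
  have h := lintegral_image_eq_lintegral_abs_deriv_mul (s := Ioo 0 T) (f := fun t => c * t)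
    (f' := fun _ => c) measurableSet_Ioo
    (fun t _ => by simpa using ((hasDerivAt_id t).const_mul c).hasDerivWithinAt)
    (mul_right_injective₀ hc.ne').injOn F
  rw [Set.image_mul_left_Ioo hc, mul_zero] at h
  rw [h, abs_of_pos hc, lintegral_const_mul' _ _ ENNReal.ofReal_ne_top]

/-- Invariance of the Carleman inequality under a linear change of time. -/
theorem CarlemanInequality.comp_mul_left {c T s C : ℝ} (hc : 0 < c) {α ϕ : ℝ → ℝ → ℝ}
    {φ : ℝ → StateSpace L} (h : CarlemanInequality L (c * T) s C α ϕ φ) :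
    CarlemanInequality L T s C (fun t => α (c * t)) (fun t => ϕ (c * t)) (fun t => φ (c * t)) := by
  obtain ⟨φx, h1, h2⟩ := h
  refine ⟨fun t => φx (c * t), ?_, ?_⟩
  · have hq : Measure.QuasiMeasurePreserving (fun t : ℝ => c * t) volume volume := by
      refine ⟨measurable_const_mul c, ?_⟩
      rw [Real.map_volume_mul_left hc.ne']
      exact Measure.smul_absolutelyContinuous
    rw [ae_restrict_iff' measurableSet_Ioo] at h1 ⊢
    filter_upwards [hq.ae h1] with t ht hmem
    exact ht ⟨mul_pos hc hmem.1, mul_lt_mul_of_pos_left hmem.2 hc⟩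
  · simp only [setLIntegral_Ioo_mul_left hc] at h2
    have hc0 : ENNReal.ofReal c ≠ 0 := by simpa using hc
    rw [← ENNReal.mul_le_mul_iff_right hc0 ENNReal.ofReal_ne_top]
    refine le_trans (le_of_eq ?_) (h2.trans (le_of_eq ?_)) <;> ring

/-- The factor ε on u is the Jacobian: u will be a time integral, while f is a difference of states
and does not scale. -/
theorem IsGenerator.rescale {ε : ℝ} (hε : 0 < ε) {u f : StateSpace L}
    (h : IsGenerator 1 ε (1 / ε) L u f) : IsGenerator (1 / ε) 1 ((1 / ε) ^ 2) L (ε • u) f := by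
  obtain ⟨v, w, z, h1, h2, h3, h4, h5, h6⟩ := h
  refine ⟨_, _, _, h1.const_mul ε, h2.const_mul ε, h3.smul ε, ?_, ?_, ?_⟩
  · filter_upwards [h4] with x hx
    rw [hx]; field_simp
  · rw [h5]; field_simp
  · rw [h6]; field_simp

theorem IsMildSolution.rescale {ε T : ℝ} (hε : 0 < ε) {φT : StateSpace L}
    {φ : ℝ → StateSpace L} (h : IsMildSolution 1 ε (1 / ε) L T φT φ) :
    IsMildSolution (1 / ε) 1 ((1 / ε) ^ 2) L (ε * T) φT (fun t => φ (t / ε)) := by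
  have hmaps : ∀ t ∈ Icc 0 (ε * T), t / ε ∈ Icc 0 T := fun t ht =>
    ⟨div_nonneg ht.1 hε.le, by rw [div_le_iff₀ hε, mul_comm]; exact ht.2⟩
  have hT : ε * T / ε = T := by field_simp
  refine ⟨h.continuousOn.comp (by fun_prop) hmaps, ?_, fun t ht => ?_⟩
  · simp only [hT, h.terminal]
  · rw [intervalIntegral.integral_comp_div φ hε.ne', hT]
    exact (h.equation _ (hmaps t ht)).rescale hε

end AdvDiff
end

theorem theorem2 (L : ℝ) (hL : 0 < L) (K : ℝ) (hK : Real.exp (2 * L) < K) :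
    (∃ C : ℝ, 0 < C ∧ ∃ s₀ : ℝ, 0 < s₀ ∧
      ∀ ε : ℝ, 0 < ε → ε < 1 → ∀ T : ℝ, 0 < T →
      ∀ s : ℝ, s₀ * (ε * T + ε ^ 2 * T ^ 2) ≤ s →
      ∀ (φT : AdvDiff.StateSpace L) (φ : ℝ → AdvDiff.StateSpace L),
        AdvDiff.IsAdjointSolution ε L T φT φ →
        AdvDiff.CarlemanInequality L T s C
          (fun t x => AdvDiff.alpha ε L K T t x) (fun t x => AdvDiff.phi ε L T t x) φ) ∧
    (∃ C : ℝ, 0 < C ∧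
      ∀ ε : ℝ, 0 < ε → ε < 1 → ∀ T' : ℝ, 0 < T' →
      ∀ s : ℝ, C * (T' + T' ^ 2 + ε⁻¹ * T' ^ 2
          + ε ^ (1 / 3 : ℝ) * T' ^ (2 / 3 : ℝ)) ≤ s →
      ∀ (φT : AdvDiff.StateSpace L) (φ : ℝ → AdvDiff.StateSpace L),
        AdvDiff.IsRescaledAdjointSolution ε L T' φT φ →
        AdvDiff.CarlemanInequality L T' s C
          (fun t x => AdvDiff.alpha ε L K (T' / ε) (t / ε) x)
          (fun t x => AdvDiff.phi ε L (T' / ε) (t / ε) x) φ) := by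
  obtain ⟨C, hC, s₀, hs₀, h⟩ := AdvDiff.exists_carleman_estimate hL hK
  have ha : ∀ ε : ℝ, 0 < ε → ε < 1 → 1 ≤ 1 / ε := fun ε h0 h1 => by
    rw [le_div_iff₀ h0]; linarith
  refine ⟨⟨C, hC, s₀, hs₀, fun ε hε hε1 T hT s hs φT φ hφ => ?_⟩,
    -- In (ii) one constant bounds s from below and multiplies the right side. The terms with powers
    -- of ε only strengthen the condition on s.
    ⟨max C s₀, lt_max_of_lt_left hC, fun ε hε hε1 T hT s hs φT φ hφ => ?_⟩⟩
  · have h1 := h (1 / ε) (ha ε hε hε1) (ε * T) (by positivity) s (by rwa [mul_pow]) φT _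
      (AdvDiff.IsMildSolution.rescale hε hφ)
    have h2 := h1.comp_mul_left hε
    have e1 : ∀ t, ε * t / ε = t := fun t => by field_simp
    have e2 : ∀ t, ε * t * (ε * T - ε * t) = ε ^ 2 * t * (T - t) := fun t => by ring
    simp only [e1, e2] at h2
    exact h2
  · have e1 : ∀ t, ε ^ 2 * (t / ε) * (T / ε - t / ε) = t * (T - t) := fun t => by field_simp
    have hs' : s₀ * (T + T ^ 2) ≤ s := by
      refine le_trans ?_ hs
      have h1 : 0 ≤ ε⁻¹ * T ^ 2 := by positivity
      have h2 : 0 ≤ ε ^ (1 / 3 : ℝ) * T ^ (2 / 3 : ℝ) := by positivity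
      exact mul_le_mul (le_max_right _ _) (by linarith) (by positivity) (by positivity)
    have hφ' : AdvDiff.IsMildSolution (1 / ε) 1 ((1 / ε) ^ 2) L T φT φ := by
      rw [div_pow, one_pow]; exact hφ
    have h1 := h (1 / ε) (ha ε hε hε1) T hT s hs' φT φ hφ'
    have hs0 : 0 ≤ s := le_trans (by positivity) hs'
    simp only [AdvDiff.alpha, AdvDiff.phi, e1]
    exact h1.mono hs0 (le_max_left _ _)
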